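/- Let $G$ be a finite group, let $k$ be an algebraically closed field whose characteristic does not divide $|G|$, and let $n\ge 1$. Let $\Sigma_n^G$ be the monoid of ordered $G$-partitions $((P_1,g_1),\dots,(P_r,g_r))$ of $[n]=\{1,\dots,n\}$, where $P_1,\dots,P_r$ are the distinct blocks of a set partition of $[n]$ and $g_1,\dots,g_r\in G$; the product of $((P_1,g_1),\dots,(P_r,g_r))$ and $((Q_1,h_1),\dots,(Q_s,h_s))$ is the sequence of all $(P_i\cap Q_j,\,g_ih_j)$, ordered lexicographically by $(i,j)$, with empty intersections omitted. The quiver of the algebra $k\Sigma_n^G$ has as vertices the simple left $k\Sigma_n^G$-modules up to isomorphism, and it has $\dim_k \mathrm{Ext}^1_{k\Sigma_n^G}(S,T)$ arrows from $S$ to $T$. Let $\mathrm{Irr}\,G$ be the set of simple left $kG$-modules up to isomorphism. An $\mathrm{Irr}\,G$-labelled set partition of $[n]$ is a set $P=\{(P_1,V_1),\dots,(P_r,V_r)\}$, where $P_1,\dots,P_r$ are the distinct blocks of a set partition of $[n]$ and $V_1,\dots,V_r\in\mathrm{Irr}\,G$. For such a $P$ let $S_P$ be the $k\Sigma_n^G$-module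 with underlying space $V_1\otimes_k\cdots\otimes_k V_r$ on which $\sigma=((Q_1,h_1),\dots,(Q_s,h_s))$ acts as follows: if every $P_i$ is contained in a block $Q_{j(i)}$ of $\sigma$, then $\sigma(v_1\otimes\cdots\otimes v_r)=h_{j(1)}v_1\otimes\cdots\otimes h_{j(r)}v_r$; otherwise $\sigma$ acts as zero. Then $P\mapsto S_P$ is a bijection from the set of $\mathrm{Irr}\,G$-labelled set partitions of $[n]$ onto the vertex set of the quiver of $k\Sigma_n^G$. Under this identification the arrows are as follows. For every $\mathrm{Irr}\,G$-labelled set partition $P=\{(P_1,V_1),\dots,(P_r,V_r)\}$, all $i\ne j$ in $\{1,\dots,r\}$ and every $U\in\mathrm{Irr}\,G$, there are exactly $\dim_k\mathrm{Hom}_{kG}(U,V_i\otimes_k V_j)$ arrows from $P$ to $$\{(P_i\cup P_j,U)\}\cup\bigl(P\setminus\{(P_i,V_i),(P_j,V_j)\}\bigr),$$ where $G$ acts diagonally on $V_i\otimes_k V_j$. There are no arrows between two labelled set partitions other than these. -/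

import Mathlib

open CategoryTheory
open scoped TensorProduct

universe u v w

/-! ### Simple modules and the Gabriel quiver of an algebra -/

section Quiver

/-- Isomorphism of simple left `A`-modules. -/
def simpleModuleSetoid (A : Type w) [Ring A] :
    Setoid {M : ModuleCat.{w} A // IsSimpleModule A M} where
  r M N := Nonempty (M.1 ≃ₗ[A] N.1)
  iseqv :=
    ⟨fun _ => ⟨LinearEquiv.refl _ _⟩, fun ⟨e⟩ => ⟨e.symm⟩, fun ⟨e⟩ ⟨f⟩ => ⟨e.trans f⟩⟩

/-- The set of simple left `A`-modules, taken up to isomorphism. Every simple module is a quotient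
of `A`, so nothing is lost by taking modules in the universe of `A`. -/
def SimpleClass (A : Type w) [Ring A] : Type (w + 1) :=
  Quotient (simpleModuleSetoid A)

/-- A simple module in the given isomorphism class. -/
noncomputable def SimpleClass.rep {A : Type w} [Ring A] (S : SimpleClass A) : ModuleCat.{w} A :=
  (Quotient.out S).1

/-- The Gabriel quiver of a `k`-algebra `A`: its vertices are the elements of `SimpleClass A`, and
the number of arrows from `S` to `T` is `dim_k Ext¹_A(S, T)`, for left modules. -/
noncomputable def gabrielArrows (k : Type u) [Field k] (A : Type w) [Ring A] [Algebra k A]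
    (S T : SimpleClass A) : Cardinal.{w} :=
  Module.rank k (Abelian.Ext.{w} S.rep T.rep 1)

variable (k : Type u) [Field k] (G : Type v) [Group G]

/-- `Irr G`: the set of simple left `kG`-modules, up to isomorphism. -/
abbrev Irr : Type (max u v + 1) := SimpleClass (MonoidAlgebra k G)

variable {k G}

/-- The underlying `k`-vector space of a simple `kG`-module. -/
abbrev Irr.Space (V : Irr k G) : Type (max u v) :=
  RestrictScalars k (MonoidAlgebra k G) (SimpleClass.rep V)

/-- The action of `G` on a simple `kG`-module. -/
noncomputable abbrev Irr.action (V : Irr k G) : Representation k G (Irr.Space V) :=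
  Representation.ofModule (SimpleClass.rep V)

/-- `dim_k Hom_{kG}(U, V ⊗ W)`, where `G` acts diagonally on `V ⊗ W`. -/
noncomputable def dimHomTensor (U V W : Irr k G) : Cardinal.{max u v} :=
  Module.rank k
    ((Irr.action U).IntertwiningMap ((Irr.action V).tprod (Irr.action W)))

end Quiver

/-! ### The monoid of ordered `G`-partitions -/

/-- An ordered `G`-partition `((P₁, g₁), …, (P_r, g_r))` of the `n`-element set: the `P_i` are
nonempty, pairwise disjoint, and they cover the set. -/
@[ext]
structure OrderedGPartition (n : ℕ) (G : Type v) : Type v where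
  parts : List (Finset (Fin n) × G)
  nonempty : ∀ p ∈ parts, p.1.Nonempty
  disjoint : parts.Pairwise fun p q => Disjoint p.1 q.1
  cover : ∀ x : Fin n, ∃ p ∈ parts, x ∈ p.1

namespace OrderedGPartition

variable {n : ℕ} {G : Type v}

/-- The sequence of all `(P_i ∩ Q_j, g_i h_j)`, in lexicographic order of `(i, j)`, where empty
intersections are omitted. -/
def mulParts [Mul G] (l m : List (Finset (Fin n) × G)) : List (Finset (Fin n) × G) :=
  ((l.product m).map fun x => (x.1.1 ∩ x.2.1, x.1.2 * x.2.2)).filter fun p => p.1.Nonempty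

theorem mem_mulParts [Mul G] {l m : List (Finset (Fin n) × G)} {p : Finset (Fin n) × G} :
    p ∈ mulParts l m ↔
      ∃ a ∈ l, ∃ b ∈ m, (a.1 ∩ b.1, a.2 * b.2) = p ∧ p.1.Nonempty := by
  simp only [mulParts, List.mem_filter, List.mem_map, List.pair_mem_product, Prod.exists,
    decide_eq_true_eq]
  constructor
  · rintro ⟨⟨a, b, c, d, ⟨h1, h2⟩, rfl⟩, h⟩
    exact ⟨a, b, h1, c, d, h2, rfl, h⟩
  · rintro ⟨a, b, h1, c, d, h2, rfl, h⟩
    exact ⟨⟨a, b, c, d, ⟨h1, h2⟩, rfl⟩, h⟩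

theorem mulParts_nil [Mul G] (m : List (Finset (Fin n) × G)) : mulParts [] m = [] := rfl

theorem mulParts_cons [Mul G] (p : Finset (Fin n) × G) (l m : List (Finset (Fin n) × G)) :
    mulParts (p :: l) m =
      ((m.map fun q => (p.1 ∩ q.1, p.2 * q.2)).filter fun r => r.1.Nonempty) ++
        mulParts l m := by
  simp [mulParts, List.product, Function.comp_def]

theorem mulParts_append [Mul G] (l l' m : List (Finset (Fin n) × G)) :
    mulParts (l ++ l') m = mulParts l m ++ mulParts l' m := by
  induction l with
  | nil => rfl
  | cons p l ih => simp [mulParts_cons, ih]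

theorem pairwise_mulParts [Mul G] {l m : List (Finset (Fin n) × G)}
    (hl : l.Pairwise fun p q => Disjoint p.1 q.1) (hm : m.Pairwise fun p q => Disjoint p.1 q.1) :
    (mulParts l m).Pairwise fun p q => Disjoint p.1 q.1 := by
  induction l with
  | nil => simp [mulParts_nil]
  | cons a l ih =>
    rw [List.pairwise_cons] at hl
    rw [mulParts_cons, List.pairwise_append]
    refine ⟨?_, ih hl.2, ?_⟩
    · refine List.Pairwise.filter _ (List.Pairwise.map _ ?_ hm)
      intro p q h
      exact Finset.disjoint_of_subset_left Finset.inter_subset_right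
        (Finset.disjoint_of_subset_right Finset.inter_subset_right h)
    · intro p hp q hq
      simp only [List.mem_filter, List.mem_map] at hp
      obtain ⟨⟨b, _, rfl⟩, -⟩ := hp
      obtain ⟨c, hc, d, _, rfl, -⟩ := mem_mulParts.1 hq
      exact Finset.disjoint_of_subset_left Finset.inter_subset_left
        (Finset.disjoint_of_subset_right Finset.inter_subset_left (hl.1 c hc))

theorem mulParts_assoc [Semigroup G] (l m r : List (Finset (Fin n) × G)) :
    mulParts (mulParts l m) r = mulParts l (mulParts m r) := by
  induction l with
  | nil => rfl
  | cons p l ih =>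
    rw [mulParts_cons p l m, mulParts_append, ih, mulParts_cons p l]
    congr 1
    clear ih
    induction m with
    | nil => rfl
    | cons q m ihm =>
      rw [mulParts_cons q m r, List.map_append, List.filter_append, ← ihm, List.map_cons,
        List.filter_cons]
      split_ifs with h
      · rw [mulParts_cons]
        congr 1
        simp only [List.filter_map, List.map_map, List.filter_filter]
        have : ∀ t : Finset (Fin n) × G, ((p.1 ∩ q.1) ∩ t.1).Nonempty →
            (q.1 ∩ t.1).Nonempty := fun t ht =>
          ht.mono (by rw [Finset.inter_assoc]; exact Finset.inter_subset_right)
        rw [show ((fun q => (p.1 ∩ q.1, p.2 * q.2)) ∘ fun t : Finset (Fin n) × G =>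
            (q.1 ∩ t.1, q.2 * t.2)) = fun t : Finset (Fin n) × G =>
            ((p.1 ∩ q.1) ∩ t.1, (p.2 * q.2) * t.2) from by
          funext t; simp [Finset.inter_assoc, mul_assoc]]
        congr 1
        apply List.filter_congr
        intro t _
        have ht := this t
        simp only [Function.comp, Finset.inter_assoc] at ht ⊢
        by_cases h1 : (p.1 ∩ (q.1 ∩ t.1)).Nonempty
        · simp [h1, ht h1]
        · simp [h1]
      · symm
        rw [List.append_left_eq_self]
        simp only [List.filter_eq_nil_iff, List.mem_map, List.mem_filter]
        rintro _ ⟨_, ⟨⟨t, _, rfl⟩, _⟩, rfl⟩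
        simp only [decide_eq_true_eq] at h ⊢
        intro h'
        exact h (h'.mono (by rw [← Finset.inter_assoc]; exact Finset.inter_subset_left))

instance [Mul G] : Mul (OrderedGPartition n G) where
  mul σ τ :=
    { parts := mulParts σ.parts τ.parts
      nonempty := fun _ hp => by
        obtain ⟨_, _, _, _, _, h⟩ := mem_mulParts.1 hp
        exact h
      disjoint := pairwise_mulParts σ.disjoint τ.disjoint
      cover := fun x => by
        obtain ⟨a, ha, hxa⟩ := σ.cover x
        obtain ⟨b, hb, hxb⟩ := τ.cover x
        have hx : x ∈ a.1 ∩ b.1 := Finset.mem_inter.2 ⟨hxa, hxb⟩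
        exact ⟨_, mem_mulParts.2 ⟨a, ha, b, hb, rfl, ⟨x, hx⟩⟩, hx⟩ }

theorem mul_parts [Mul G] (σ τ : OrderedGPartition n G) :
    (σ * τ).parts = mulParts σ.parts τ.parts := rfl

/-- The identity element is `((the whole set, 1))`. -/
instance [One G] [NeZero n] : One (OrderedGPartition n G) where
  one :=
    { parts := [(Finset.univ, 1)]
      nonempty := by simp [Finset.univ_nonempty]
      disjoint := by simp
      cover := by simp }

theorem one_parts [One G] [NeZero n] :
    (1 : OrderedGPartition n G).parts = [(Finset.univ, 1)] := rfl

instance [Monoid G] [NeZero n] : Monoid (OrderedGPartition n G) where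
  mul_assoc σ τ ρ := OrderedGPartition.ext (mulParts_assoc _ _ _)
  one_mul σ := OrderedGPartition.ext <| by
    rw [mul_parts, one_parts, mulParts_cons, mulParts_nil]
    simpa using σ.nonempty
  mul_one σ := OrderedGPartition.ext <| by
    rw [mul_parts, one_parts]
    have h := σ.nonempty
    generalize σ.parts = l at h ⊢
    induction l with
    | nil => rfl
    | cons p l ih =>
      rw [mulParts_cons, ih fun q hq => h q (List.mem_cons_of_mem _ hq)]
      simp [h p List.mem_cons_self]

/-- Two parts of an ordered `G`-partition which share a point are equal. -/
theorem eq_of_mem (σ : OrderedGPartition n G) {p q : Finset (Fin n) × G} (hp : p ∈ σ.parts)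
    (hq : q ∈ σ.parts) {x : Fin n} (hxp : x ∈ p.1) (hxq : x ∈ q.1) : p = q := by
  by_contra hne
  have : Std.Symm fun p q : Finset (Fin n) × G => Disjoint p.1 q.1 := ⟨fun _ _ h => h.symm⟩
  exact Finset.disjoint_left.1 (σ.disjoint.forall hp hq hne) hxp hxq

end OrderedGPartition

/-! ### Labelled set partitions -/

/-- An `X`-labelled set partition `{(P₁, x₁), …, (P_r, x_r)}` of the `n`-element set. -/
@[ext]
structure LabelledSetPartition (n : ℕ) (X : Type w) : Type w where
  carrier : Set (Finset (Fin n) × X)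
  nonempty : ∀ p ∈ carrier, p.1.Nonempty
  disjoint : ∀ p ∈ carrier, ∀ q ∈ carrier, p ≠ q → Disjoint p.1 q.1
  cover : ∀ x : Fin n, ∃ p ∈ carrier, x ∈ p.1

namespace LabelledSetPartition

variable {n : ℕ} {X : Type w}

/-- The blocks of a labelled set partition. -/
def Block (P : LabelledSetPartition n X) : Type :=
  {B : Finset (Fin n) // ∃ x, (B, x) ∈ P.carrier}

/-- The label of a block. -/
noncomputable def label (P : LabelledSetPartition n X) (B : P.Block) : X := B.2.choose

theorem label_mem (P : LabelledSetPartition n X) (B : P.Block) :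
    (B.1, P.label B) ∈ P.carrier := B.2.choose_spec

theorem label_eq (P : LabelledSetPartition n X) (B : P.Block) {x : X}
    (h : (B.1, x) ∈ P.carrier) : P.label B = x := by
  by_contra hne
  have hd := P.disjoint _ (P.label_mem B) _ h (fun e => hne (congrArg Prod.snd e))
  exact (P.nonempty _ h).ne_empty (disjoint_self.1 hd)

/-- The labelled set partition `{(B ∪ C, U)} ∪ P \ {(B, x_B), (C, x_C)}`, for two different blocks
`B` and `C` of `P`. -/
noncomputable def merge (P : LabelledSetPartition n X) (B C : P.Block) (_hBC : B ≠ C) (U : X) :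
    LabelledSetPartition n X where
  carrier := {(B.1 ∪ C.1, U)} ∪ (P.carrier \ {(B.1, P.label B), (C.1, P.label C)})
  nonempty := by
    rintro p (rfl | hp)
    · exact (P.nonempty _ (P.label_mem B)).mono Finset.subset_union_left
    · exact P.nonempty _ hp.1
  disjoint := by
    have key : ∀ p ∈ P.carrier \ {(B.1, P.label B), (C.1, P.label C)},
        Disjoint p.1 (B.1 ∪ C.1) := by
      rintro p ⟨hp, hne⟩
      simp only [Set.mem_insert_iff, Set.mem_singleton_iff, not_or] at hne
      exact Finset.disjoint_union_right.2
        ⟨P.disjoint _ hp _ (P.label_mem B) hne.1, P.disjoint _ hp _ (P.label_mem C) hne.2⟩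
    rintro p (rfl | hp) q (rfl | hq) hne
    · exact absurd rfl hne
    · exact (key q hq).symm
    · exact key p hp
    · exact P.disjoint _ hp.1 _ hq.1 hne
  cover := by
    intro x
    obtain ⟨p, hp, hx⟩ := P.cover x
    by_cases h : p ∈ ({(B.1, P.label B), (C.1, P.label C)} : Set (Finset (Fin n) × X))
    · refine ⟨_, Or.inl rfl, ?_⟩
      simp only [Set.mem_insert_iff, Set.mem_singleton_iff] at h
      rcases h with rfl | rfl
      · exact Finset.mem_union_left _ hx
      · exact Finset.mem_union_right _ hx
    · exact ⟨p, Or.inr ⟨hp, h⟩, hx⟩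

end LabelledSetPartition

/-! ### The simple module attached to a labelled set partition -/

namespace LabelledSetPartition

variable {n : ℕ} {G : Type v}

/-- Every block of `P` lies in a block of `σ`: in the refinement order, the set partition which
underlies `P` is below the one which underlies `σ`. -/
def Refines {X : Type w} (P : LabelledSetPartition n X) (σ : OrderedGPartition n G) : Prop :=
  ∀ B : P.Block, ∃ q ∈ σ.parts, B.1 ⊆ q.1

/-- If `P` refines `σ`, the element of `G` that `σ` attaches to its block containing `B`. -/
noncomputable def Refines.value {X : Type w} {P : LabelledSetPartition n X}
    {σ : OrderedGPartition n G} (h : P.Refines σ) (B : P.Block) : G :=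
  (h B).choose.2

section

variable {X : Type w} {P : LabelledSetPartition n X} {σ τ : OrderedGPartition n G}

theorem Refines.value_eq (h : P.Refines σ) (B : P.Block) {q : Finset (Fin n) × G}
    (hq : q ∈ σ.parts) (hB : B.1 ⊆ q.1) : h.value B = q.2 := by
  obtain ⟨x, hx⟩ := P.nonempty _ (P.label_mem B)
  exact congrArg Prod.snd
    (σ.eq_of_mem (h B).choose_spec.1 hq ((h B).choose_spec.2 hx) (hB hx))

theorem refines_mul [Group G] : P.Refines (σ * τ) ↔ P.Refines σ ∧ P.Refines τ := by
  constructor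
  · intro h
    constructor <;> intro B
    · obtain ⟨_, hq, hB⟩ := h B
      obtain ⟨a, ha, b, hb, rfl, -⟩ := OrderedGPartition.mem_mulParts.1 hq
      exact ⟨a, ha, hB.trans Finset.inter_subset_left⟩
    · obtain ⟨_, hq, hB⟩ := h B
      obtain ⟨a, ha, b, hb, rfl, -⟩ := OrderedGPartition.mem_mulParts.1 hq
      exact ⟨b, hb, hB.trans Finset.inter_subset_right⟩
  · rintro ⟨h, h'⟩ B
    obtain ⟨a, ha, hBa⟩ := h B
    obtain ⟨b, hb, hBb⟩ := h' B
    have hB := Finset.subset_inter hBa hBb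
    exact ⟨_, OrderedGPartition.mem_mulParts.2
      ⟨a, ha, b, hb, rfl, (P.nonempty _ (P.label_mem B)).mono hB⟩, hB⟩

theorem Refines.value_mul [Group G] (h : P.Refines (σ * τ)) (hσ : P.Refines σ) (hτ : P.Refines τ)
    (B : P.Block) : h.value B = hσ.value B * hτ.value B := by
  have hB := Finset.subset_inter (hσ B).choose_spec.2 (hτ B).choose_spec.2
  exact h.value_eq B (OrderedGPartition.mem_mulParts.2
    ⟨_, (hσ B).choose_spec.1, _, (hτ B).choose_spec.1, rfl,
      (P.nonempty _ (P.label_mem B)).mono hB⟩) hB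

theorem refines_one [Group G] [NeZero n] : P.Refines (1 : OrderedGPartition n G) :=
  fun B => ⟨(Finset.univ, 1), by simp [OrderedGPartition.one_parts], Finset.subset_univ _⟩

theorem Refines.value_one [Group G] [NeZero n] (h : P.Refines (1 : OrderedGPartition n G)) (B : P.Block) :
    h.value B = 1 :=
  h.value_eq B (q := (Finset.univ, 1)) (by simp [OrderedGPartition.one_parts])
    (Finset.subset_univ _)

end

variable {k : Type u} [Field k] [Group G]

/-- The vector space `V₁ ⊗ ⋯ ⊗ V_r` for `P = {(P₁, V₁), …, (P_r, V_r)}`. -/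
abbrev Space (P : LabelledSetPartition n (Irr k G)) : Type (max u v) :=
  PiTensorProduct k fun B : P.Block => Irr.Space (P.label B)

open scoped Classical in
/-- The simple module of the monoid of ordered `G`-partitions which belongs to
`P = {(P₁, V₁), …, (P_r, V_r)}`, on the space `V₁ ⊗ ⋯ ⊗ V_r`. If each `P_i` lies in a block of `σ`
and `σ` attaches `g_i` to that block, then `σ (v₁ ⊗ ⋯ ⊗ v_r) = g₁ v₁ ⊗ ⋯ ⊗ g_r v_r`; every other
`σ` acts as zero. So the elements of the `J`-class of `{P₁, …, P_r}` act through
`((P_{i₁}, g_{i₁}), …) ↦ (g₁, …, g_r)`, and those not above this `J`-class act as zero. -/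
noncomputable def action [NeZero n] (P : LabelledSetPartition n (Irr k G)) :
    Representation k (OrderedGPartition n G) P.Space where
  toFun σ :=
    if h : P.Refines σ then
      PiTensorProduct.map fun B => Irr.action (P.label B) (h.value B)
    else 0
  map_one' := by
    rw [dif_pos refines_one]
    simp only [Refines.value_one, map_one]
    exact PiTensorProduct.map_one
  map_mul' σ τ := by
    by_cases h : P.Refines (σ * τ)
    · obtain ⟨hσ, hτ⟩ := refines_mul.1 h
      rw [dif_pos h, dif_pos hσ, dif_pos hτ]
      simp only [Refines.value_mul h hσ hτ, map_mul]
      exact PiTensorProduct.map_mul _ _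
    · rw [dif_neg h]
      by_cases hσ : P.Refines σ
      · have hτ : ¬ P.Refines τ := fun hτ => h (refines_mul.2 ⟨hσ, hτ⟩)
        rw [dif_neg hτ, mul_zero]
      · rw [dif_neg hσ, zero_mul]

end LabelledSetPartition

/-! An ordered `G`-partition is the same thing as a weak order on $[n]$ together with a label in $G$
for each point, constant on blocks. Under multiplication the weak orders are refined
lexicographically and the labels multiply pointwise (`precedes_mul`, `lab_mul`, `ext_precedes`), so
identities in the monoid become propositional checks. Two of them carry the proof:
$\varepsilon\sigma\varepsilon=\varepsilon\sigma$ whenever all labels of $\varepsilon$ are $1$, and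
$\sigma\bar\sigma=\bar\sigma\sigma=\sigma$, where $\bar\sigma$ is $\sigma$ with its labels erased.

Vertices. On a simple module choose an element acting nontrivially that has as few pairs of points
in a common block as possible, and let $e$ be the idempotent with the same blocks and trivial
labels. By the first identity the kernel of $e$ is a submodule, so $e$ acts as the identity; by
minimality every $\sigma$ that does not contain the blocks of $e$ in its own acts as zero. The
module is therefore inflated from the group $G^{\text{blocks}}$, and a simple module of this group
is an outer tensor product of simple $kG$-modules. Conversely each $S_P$ is simple by Burnside's
theorem in every tensor factor, and $P$ can be read off from it.

Arrows. $\mathrm{Ext}^1(S_P,S_Q)$ is the space of derivations $c(\sigma\tau)=\sigma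
c(\tau)+c(\sigma)\tau$ with values in $\mathrm{Hom}_k(S_P,S_Q)$, modulo inner ones. If the partition
of $P$ does not refine that of $Q$, applying $c$ to $e\sigma e=e\sigma$ shows that $c$ is inner. If
the two partitions agree, averaging over $G^{\text{blocks}}$ does so, because $|G|$ is invertible in
$k$.

Otherwise $P$ strictly refines $Q$; call $(x,y)$ critical if $x,y$ are together in $Q$ but not in
$P$. On an unlabelled $\sigma$ that contains the blocks of $P$ and puts $x$ before $y$, the value of
$c$ depends only on the $P$-block of $x$ (`cocycle_eq_front`); call it $c_x$. These values determine
$c$, and $c$ is inner exactly when they all agree. Two critical pairs from different pairs of blocks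
can be ordered compatibly by one ordered partition, which forces agreement. An obstruction is thus
left only if $Q$ joins exactly two blocks $B,C$ of $P$; then it is $c_x-c_y$ with $x\in B$, $y\in
C$, and it ranges over all maps $S_P\to S_Q$ commuting with the $\sigma$ that $Q$ refines
(`gabrielArrows_eq_rank_equivariantMaps`). By Schur's lemma on the untouched blocks this space is
zero unless their labels agree, and is then $\mathrm{Hom}_G(V_B\otimes V_C,U)$. A trace pairing
shows that it has the dimension of $\mathrm{Hom}_G(U,V_B\otimes V_C)$. -/

set_option linter.unusedSectionVars false

/-! ### Ordered `G`-partitions as labelled weak orders -/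

namespace OrderedGPartition

variable {n : ℕ} {G : Type v}

/-- In a sequence of labelled blocks, a block containing `x` comes strictly before a block
containing `y`. -/
def ListPrecedes : List (Finset (Fin n) × G) → Fin n → Fin n → Prop
  | [], _, _ => False
  | p :: l, x, y => (x ∈ p.1 ∧ ∃ q ∈ l, y ∈ q.1) ∨ ListPrecedes l x y

/-- In a sequence of labelled blocks, some block containing `x` has label `g`. -/
def ListLabels (l : List (Finset (Fin n) × G)) (x : Fin n) (g : G) : Prop :=
  ∃ p ∈ l, x ∈ p.1 ∧ p.2 = g

theorem ListPrecedes.mem_left {l : List (Finset (Fin n) × G)} {x y : Fin n}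
    (h : ListPrecedes l x y) : ∃ p ∈ l, x ∈ p.1 := by
  induction l with
  | nil => exact h.elim
  | cons p l ih =>
    rcases h with ⟨h, _⟩ | h
    · exact ⟨p, by simp, h⟩
    · obtain ⟨q, hq, hx⟩ := ih h
      exact ⟨q, by simp [hq], hx⟩

theorem ListPrecedes.mem_right {l : List (Finset (Fin n) × G)} {x y : Fin n}
    (h : ListPrecedes l x y) : ∃ p ∈ l, y ∈ p.1 := by
  induction l with
  | nil => exact h.elim
  | cons p l ih =>
    rcases h with ⟨_, q, hq, h⟩ | h
    · exact ⟨q, by simp [hq], h⟩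
    · obtain ⟨q, hq, hx⟩ := ih h
      exact ⟨q, by simp [hq], hx⟩

theorem listPrecedes_append {l m : List (Finset (Fin n) × G)} {x y : Fin n} :
    ListPrecedes (l ++ m) x y ↔ ListPrecedes l x y ∨ ListPrecedes m x y ∨
      ((∃ p ∈ l, x ∈ p.1) ∧ ∃ q ∈ m, y ∈ q.1) := by
  induction l with
  | nil => simp [ListPrecedes]
  | cons p l ih =>
    have h1 : (∃ q ∈ l ++ m, y ∈ q.1) ↔ (∃ q ∈ l, y ∈ q.1) ∨ ∃ q ∈ m, y ∈ q.1 := by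
      simp only [List.mem_append, or_and_right, exists_or]
    have h2 : (∃ q ∈ p :: l, x ∈ q.1) ↔ x ∈ p.1 ∨ ∃ q ∈ l, x ∈ q.1 := by simp
    rw [List.cons_append, ListPrecedes, ListPrecedes, ih, h1, h2]
    generalize (∃ q ∈ l, y ∈ q.1) = a
    generalize (∃ q ∈ l, x ∈ q.1) = b
    generalize (∃ q ∈ m, y ∈ q.1) = c
    clear ih h1 h2
    grind

theorem listPrecedes_filter_map_inter [Mul G] {p : Finset (Fin n) × G}
    {m : List (Finset (Fin n) × G)} {x y : Fin n} :
    ListPrecedes ((m.map fun q => (p.1 ∩ q.1, p.2 * q.2)).filter fun r => r.1.Nonempty) x y ↔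
      x ∈ p.1 ∧ y ∈ p.1 ∧ ListPrecedes m x y := by
  induction m with
  | nil => simp [ListPrecedes]
  | cons q m ih =>
    have hy : (∃ r ∈ (m.map fun q => (p.1 ∩ q.1, p.2 * q.2)).filter fun r => r.1.Nonempty,
        y ∈ r.1) ↔ y ∈ p.1 ∧ ∃ r ∈ m, y ∈ r.1 := by
      simp only [List.mem_filter, List.mem_map, decide_eq_true_eq]
      constructor
      · rintro ⟨_, ⟨⟨r, hr, rfl⟩, -⟩, hy⟩
        exact ⟨(Finset.mem_inter.1 hy).1, r, hr, (Finset.mem_inter.1 hy).2⟩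
      · rintro ⟨h, r, hr, h'⟩
        exact ⟨_, ⟨⟨r, hr, rfl⟩, ⟨y, by simp [h, h']⟩⟩, by simp [h, h']⟩
    rw [List.map_cons, List.filter_cons]
    split_ifs with h
    · rw [ListPrecedes, hy, ih, ListPrecedes, Finset.mem_inter]
      generalize (∃ q ∈ m, y ∈ q.1) = a
      tauto
    · have : x ∈ p.1 → x ∉ q.1 := fun h1 h2 => h (by simpa using ⟨x, by simp [h1, h2]⟩)
      rw [ih, ListPrecedes]
      generalize (∃ q ∈ m, y ∈ q.1) = a
      tauto

/-- This is where the lexicographic order of the pairs $(i,j)$ enters: the first index decides, and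
the second only breaks ties. Both points must be covered by `m`, since otherwise the intersections
containing them disappear. -/
theorem listPrecedes_mulParts [Mul G] {l m : List (Finset (Fin n) × G)} {x y : Fin n}
    (hx : ∃ q ∈ m, x ∈ q.1) (hy : ∃ q ∈ m, y ∈ q.1) :
    ListPrecedes (mulParts l m) x y ↔
      ListPrecedes l x y ∨ ((∃ p ∈ l, x ∈ p.1 ∧ y ∈ p.1) ∧ ListPrecedes m x y) := by
  induction l with
  | nil => simp [mulParts_nil, ListPrecedes]
  | cons p l ih =>
    have h1 : (∃ r ∈ (m.map fun q => (p.1 ∩ q.1, p.2 * q.2)).filter fun r => r.1.Nonempty,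
        x ∈ r.1) ↔ x ∈ p.1 := by
      simp only [List.mem_filter, List.mem_map, decide_eq_true_eq]
      constructor
      · rintro ⟨_, ⟨⟨r, hr, rfl⟩, -⟩, hy⟩
        exact (Finset.mem_inter.1 hy).1
      · intro h
        obtain ⟨r, hr, h'⟩ := hx
        exact ⟨_, ⟨⟨r, hr, rfl⟩, ⟨x, by simp [h, h']⟩⟩, by simp [h, h']⟩
    have h2 : (∃ r ∈ mulParts l m, y ∈ r.1) ↔ ∃ p ∈ l, y ∈ p.1 := by
      constructor
      · rintro ⟨r, hr, hy⟩
        obtain ⟨a, ha, b, hb, rfl, -⟩ := mem_mulParts.1 hr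
        exact ⟨a, ha, (Finset.mem_inter.1 hy).1⟩
      · rintro ⟨a, ha, h⟩
        obtain ⟨r, hr, h'⟩ := hy
        have : y ∈ a.1 ∩ r.1 := by simp [h, h']
        exact ⟨_, mem_mulParts.2 ⟨a, ha, r, hr, rfl, ⟨y, this⟩⟩, this⟩
    have h3 : (∃ q ∈ p :: l, x ∈ q.1 ∧ y ∈ q.1) ↔
        (x ∈ p.1 ∧ y ∈ p.1) ∨ ∃ q ∈ l, x ∈ q.1 ∧ y ∈ q.1 := by simp
    rw [mulParts_cons, listPrecedes_append, listPrecedes_filter_map_inter, h1, h2, h3, ih,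
      ListPrecedes]
    clear ih h1 h2 h3 hx hy
    generalize (∃ q ∈ l, y ∈ q.1) = a
    generalize (∃ q ∈ l, x ∈ q.1 ∧ y ∈ q.1) = b
    tauto

/-- The first block can be recovered as the set of points that nothing precedes, so the lists are
compared by peeling off their heads. -/
theorem list_ext {l m : List (Finset (Fin n) × G)}
    (hl : ∀ p ∈ l, p.1.Nonempty) (hm : ∀ p ∈ m, p.1.Nonempty)
    (dl : l.Pairwise fun p q => Disjoint p.1 q.1) (dm : m.Pairwise fun p q => Disjoint p.1 q.1)
    (h : ∀ x y, ListPrecedes l x y ↔ ListPrecedes m x y)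
    (h' : ∀ x g, ListLabels l x g ↔ ListLabels m x g) : l = m := by
  induction l generalizing m with
  | nil =>
    cases m with
    | nil => rfl
    | cons q m =>
      obtain ⟨x, hx⟩ := hm q (by simp)
      obtain ⟨p, hp, _⟩ := (h' x q.2).2 ⟨q, by simp, hx, rfl⟩
      simp at hp
  | cons p l ih =>
    cases m with
    | nil =>
      obtain ⟨x, hx⟩ := hl p (by simp)
      obtain ⟨p, hp, _⟩ := (h' x p.2).1 ⟨p, by simp, hx, rfl⟩
      simp at hp
    | cons q m =>
      -- The points of the first block are the covered points with no predecessor; nonemptiness of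
      -- the first block supplies a predecessor for every other point.
      have head : ∀ (p : Finset (Fin n) × G) (l : List (Finset (Fin n) × G)),
          (∀ r ∈ p :: l, r.1.Nonempty) → (p :: l).Pairwise (fun p q => Disjoint p.1 q.1) →
          ∀ x, x ∈ p.1 ↔ (∃ g, ListLabels (p :: l) x g) ∧ ∀ y, ¬ ListPrecedes (p :: l) y x := by
        intro p l hl dl x
        rw [List.pairwise_cons] at dl
        constructor
        · intro hx
          have hx' : ∀ r ∈ l, x ∉ r.1 := fun r hr => Finset.disjoint_left.1 (dl.1 r hr) hx
          refine ⟨⟨p.2, p, by simp, hx, rfl⟩, fun y => ?_⟩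
          rintro (⟨_, r, hr, h⟩ | h)
          · exact hx' r hr h
          · obtain ⟨r, hr, h⟩ := h.mem_right
            exact hx' r hr h
        · rintro ⟨⟨g, r, hr, hx, _⟩, h⟩
          rcases List.mem_cons.1 hr with rfl | hr
          · exact hx
          · obtain ⟨y, hy⟩ := hl p (by simp)
            exact absurd (Or.inl ⟨hy, r, hr, hx⟩) (h y)
      have e1 : p.1 = q.1 := by
        ext x
        rw [head p l hl dl, head q m hm dm]
        simp only [h, h']
      rw [List.pairwise_cons] at dl dm
      have notin : ∀ {p : Finset (Fin n) × G} {l : List (Finset (Fin n) × G)},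
          (∀ r ∈ l, Disjoint p.1 r.1) → ∀ x ∈ p.1, ∀ r ∈ l, x ∉ r.1 := fun dl x hx r hr =>
        Finset.disjoint_left.1 (dl r hr) hx
      have e2 : p.2 = q.2 := by
        obtain ⟨x, hx⟩ := hl p (by simp)
        obtain ⟨r, hr, hx', e⟩ := (h' x p.2).1 ⟨p, by simp, hx, rfl⟩
        rcases List.mem_cons.1 hr with rfl | hr
        · exact e.symm
        · exact absurd hx' (notin dm.1 x (e1 ▸ hx) r hr)
      obtain rfl : p = q := Prod.ext e1 e2
      congr 1
      refine ih (fun r hr => hl r (by simp [hr])) (fun r hr => hm r (by simp [hr])) dl.2 dm.2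
        (fun x y => ?_) (fun x g => ?_)
      · have h := h x y
        simp only [ListPrecedes] at h
        by_cases hx : x ∈ p.1
        · have n1 : ¬ ListPrecedes l x y := fun H => by
            obtain ⟨r, hr, H⟩ := H.mem_left
            exact notin dl.1 x hx r hr H
          have n2 : ¬ ListPrecedes m x y := fun H => by
            obtain ⟨r, hr, H⟩ := H.mem_left
            exact notin dm.1 x hx r hr H
          tauto
        · tauto
      · have h := h' x g
        simp only [ListLabels, List.mem_cons, exists_eq_or_imp] at h
        by_cases hx : x ∈ p.1
        · have n1 : ¬ ListLabels l x g := fun ⟨r, hr, H, _⟩ => notin dl.1 x hx r hr H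
          have n2 : ¬ ListLabels m x g := fun ⟨r, hr, H, _⟩ => notin dm.1 x hx r hr H
          tauto
        · simpa only [hx, false_and, false_or, ListLabels] using h

/-- The block of `σ` containing `x` comes strictly before the block containing `y`. -/
def Precedes (σ : OrderedGPartition n G) (x y : Fin n) : Prop := ListPrecedes σ.parts x y

/-- `x` and `y` lie in the same block of `σ`. -/
def Same (σ : OrderedGPartition n G) (x y : Fin n) : Prop := ∃ p ∈ σ.parts, x ∈ p.1 ∧ y ∈ p.1

/-- The label of the block of `σ` containing `x`. -/
noncomputable def lab (σ : OrderedGPartition n G) (x : Fin n) : G := (σ.cover x).choose.2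

variable (σ τ : OrderedGPartition n G)

theorem lab_eq {p : Finset (Fin n) × G} (hp : p ∈ σ.parts) {x : Fin n} (hx : x ∈ p.1) :
    σ.lab x = p.2 :=
  congrArg Prod.snd (σ.eq_of_mem (σ.cover x).choose_spec.1 hp (σ.cover x).choose_spec.2 hx)

theorem Same.refl (x : Fin n) : σ.Same x x := by
  obtain ⟨p, hp, hx⟩ := σ.cover x
  exact ⟨p, hp, hx, hx⟩

variable {σ} in
theorem Same.symm {x y : Fin n} (h : σ.Same x y) : σ.Same y x := by
  obtain ⟨p, hp, hx, hy⟩ := h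
  exact ⟨p, hp, hy, hx⟩

variable {σ} in
theorem Same.trans {x y z : Fin n} (h : σ.Same x y) (h' : σ.Same y z) : σ.Same x z := by
  obtain ⟨p, hp, hx, hy⟩ := h
  obtain ⟨q, hq, hy', hz⟩ := h'
  obtain rfl := σ.eq_of_mem hp hq hy hy'
  exact ⟨p, hp, hx, hz⟩

theorem listPrecedes_cases {l : List (Finset (Fin n) × G)} {x y : Fin n}
    (hx : ∃ p ∈ l, x ∈ p.1) (hy : ∃ p ∈ l, y ∈ p.1) :
    ListPrecedes l x y ∨ (∃ p ∈ l, x ∈ p.1 ∧ y ∈ p.1) ∨ ListPrecedes l y x := by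
  induction l with
  | nil => simp at hx
  | cons p l ih =>
    simp only [ListPrecedes, List.mem_cons, exists_eq_or_imp] at hx hy ⊢
    generalize (∃ q ∈ l, y ∈ q.1) = a at *
    generalize (∃ q ∈ l, x ∈ q.1) = b at *
    generalize (∃ q ∈ l, x ∈ q.1 ∧ y ∈ q.1) = c at *
    tauto

theorem not_listPrecedes_and {l : List (Finset (Fin n) × G)}
    (dl : l.Pairwise fun p q => Disjoint p.1 q.1) {x y : Fin n} (h : ListPrecedes l x y) :
    ¬ ListPrecedes l y x ∧ ¬ ∃ p ∈ l, x ∈ p.1 ∧ y ∈ p.1 := by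
  induction l with
  | nil => exact h.elim
  | cons p l ih =>
    rw [List.pairwise_cons] at dl
    have notin : ∀ x ∈ p.1, ∀ r ∈ l, x ∉ r.1 := fun x hx r hr =>
        Finset.disjoint_left.1 (dl.1 r hr) hx
    rcases h with ⟨hx, r, hr, hy⟩ | h
    · constructor
      · rintro (⟨_, s, hs, h⟩ | h)
        · exact notin x hx s hs h
        · obtain ⟨s, hs, h⟩ := h.mem_right
          exact notin x hx s hs h
      · rintro ⟨s, hs, hx', hy'⟩
        rcases List.mem_cons.1 hs with rfl | hs
        · exact notin y hy' r hr hy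
        · exact notin x hx s hs hx'
    · obtain ⟨ih1, ih2⟩ := ih dl.2 h
      obtain ⟨s, hs, hxs⟩ := h.mem_left
      obtain ⟨r, hr, hyr⟩ := h.mem_right
      constructor
      · rintro (⟨h1, _⟩ | h)
        · exact notin y h1 r hr hyr
        · exact ih1 h
      · rintro ⟨t, ht, hx', hy'⟩
        rcases List.mem_cons.1 ht with rfl | ht
        · exact notin x hx' s hs hxs
        · exact ih2 ⟨t, ht, hx', hy'⟩

theorem precedes_cases (x y : Fin n) : σ.Precedes x y ∨ σ.Same x y ∨ σ.Precedes y x :=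
  listPrecedes_cases (σ.cover x) (σ.cover y)

variable {σ} in
theorem Precedes.not_same {x y : Fin n} (h : σ.Precedes x y) : ¬ σ.Same x y :=
  (not_listPrecedes_and σ.disjoint h).2

variable {σ} in
theorem Precedes.asymm {x y : Fin n} (h : σ.Precedes x y) : ¬ σ.Precedes y x :=
  (not_listPrecedes_and σ.disjoint h).1

theorem same_iff {x y : Fin n} : σ.Same x y ↔ ¬ σ.Precedes x y ∧ ¬ σ.Precedes y x := by
  constructor
  · exact fun h => ⟨fun h' => h'.not_same h, fun h' => h'.not_same h.symm⟩
  · rintro ⟨h1, h2⟩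
    exact ((σ.precedes_cases x y).resolve_left h1).resolve_right h2

variable {σ τ} in
-- With `precedes_mul` and `lab_mul`, this turns every monoid identity below into propositional
-- logic about a weak order and an equation between labels.
theorem ext_precedes (h : ∀ x y, σ.Precedes x y ↔ τ.Precedes x y) (h' : ∀ x, σ.lab x = τ.lab x) :
    σ = τ := by
  have key : ∀ (σ : OrderedGPartition n G) x g, ListLabels σ.parts x g ↔ σ.lab x = g := by
    intro σ x g
    constructor
    · rintro ⟨p, hp, hx, rfl⟩
      exact σ.lab_eq hp hx
    · rintro rfl
      exact ⟨_, (σ.cover x).choose_spec.1, (σ.cover x).choose_spec.2, rfl⟩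
  refine OrderedGPartition.ext
    (list_ext σ.nonempty τ.nonempty σ.disjoint τ.disjoint h fun x g => ?_)
  rw [key, key, h']

theorem precedes_mul [Mul G] {x y : Fin n} :
    (σ * τ).Precedes x y ↔ σ.Precedes x y ∨ (σ.Same x y ∧ τ.Precedes x y) :=
  listPrecedes_mulParts (τ.cover x) (τ.cover y)

theorem same_mul [Mul G] {x y : Fin n} : (σ * τ).Same x y ↔ σ.Same x y ∧ τ.Same x y := by
  simp only [same_iff, precedes_mul]
  tauto

theorem lab_mul [Mul G] (x : Fin n) : (σ * τ).lab x = σ.lab x * τ.lab x := by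
  obtain ⟨p, hp, hx⟩ := (σ * τ).cover x
  obtain ⟨a, ha, b, hb, rfl, -⟩ := mem_mulParts.1 hp
  rw [Finset.mem_inter] at hx
  rw [lab_eq _ hp (Finset.mem_inter.2 hx), lab_eq _ ha hx.1, lab_eq _ hb hx.2]

/-- The ordered `G`-partition into the nonempty level sets of `φ`, in increasing order of the value,
where the level set of `i` has the label `γ i`. -/
noncomputable def ofFun (φ : Fin n → ℕ) (γ : ℕ → G) : OrderedGPartition n G where
  parts := ((Finset.univ.image φ).sort (· ≤ ·)).map
    fun i => (Finset.univ.filter fun x => φ x = i, γ i)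
  nonempty := by
    intro p hp
    simp only [List.mem_map, Finset.mem_sort, Finset.mem_image, Finset.mem_univ, true_and] at hp
    obtain ⟨_, ⟨x, rfl⟩, rfl⟩ := hp
    exact ⟨x, by simp⟩
  disjoint := by
    refine List.Pairwise.map _ ?_ (Finset.sort_nodup _ _)
    intro i j hij
    rw [Finset.disjoint_left]
    intro x hx hx'
    simp only [Finset.mem_filter, Finset.mem_univ, true_and] at hx hx'
    exact hij (hx.symm.trans hx')
  cover := by
    intro x
    exact ⟨_, List.mem_map.2 ⟨φ x, by simp, rfl⟩, by simp⟩

theorem listPrecedes_map (φ : Fin n → ℕ) (γ : ℕ → G) {l : List ℕ} (hl : l.Pairwise (· < ·))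
    {x y : Fin n} :
    ListPrecedes (l.map fun i => (Finset.univ.filter fun x => φ x = i, γ i)) x y ↔
      φ x < φ y ∧ φ x ∈ l ∧ φ y ∈ l := by
  induction l with
  | nil => simp [ListPrecedes]
  | cons i l ih =>
    rw [List.pairwise_cons] at hl
    have := hl.1 (φ x)
    have := hl.1 (φ y)
    simp only [List.map_cons, ListPrecedes, ih hl.2, List.mem_cons, List.mem_map,
      Finset.mem_filter, Finset.mem_univ, true_and]
    constructor
    · rintro (⟨rfl, _, ⟨j, hj, rfl⟩, h⟩ | h)
      · obtain rfl : φ y = j := by simpa using h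
        exact ⟨hl.1 _ hj, Or.inl rfl, Or.inr hj⟩
      · tauto
    · rintro ⟨h, h1 | h1, h2 | h2⟩
      · omega
      · exact Or.inl ⟨h1, _, ⟨_, h2, rfl⟩, by simp⟩
      · have := hl.1 _ h1
        omega
      · exact Or.inr ⟨h, h1, h2⟩

@[simp]
theorem precedes_ofFun (φ : Fin n → ℕ) (γ : ℕ → G) {x y : Fin n} :
    (ofFun φ γ).Precedes x y ↔ φ x < φ y := by
  refine (listPrecedes_map φ γ (Finset.sortedLT_sort _).pairwise).trans ?_
  simp

@[simp]
theorem same_ofFun (φ : Fin n → ℕ) (γ : ℕ → G) {x y : Fin n} :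
    (ofFun φ γ).Same x y ↔ φ x = φ y := by
  rw [same_iff, precedes_ofFun, precedes_ofFun]
  omega

@[simp]
theorem lab_ofFun (φ : Fin n → ℕ) (γ : ℕ → G) (x : Fin n) : (ofFun φ γ).lab x = γ (φ x) :=
  lab_eq (ofFun φ γ) (p := (Finset.univ.filter fun y => φ y = φ x, γ (φ x)))
    (List.mem_map.2 ⟨φ x, by simp, rfl⟩) (by simp)

/-- The ordered `G`-partition with the blocks of `σ` in which all labels are replaced by `1`. -/
def unlabel [One G] : OrderedGPartition n G where
  parts := σ.parts.map fun p => (p.1, 1)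
  nonempty := by
    intro p hp
    obtain ⟨q, hq, rfl⟩ := List.mem_map.1 hp
    exact σ.nonempty q hq
  disjoint := List.Pairwise.map _ (fun _ _ h => h) σ.disjoint
  cover := by
    intro x
    obtain ⟨p, hp, hx⟩ := σ.cover x
    exact ⟨_, List.mem_map.2 ⟨p, hp, rfl⟩, hx⟩

@[simp]
theorem precedes_unlabel [One G] {x y : Fin n} : σ.unlabel.Precedes x y ↔ σ.Precedes x y := by
  unfold Precedes unlabel
  dsimp only
  generalize σ.parts = l
  induction l with
  | nil => rfl
  | cons p l ih => simp [ListPrecedes, ih]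

@[simp]
theorem same_unlabel [One G] {x y : Fin n} : σ.unlabel.Same x y ↔ σ.Same x y := by
  simp [same_iff]

@[simp]
theorem lab_unlabel [One G] (x : Fin n) : σ.unlabel.lab x = 1 := by
  obtain ⟨p, hp, hx⟩ := σ.unlabel.cover x
  rw [lab_eq _ hp hx]
  obtain ⟨q, hq, rfl⟩ := List.mem_map.1 hp
  rfl

theorem mul_unlabel [Monoid G] : σ * σ.unlabel = σ := by
  refine ext_precedes (fun x y => ?_) (fun x => by simp [lab_mul])
  simp only [precedes_mul, precedes_unlabel]
  tauto

theorem unlabel_mul [Monoid G] : σ.unlabel * σ = σ := by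
  refine ext_precedes (fun x y => ?_) (fun x => by simp [lab_mul])
  simp only [precedes_mul, precedes_unlabel]
  tauto

/-- The left regular band identity: a tie left by `ε` is not broken by a second `ε`, and a pair that
`ε` orders is already decided. -/
theorem mul_mul_of_lab_eq_one [Monoid G] {ε : OrderedGPartition n G} (h : ∀ x, ε.lab x = 1) :
    ε * σ * ε = ε * σ := by
  refine ext_precedes (fun x y => ?_) (fun x => by simp [lab_mul, h])
  simp only [precedes_mul, same_mul]
  have := (ε.same_iff (x := x) (y := y))
  tauto

instance [Finite G] : Finite (OrderedGPartition n G) := by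
  refine Finite.of_injective
    (fun σ : OrderedGPartition n G => (⟨σ.Precedes, σ.lab⟩ : (Fin n → Fin n → Prop) × (Fin n → G)))
    fun σ τ h => ?_
  rw [Prod.mk.injEq] at h
  exact ext_precedes (fun x y => by rw [h.1]) (fun x => by rw [h.2])

end OrderedGPartition

namespace LabelledSetPartition

variable {n : ℕ} {X : Type w} (P : LabelledSetPartition n X) {G : Type v}

/-! ### Blocks and the refinement order -/

instance : Finite P.Block := Subtype.finite

/-- `x` and `y` lie in the same block of `P`. -/
def Same (x y : Fin n) : Prop := ∃ B : P.Block, x ∈ B.1 ∧ y ∈ B.1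

theorem exists_block (x : Fin n) : ∃ B : P.Block, x ∈ B.1 := by
  obtain ⟨p, hp, hx⟩ := P.cover x
  exact ⟨⟨p.1, p.2, hp⟩, hx⟩

/-- The block of `P` containing `x`. -/
noncomputable def blockOf (x : Fin n) : P.Block := (P.exists_block x).choose

theorem mem_blockOf (x : Fin n) : x ∈ (P.blockOf x).1 := (P.exists_block x).choose_spec

theorem block_eq {B C : P.Block} {x : Fin n} (hB : x ∈ B.1) (hC : x ∈ C.1) : B = C := by
  by_contra hne
  exact Finset.disjoint_left.1 (P.disjoint _ (P.label_mem B) _ (P.label_mem C)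
    fun e => hne (Subtype.ext (congrArg Prod.fst e))) hB hC

variable {P} in
theorem blockOf_eq {B : P.Block} {x : Fin n} (h : x ∈ B.1) : P.blockOf x = B :=
  P.block_eq (P.mem_blockOf x) h

theorem block_nonempty (B : P.Block) : B.1.Nonempty := P.nonempty _ (P.label_mem B)

theorem blockOf_surjective : Function.Surjective P.blockOf := fun B => by
  obtain ⟨x, hx⟩ := P.block_nonempty B
  exact ⟨x, blockOf_eq hx⟩

theorem same_iff {x y : Fin n} : P.Same x y ↔ P.blockOf x = P.blockOf y := by
  constructor
  · rintro ⟨B, hx, hy⟩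
    rw [blockOf_eq hx, blockOf_eq hy]
  · intro h
    exact ⟨P.blockOf x, P.mem_blockOf x, h ▸ P.mem_blockOf y⟩

theorem mem_block_iff {B : P.Block} {x : Fin n} : x ∈ B.1 ↔ P.blockOf x = B :=
  ⟨blockOf_eq, fun h => h ▸ P.mem_blockOf x⟩

theorem Same.refl (x : Fin n) : P.Same x x := P.same_iff.2 rfl

variable {P}

theorem Same.symm {x y : Fin n} (h : P.Same x y) : P.Same y x := P.same_iff.2 (P.same_iff.1 h).symm

theorem Same.trans {x y z : Fin n} (h : P.Same x y) (h' : P.Same y z) : P.Same x z :=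
  P.same_iff.2 ((P.same_iff.1 h).trans (P.same_iff.1 h'))

theorem refines_iff {σ : OrderedGPartition n G} :
    P.Refines σ ↔ ∀ x y, P.Same x y → σ.Same x y := by
  constructor
  · rintro h x y ⟨B, hx, hy⟩
    obtain ⟨q, hq, hB⟩ := h B
    exact ⟨q, hq, hB hx, hB hy⟩
  · intro h B
    obtain ⟨x, hx⟩ := P.block_nonempty B
    obtain ⟨q, hq, hxq⟩ := σ.cover x
    refine ⟨q, hq, fun y hy => ?_⟩
    obtain ⟨r, hr, hxr, hyr⟩ := h x y ⟨B, hx, hy⟩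
    rwa [σ.eq_of_mem hq hr hxq hxr]

theorem Refines.value_eq_lab {σ : OrderedGPartition n G} (h : P.Refines σ) {B : P.Block}
    {x : Fin n} (hx : x ∈ B.1) : h.value B = σ.lab x := by
  rw [σ.lab_eq (h B).choose_spec.1 ((h B).choose_spec.2 hx)]
  rfl

theorem refines_unlabel [One G] {σ : OrderedGPartition n G} :
    P.Refines σ.unlabel ↔ P.Refines σ := by
  simp only [refines_iff, OrderedGPartition.same_unlabel]

variable (P)

/-- A numbering of the blocks of `P`. -/
noncomputable def blockIndex (B : P.Block) : ℕ := (Finite.equivFin P.Block B).1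

theorem blockIndex_injective : Function.Injective P.blockIndex :=
  Fin.val_injective.comp (Finite.equivFin P.Block).injective

/-- An ordered `G`-partition with the blocks of `P`, labelled by `γ`. -/
noncomputable def ordered [One G] (γ : P.Block → G) : OrderedGPartition n G :=
  .ofFun (fun x => P.blockIndex (P.blockOf x)) (Function.extend P.blockIndex γ 1)

@[simp]
theorem same_ordered [One G] (γ : P.Block → G) {x y : Fin n} :
    (P.ordered γ).Same x y ↔ P.Same x y := by
  rw [ordered, OrderedGPartition.same_ofFun, P.blockIndex_injective.eq_iff, same_iff]

@[simp]
theorem lab_ordered [One G] (γ : P.Block → G) (x : Fin n) :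
    (P.ordered γ).lab x = γ (P.blockOf x) := by
  rw [ordered, OrderedGPartition.lab_ofFun, P.blockIndex_injective.extend_apply]

theorem ordered_precedes_iff [One G] (γ δ : P.Block → G) {x y : Fin n} :
    (P.ordered γ).Precedes x y ↔ (P.ordered δ).Precedes x y := by
  simp [ordered]

theorem refines_ordered [One G] (γ : P.Block → G) : P.Refines (P.ordered γ) :=
  refines_iff.2 fun _ _ h => (P.same_ordered γ).2 h

/-- The order of the blocks is fixed by `blockIndex`, so the elements `P.ordered γ` form a copy of
$G^{\text{blocks}}$ with identity `P.ordered 1`. -/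
theorem ordered_mul_ordered [Monoid G] (γ δ : P.Block → G) :
    P.ordered γ * P.ordered δ = P.ordered (γ * δ) := by
  refine OrderedGPartition.ext_precedes (fun x y => ?_) (fun x => ?_)
  · rw [OrderedGPartition.precedes_mul, P.ordered_precedes_iff δ γ,
      P.ordered_precedes_iff (γ * δ) γ]
    tauto
  · simp [OrderedGPartition.lab_mul]

variable {P} in
-- Points in one block of `P` are not ordered by `σ`, so only the labels of `σ` survive. Wherever
-- `P.ordered 1` acts as the identity, `σ` acts through $G^{\text{blocks}}$.
theorem Refines.ordered_one_mul [Monoid G] {σ : OrderedGPartition n G} (h : P.Refines σ) :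
    P.ordered 1 * σ = P.ordered h.value := by
  refine OrderedGPartition.ext_precedes (fun x y => ?_) (fun x => ?_)
  · rw [OrderedGPartition.precedes_mul, P.ordered_precedes_iff h.value 1, P.same_ordered]
    have := fun h1 => (refines_iff.1 h x y) h1
    have := fun h2 : σ.Precedes x y => h2.not_same
    tauto
  · rw [OrderedGPartition.lab_mul, P.lab_ordered, P.lab_ordered,
      h.value_eq_lab (P.mem_blockOf x)]
    simp

/-- The block of `P` containing `x`, labelled by `g`, followed by the rest, labelled by `1`. -/
noncomputable def front [One G] (x : Fin n) (g : G) : OrderedGPartition n G :=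
  open scoped Classical in
  .ofFun (fun z => if P.Same x z then 0 else 1) fun i => if i = 0 then g else 1

variable [Monoid G]

theorem lab_front_of_same {x z : Fin n} (g : G) (h : P.Same x z) : (P.front x g).lab z = g := by
  simp [front, h]

theorem lab_front_of_not_same {x z : Fin n} (g : G) (h : ¬ P.Same x z) :
    (P.front x g).lab z = 1 := by
  simp [front, h]

theorem lab_front_one (x z : Fin n) : (P.front x (1 : G)).lab z = 1 := by simp [front]

theorem precedes_front {x y z : Fin n} {g : G} :
    (P.front x g).Precedes y z ↔ P.Same x y ∧ ¬ P.Same x z := by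
  rw [front, OrderedGPartition.precedes_ofFun]
  split_ifs <;> simp [*]

theorem same_front {x y z : Fin n} {g : G} :
    (P.front x g).Same y z ↔ (P.Same x y ↔ P.Same x z) := by
  rw [OrderedGPartition.same_iff, precedes_front, precedes_front]
  tauto

theorem refines_front (x : Fin n) (g : G) : P.Refines (P.front x g) :=
  refines_iff.2 fun _ _ h => P.same_front.2 ⟨fun h' => h'.trans h, fun h' => h'.trans h.symm⟩

theorem carrier_eq : P.carrier = {p | ∃ B : P.Block, p = (B.1, P.label B)} := by
  ext p
  constructor
  · intro hp
    exact ⟨⟨p.1, p.2, hp⟩, Prod.ext rfl (P.label_eq ⟨p.1, p.2, hp⟩ hp).symm⟩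
  · rintro ⟨B, rfl⟩
    exact P.label_mem B

variable {P}

/-- Labelled set partitions agree if they have the same blocks, with the same labels. -/
theorem eq_of_same {Q : LabelledSetPartition n X} (h : ∀ x y, P.Same x y ↔ Q.Same x y)
    (h' : ∀ x, P.label (P.blockOf x) = Q.label (Q.blockOf x)) : P = Q := by
  have key : ∀ {P Q : LabelledSetPartition n X}, (∀ x y, P.Same x y ↔ Q.Same x y) →
      (∀ x, P.label (P.blockOf x) = Q.label (Q.blockOf x)) → P.carrier ⊆ Q.carrier := by
    intro P Q h h'
    rw [P.carrier_eq, Q.carrier_eq]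
    rintro _ ⟨B, rfl⟩
    obtain ⟨x, rfl⟩ := P.blockOf_surjective B
    refine ⟨Q.blockOf x, Prod.ext ?_ (h' x)⟩
    ext y
    rw [mem_block_iff, mem_block_iff, ← same_iff, ← same_iff, h]
  exact LabelledSetPartition.ext
    (Set.Subset.antisymm (key h h') (key (fun x y => (h x y).symm) fun x => (h' x).symm))

end LabelledSetPartition

/-! ### `Ext¹` as derivations modulo inner derivations -/

section ExtDerivations

variable (k : Type u) [Field k] (A : Type w) [Ring A] [Algebra k A]
  (X Y : Type w) [AddCommGroup X] [Module k X] [Module A X] [IsScalarTower k A X]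
  [AddCommGroup Y] [Module k Y] [Module A Y] [IsScalarTower k A Y]

/-- Derivations of the `k`-algebra `A` with values in the bimodule `Hom_k(X, Y)`. -/
def homDerivations : Submodule k (A →ₗ[k] X →ₗ[k] Y) where
  carrier := {D | ∀ a b x, D (a * b) x = a • D b x + D a (b • x)}
  add_mem' := by
    intro D E hD hE a b x
    simp only [LinearMap.add_apply, hD a b x, hE a b x, smul_add]
    abel
  zero_mem' := by simp
  smul_mem' := by
    intro c D hD a b x
    simp only [LinearMap.smul_apply, hD a b x, smul_add, smul_comm a c]

/-- The inner derivation `a ↦ a h - h a`. -/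
def innerDerivation : (X →ₗ[k] Y) →ₗ[k] homDerivations k A X Y where
  toFun h := ⟨LinearMap.mk₂ k (fun a x => a • h x - h (a • x))
      (by intro a b x; simp only [add_smul, map_add]; abel)
      (by intro c a x; simp only [smul_assoc, map_smul, smul_sub])
      (by intro a x y; simp only [map_add, smul_add]; abel)
      (by intro c a x; simp only [map_smul, smul_sub, smul_comm a c]),
    by intro a b x; simp [mul_smul, smul_sub]⟩
  map_add' h h' := by
    ext a x
    simp only [LinearMap.mk₂_apply, LinearMap.add_apply, smul_add, Submodule.coe_add]
    abel
  map_smul' c h := by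
    ext a x
    simp [smul_sub, smul_comm a c]

variable {k A X Y}

@[simp]
theorem innerDerivation_apply (h : X →ₗ[k] Y) (a : A) (x : X) :
    (innerDerivation k A X Y h).1 a x = a • h x - h (a • x) := rfl

theorem derivation_one (D : homDerivations k A X Y) (x : X) : D.1 1 x = 0 := by
  have := D.2 1 1 x
  simpa using this

variable (k A X)

/-- The surjection `A ⊗ X → X`. -/
noncomputable def actionMap : A ⊗[k] X →ₗ[A] X :=
  TensorProduct.AlgebraTensorModule.lift
    { toFun := fun a => Algebra.lsmul k k X a
      map_add' := map_add _
      map_smul' := fun a b => by ext x; simp }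

@[simp]
theorem actionMap_tmul (a : A) (x : X) : actionMap k A X (a ⊗ₜ x) = a • x := rfl

theorem actionMap_surjective : Function.Surjective (actionMap k A X) := fun x =>
  ⟨1 ⊗ₜ x, by simp⟩

variable {k A X}

/-- The map `A ⊗ X → Y` which a derivation induces. -/
noncomputable def derivationLift (D : homDerivations k A X Y) : A ⊗[k] X →ₗ[k] Y :=
  TensorProduct.lift D.1

/-- The failure of `A`-linearity only involves the image of `z` in `X`, so the lift becomes
`A`-linear on the kernel of `actionMap`. -/
theorem derivationLift_smul (D : homDerivations k A X Y) (a : A) (z : A ⊗[k] X) :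
    derivationLift D (a • z) = a • derivationLift D z + D.1 a (actionMap k A X z) := by
  induction z using TensorProduct.induction_on with
  | zero => simp
  | tmul b x => simp [derivationLift, TensorProduct.smul_tmul', D.2 a b x]
  | add z w hz hw =>
    simp only [smul_add, map_add, hz, hw]
    abel

variable (k A X Y)

/-- The `A`-linear map on the kernel of `A ⊗ X → X` which a derivation induces. -/
noncomputable def derivationToHom :
    homDerivations k A X Y →ₗ[k] (LinearMap.ker (actionMap k A X) →ₗ[A] Y) where
  toFun D :=
    { toFun := fun z => derivationLift D z.1
      map_add' := by simp
      map_smul' := by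
        intro a z
        have hz : actionMap k A X z.1 = 0 := z.2
        simp [derivationLift_smul, hz] }
  map_add' D E := by
    ext z
    change derivationLift (D + E) z.1 = derivationLift D z.1 + derivationLift E z.1
    generalize z.1 = z
    induction z using TensorProduct.induction_on with
    | zero => simp
    | tmul a x => simp [derivationLift]
    | add z w hz hw => rw [map_add, hz, hw]; simp only [map_add]; abel
  map_smul' c D := by
    ext z
    change derivationLift (c • D) z.1 = c • derivationLift D z.1
    generalize z.1 = z
    induction z using TensorProduct.induction_on with
    | zero => simp
    | tmul a x => simp [derivationLift]
    | add z w hz hw => rw [map_add, hz, hw, map_add, smul_add]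

variable {k A X Y}

/-- The derivation `a ↦ (x ↦ φ (a ⊗ x - 1 ⊗ a x))`. -/
noncomputable def derivationOfHom (φ : LinearMap.ker (actionMap k A X) →ₗ[A] Y) :
    homDerivations k A X Y := by
  refine ⟨LinearMap.mk₂ k (fun a x => φ ⟨a ⊗ₜ x - 1 ⊗ₜ (a • x), by simp⟩) ?_ ?_ ?_ ?_, ?_⟩
  · intro a b x
    rw [← map_add]
    congr 1
    ext
    simp only [TensorProduct.add_tmul, add_smul, TensorProduct.tmul_add, Submodule.coe_add]
    abel
  · intro c a x
    rw [← LinearMap.map_smul_of_tower]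
    congr 1
    ext
    simp [TensorProduct.smul_tmul', smul_sub]
  · intro a x y
    rw [← map_add]
    congr 1
    ext
    simp only [smul_add, TensorProduct.tmul_add, Submodule.coe_add]
    abel
  · intro c a x
    rw [← LinearMap.map_smul_of_tower]
    congr 1
    ext
    simp [smul_sub, smul_comm a c]
  · intro a b x
    simp only [LinearMap.mk₂_apply]
    rw [← map_smul, ← map_add]
    congr 1
    ext
    simp [smul_sub, TensorProduct.smul_tmul', mul_smul]

/-- The map $z\mapsto z-1\otimes\pi(z)$, with $\pi$ the action map, projects onto the kernel of
$\pi$ and sends $a\otimes x$ to the element used to define the derivation. -/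
theorem derivationToHom_derivationOfHom (φ : LinearMap.ker (actionMap k A X) →ₗ[A] Y) :
    derivationToHom k A X Y (derivationOfHom φ) = φ := by
  have key : ∀ z : A ⊗[k] X, ∃ h, derivationLift (derivationOfHom φ) z =
      φ ⟨z - 1 ⊗ₜ actionMap k A X z, h⟩ := by
    intro z
    have h : ∀ z, z - 1 ⊗ₜ actionMap k A X z ∈ LinearMap.ker (actionMap k A X) := by simp
    refine ⟨h z, ?_⟩
    induction z using TensorProduct.induction_on with
    | zero =>
      rw [map_zero, ← map_zero φ]
      congr 1
      ext
      simp
    | tmul a x => rfl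
    | add z w hz hw =>
      rw [map_add, hz, hw, ← map_add]
      congr 1
      ext
      simp only [map_add, TensorProduct.tmul_add, Submodule.coe_add]
      abel
  ext z
  obtain ⟨h, e⟩ := key z.1
  have hz : actionMap k A X z.1 = 0 := z.2
  change derivationLift (derivationOfHom φ) z.1 = φ z
  rw [e]
  congr 1
  ext
  simp [hz]

/-- The `A`-linear map on `A ⊗ X` extending `h`. -/
noncomputable def tensorExtend (h : X →ₗ[k] Y) : A ⊗[k] X →ₗ[A] Y :=
  TensorProduct.AlgebraTensorModule.lift
    { toFun := fun a => (Algebra.lsmul k k Y a).comp h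
      map_add' := fun a b => by ext x; simp
      map_smul' := fun a b => by
        ext x
        simp only [map_mul, LinearMap.comp_apply, smul_eq_mul, LinearMap.smul_apply,
          RingHom.id_apply, Algebra.lsmul_coe, Module.End.mul_apply] }

@[simp]
theorem tensorExtend_tmul (h : X →ₗ[k] Y) (a : A) (x : X) :
    tensorExtend h (a ⊗ₜ[k] x) = a • h x := rfl

/-- An `A`-linear map on $A\otimes X$ is determined by its restriction $h$ to $1\otimes X$, and any
$k$-linear $h$ occurs; this $h$ is what makes the derivation inner. -/
theorem mem_range_innerDerivation_iff (D : homDerivations k A X Y) :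
    D ∈ LinearMap.range (innerDerivation k A X Y) ↔
      ∃ ψ : A ⊗[k] X →ₗ[A] Y, ∀ z : LinearMap.ker (actionMap k A X),
        ψ z.1 = derivationToHom k A X Y D z := by
  constructor
  · rintro ⟨h, rfl⟩
    refine ⟨tensorExtend h, fun z => ?_⟩
    have key : ∀ z : A ⊗[k] X, derivationLift (innerDerivation k A X Y h) z =
        tensorExtend h z - h (actionMap k A X z) := by
      intro z
      induction z using TensorProduct.induction_on with
      | zero => simp
      | tmul a x => simp [derivationLift]
      | add z w hz hw => rw [map_add, hz, hw]; simp only [map_add]; abel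
    have hz : actionMap k A X z.1 = 0 := z.2
    change _ = derivationLift (innerDerivation k A X Y h) z.1
    rw [key, hz, map_zero, sub_zero]
  · rintro ⟨ψ, hψ⟩
    refine ⟨(ψ.restrictScalars k).comp (TensorProduct.mk k A X 1), ?_⟩
    ext a x
    have h := hψ ⟨a ⊗ₜ x - 1 ⊗ₜ (a • x), by simp⟩
    change _ = derivationLift D (a ⊗ₜ x - 1 ⊗ₜ (a • x)) at h
    have h1 : ψ (a ⊗ₜ x) = a • ψ (1 ⊗ₜ x) := by
      rw [← map_smul, TensorProduct.smul_tmul', smul_eq_mul, mul_one]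
    simpa [derivationLift, derivation_one, h1] using h

variable (k A X Y)

/-- `Ext¹_A(X, Y)` consists of the derivations with values in `Hom_k(X, Y)` modulo the inner
derivations. -/
theorem exists_derivations_to_ext :
    ∃ Θ : homDerivations k A X Y →ₗ[k] Abelian.Ext.{w} (ModuleCat.of A X) (ModuleCat.of A Y) 1,
      Function.Surjective Θ ∧ LinearMap.ker Θ = LinearMap.range (innerDerivation k A X Y) := by
  let S : ShortComplex (ModuleCat.{w} A) := LinearMap.shortComplexKer (actionMap k A X)
  have hS : S.ShortExact := LinearMap.shortExact_shortComplexKer (actionMap_surjective k A X)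
  -- $X$ is free over the field $k$, so $A\otimes X$ is free over $A$. The long exact sequence then
  -- presents $\mathrm{Ext}^1(X,Y)$ as the maps from the kernel to $Y$, modulo those extending to
  -- $A\otimes X$.
  have hP : Projective S.X₂ :=
    (IsProjective.iff_projective (R := A) (A ⊗[k] X)).1 inferInstance
  let ι : homDerivations k A X Y → (S.X₁ ⟶ ModuleCat.of A Y) :=
    fun D => ModuleCat.ofHom (derivationToHom k A X Y D)
  have hι : ∀ φ : S.X₁ ⟶ ModuleCat.of A Y, ∃ D, ι D = φ := fun φ =>
    ⟨derivationOfHom φ.hom, ModuleCat.hom_ext (derivationToHom_derivationOfHom φ.hom)⟩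
  let Θ : homDerivations k A X Y →ₗ[k] Abelian.Ext.{w} (ModuleCat.of A X) (ModuleCat.of A Y) 1 :=
    { toFun := fun D => hS.extClass.comp (Abelian.Ext.mk₀ (ι D)) (add_zero 1)
      map_add' := fun D E => by
        rw [← Abelian.Ext.comp_add, ← Abelian.Ext.mk₀_add]
        simp only [ι, map_add]
        rfl
      map_smul' := fun c D => by
        rw [RingHom.id_apply, ← Abelian.Ext.comp_smul, ← Abelian.Ext.mk₀_smul]
        congr 2
        ext z
        change derivationToHom k A X Y (c • D) z =
          algebraMap k A c • (derivationToHom k A X Y D z)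
        rw [map_smul, algebraMap_smul]
        rfl }
  have hΘ : ∀ D, Θ D = hS.extClass.comp (Abelian.Ext.mk₀ (ι D)) (add_zero 1) := fun D => rfl
  refine ⟨Θ, fun x => ?_, ?_⟩
  · obtain ⟨x₁, rfl⟩ := Abelian.Ext.contravariant_sequence_exact₃ hS (ModuleCat.of A Y) x
      (Abelian.Ext.eq_zero_of_projective _) (add_zero 1)
    obtain ⟨φ, rfl⟩ := (Abelian.Ext.mk₀_bijective S.X₁ (ModuleCat.of A Y)).2 x₁
    obtain ⟨D, rfl⟩ := hι φ
    exact ⟨D, rfl⟩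
  · ext D
    rw [LinearMap.mem_ker, hΘ, mem_range_innerDerivation_iff]
    constructor
    · intro h
      obtain ⟨x₂, hx₂⟩ := Abelian.Ext.contravariant_sequence_exact₁ hS (ModuleCat.of A Y) _
        (add_zero 1) h
      obtain ⟨ψ, rfl⟩ := (Abelian.Ext.mk₀_bijective S.X₂ (ModuleCat.of A Y)).2 x₂
      rw [Abelian.Ext.mk₀_comp_mk₀] at hx₂
      have := (Abelian.Ext.mk₀_bijective _ _).1 hx₂
      exact ⟨ψ.hom, fun z => congrArg (fun f => f.hom z) this⟩
    · rintro ⟨ψ, hψ⟩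
      have : ι D = S.f ≫ ModuleCat.ofHom ψ := by
        ext z
        exact (hψ z).symm
      rw [this, ← Abelian.Ext.mk₀_comp_mk₀, hS.extClass_comp_assoc]

variable {k A}

/-- `Ext` depends on its arguments only up to isomorphism. -/
theorem nonempty_ext_equiv_of_iso {X X' Y Y' : ModuleCat.{w} A} (e : X' ≅ X) (f : Y ≅ Y') (n : ℕ) :
    Nonempty (Abelian.Ext.{w} X Y n ≃ₗ[k] Abelian.Ext.{w} X' Y' n) := by
  let F : ∀ {X X' Y Y' : ModuleCat.{w} A}, (X' ⟶ X) → (Y ⟶ Y') →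
      (Abelian.Ext.{w} X Y n →ₗ[k] Abelian.Ext.{w} X' Y' n) := fun e f =>
    (Abelian.Ext.postcompOfLinear (Abelian.Ext.mk₀ f) k _ (add_zero n)) ∘ₗ
      (Abelian.Ext.precompOfLinear (Abelian.Ext.mk₀ e) k _ (zero_add n))
  have hF : ∀ {X X' Y Y' : ModuleCat.{w} A} (e : X' ≅ X) (f : Y ≅ Y') (x),
      F e.inv f.inv (F e.hom f.hom x) = x := by
    intro X X' Y Y' e f x
    change (Abelian.Ext.comp (Abelian.Ext.mk₀ e.inv) (((Abelian.Ext.mk₀ e.hom).comp x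
      (zero_add n)).comp (Abelian.Ext.mk₀ f.hom) (add_zero n)) (zero_add n)).comp
        (Abelian.Ext.mk₀ f.inv) (add_zero n) = x
    rw [Abelian.Ext.comp_assoc_of_third_deg_zero, Abelian.Ext.comp_assoc_of_third_deg_zero,
      Abelian.Ext.mk₀_comp_mk₀, Abelian.Ext.comp_assoc_of_third_deg_zero,
      Abelian.Ext.mk₀_comp_mk₀_assoc]
    simp
  exact ⟨LinearEquiv.ofLinearMap (F e.hom f.hom) (F e.inv f.inv)
    (LinearMap.ext (hF e.symm f.symm)) (LinearMap.ext (hF e f))⟩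

/-- Two linear surjections with the same kernel have isomorphic targets. -/
theorem nonempty_equiv_of_ker_eq {D E F : Type*} [AddCommGroup D] [Module k D] [AddCommGroup E]
    [Module k E] [AddCommGroup F] [Module k F] (f : D →ₗ[k] E) (g : D →ₗ[k] F)
    (hf : Function.Surjective f) (hg : Function.Surjective g)
    (h : LinearMap.ker f = LinearMap.ker g) : Nonempty (E ≃ₗ[k] F) :=
  ⟨(f.quotKerEquivOfSurjective hf).symm.trans
    ((Submodule.quotEquivOfEq _ _ h).trans (g.quotKerEquivOfSurjective hg))⟩

variable {X Y}

/-- Frees the arrow count from the chosen representatives and from `Ext`: any surjection from the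
derivations whose kernel is the inner ones computes it. -/
theorem gabrielArrows_eq_rank {S T : SimpleClass A} (e : S.rep ≃ₗ[A] X) (f : T.rep ≃ₗ[A] Y)
    {E : Type w} [AddCommGroup E] [Module k E] (Θ : homDerivations k A X Y →ₗ[k] E)
    (hΘ : Function.Surjective Θ)
    (hker : LinearMap.ker Θ = LinearMap.range (innerDerivation k A X Y)) :
    gabrielArrows k A S T = Module.rank k E := by
  obtain ⟨Ψ, hΨ, hker'⟩ := exists_derivations_to_ext k A X Y
  obtain ⟨e₁⟩ := nonempty_equiv_of_ker_eq (k := k) (D := homDerivations k A X Y) Θ Ψ hΘ hΨ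
    (hker.trans hker'.symm)
  obtain ⟨e₂⟩ := nonempty_ext_equiv_of_iso (k := k)
    (show S.rep ≅ ModuleCat.of A X from e.toModuleIso)
    (show ModuleCat.of A Y ≅ T.rep from f.symm.toModuleIso) 1
  exact (e₁.trans e₂).rank_eq.symm

theorem gabrielArrows_eq_zero {S T : SimpleClass A} (e : S.rep ≃ₗ[A] X) (f : T.rep ≃ₗ[A] Y)
    (h : ∀ D : homDerivations k A X Y, D ∈ LinearMap.range (innerDerivation k A X Y)) :
    gabrielArrows k A S T = 0 := by
  rw [gabrielArrows_eq_rank e f (0 : homDerivations k A X Y →ₗ[k] PUnit.{w + 1})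
    (fun x => ⟨0, Subsingleton.elim _ _⟩)]
  · exact rank_subsingleton' k PUnit.{w + 1}
  · rw [LinearMap.ker_zero]
    exact (eq_top_iff.2 fun D _ => h D).symm

end ExtDerivations

/-! ### Tensor products of irreducible representations -/

section TensorRepresentations

variable {k : Type u} [Field k] {G : Type v} [Group G]

/-- Burnside's theorem: over an algebraically closed field, the operators of a finite dimensional
irreducible representation span all endomorphisms. -/
theorem Representation.span_range_eq_top_of_isIrreducible [IsAlgClosed k] {V : Type*}
    [AddCommGroup V] [Module k V] [FiniteDimensional k V] (ρ : Representation k G V)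
    [ρ.IsIrreducible] : Submodule.span k (Set.range ρ) = ⊤ := by
  rw [eq_top_iff]
  rintro T -
  have hsimple : IsSimpleModule (MonoidAlgebra k G) ρ.asModule := inferInstance
  have hend := (IsSimpleModule.algebraMap_end_bijective_of_isAlgClosed (A := MonoidAlgebra k G)
    (V := ρ.asModule) k).2
  let T' : ρ.asModule →ₗ[k] ρ.asModule := T
  -- By Schur's lemma the endomorphism ring consists of scalars, so every $k$-linear operator
  -- commutes with it and the density theorem applies.
  let f : Module.End (Module.End (MonoidAlgebra k G) ρ.asModule) ρ.asModule :=
    { toFun := T'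
      map_add' := T'.map_add
      map_smul' := by
        intro e x
        obtain ⟨c, rfl⟩ := hend e
        exact T'.map_smul c x }
  obtain ⟨s, hs⟩ := Module.Finite.fg_top (R := k) (M := ρ.asModule)
  obtain ⟨r, hr⟩ := jacobson_density f s
  have hT : T = ρ.asAlgebraHom r := by
    have : T' = ρ.asAlgebraHom r := by
      refine LinearMap.ext_on hs ?_
      intro m hm
      exact hr m hm
    exact this
  rw [hT]
  clear hr hT
  induction r using MonoidAlgebra.induction_linear with
  | zero => simp
  | add x y hx hy =>
    rw [map_add]
    exact Submodule.add_mem _ hx hy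
  | single g c =>
    rw [Representation.asAlgebraHom_single]
    exact Submodule.smul_mem _ _ (Submodule.subset_span ⟨g, rfl⟩)

/-! ### Outer tensor products of irreducible representations -/

section Pi

variable {ι : Type*} [Finite ι] {V : ι → Type*} [∀ i, AddCommGroup (V i)] [∀ i, Module k (V i)]
  [∀ i, FiniteDimensional k (V i)]

/-- Rank one operators move any nonzero tensor to any pure tensor. -/
theorem PiTensorProduct.exists_map_eq_tprod {x : ⨂[k] i, V i} (hx : x ≠ 0) (w : ∀ i, V i) :
    ∃ a : ∀ i, V i →ₗ[k] V i, ∃ c : k, c ≠ 0 ∧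
      PiTensorProduct.map a x = c • PiTensorProduct.tprod k w := by
  have := Fintype.ofFinite ι
  let b := fun i => Module.finBasis k (V i)
  let B := Basis.piTensorProduct b
  have hx' : B.repr x ≠ 0 := by simpa using hx
  obtain ⟨p, hp⟩ := Finsupp.ne_iff.1 hx'
  -- In factor `i` the operator reads off the coordinate `p i` and multiplies `w i` by it, so
  -- together they read off the coordinate `p` of the tensor, which is nonzero for `x`.
  have key : ∀ z, PiTensorProduct.map (fun i => ((b i).coord (p i)).smulRight (w i)) z =
      B.repr z p • PiTensorProduct.tprod k w := by
    intro z
    have : PiTensorProduct.map (fun i => ((b i).coord (p i)).smulRight (w i)) =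
        (B.coord p).smulRight (PiTensorProduct.tprod k w) := by
      ext v
      simp [B, MultilinearMap.map_smul_univ]
    exact LinearMap.congr_fun this z
  exact ⟨_, _, hp, key x⟩

variable (ρ : ∀ i, Representation k G (V i)) [∀ i, (ρ i).IsIrreducible] [IsAlgClosed k] [Finite G]

/-- By Burnside in each factor, images of `x` under all pure tensors of operators lie in `N`; rank
one operators then produce every pure tensor. -/
theorem PiTensorProduct.eq_top_of_stable (N : Submodule k (⨂[k] i, V i))
    (hN : ∀ γ : ι → G, ∀ x ∈ N, PiTensorProduct.map (fun i => ρ i (γ i)) x ∈ N)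
    {x : ⨂[k] i, V i} (hx : x ∈ N) (hx0 : x ≠ 0) : N = ⊤ := by
  have := Fintype.ofFinite ι
  have := Fintype.ofFinite G
  classical
  have h1 : ∀ a : ∀ i, V i →ₗ[k] V i, PiTensorProduct.map a x ∈ N := by
    intro a
    have ha : ∀ i, ∃ c : G → k, ∑ g, c g • ρ i g = a i := fun i => by
      have : a i ∈ Submodule.span k (Set.range (ρ i)) := by
        rw [(ρ i).span_range_eq_top_of_isIrreducible]
        trivial
      exact (Submodule.mem_span_range_iff_exists_fun k).1 this
    choose c hc using ha
    -- Expand each `a i` in group operators and use multilinearity of the tensor product of maps.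
    have : PiTensorProduct.map a = ∑ γ : ι → G, (∏ i, c i (γ i)) •
        PiTensorProduct.map fun i => ρ i (γ i) := by
      have h := (PiTensorProduct.mapMultilinear k V V).map_sum (fun i (g : G) => c i g • ρ i g)
      simp only [hc, PiTensorProduct.mapMultilinear_apply] at h
      rw [h]
      refine Finset.sum_congr rfl fun γ _ => ?_
      exact (PiTensorProduct.mapMultilinear k V V).map_smul_univ _ _
    rw [this, LinearMap.sum_apply]
    exact N.sum_mem fun γ _ => N.smul_mem _ (hN γ x hx)
  rw [eq_top_iff, ← PiTensorProduct.span_tprod_eq_top, Submodule.span_le]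
  rintro _ ⟨w, rfl⟩
  obtain ⟨a, c, hc, ha⟩ := PiTensorProduct.exists_map_eq_tprod hx0 w
  exact (N.smul_mem_iff hc).1 (ha ▸ h1 a)

/-- Schur's lemma for an outer tensor product of irreducible representations. -/
theorem PiTensorProduct.eq_smul_of_commute (d : (⨂[k] i, V i) →ₗ[k] ⨂[k] i, V i)
    (hd : ∀ γ : ι → G, ∀ x, d (PiTensorProduct.map (fun i => ρ i (γ i)) x) =
      PiTensorProduct.map (fun i => ρ i (γ i)) (d x)) : ∃ c : k, ∀ x, d x = c • x := by
  rcases subsingleton_or_nontrivial (⨂[k] i, V i) with h | h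
  · exact ⟨0, fun x => Subsingleton.elim _ _⟩
  -- An eigenspace of `d` is stable under the group and nonzero, hence everything.
  obtain ⟨c, hc⟩ := Module.End.exists_eigenvalue (K := k) d
  obtain ⟨x, hx, hx0⟩ := hc.exists_hasEigenvector
  refine ⟨c, fun y => ?_⟩
  have := PiTensorProduct.eq_top_of_stable ρ (Module.End.eigenspace d c) (fun γ y hy => by
    rw [Module.End.mem_eigenspace_iff] at hy ⊢
    rw [hd, hy, map_smul]) hx hx0
  exact Module.End.mem_eigenspace_iff.1 (this ▸ Submodule.mem_top : y ∈ Module.End.eigenspace d c)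

end Pi

/-! ### Splitting off one tensor factor -/

section Split

variable {ι J : Type*} (V : ι → Type*) [∀ i, AddCommGroup (V i)] [∀ i, Module k (V i)]
  (D : ι) (g : J → ι) (h : Function.Bijective (Sum.elim (fun _ : Unit => D) g))

/-- Splitting off one tensor factor. -/
noncomputable def PiTensorProduct.split : (⨂[k] i, V i) ≃ₗ[k] V D ⊗[k] (⨂[k] j, V (g j)) :=
  (PiTensorProduct.reindex k V (Equiv.ofBijective _ h).symm).trans
    ((PiTensorProduct.tmulEquivDep k
      (fun s : Unit ⊕ J => V (Sum.elim (fun _ : Unit => D) g s))).symm.trans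
      (TensorProduct.congr (PiTensorProduct.subsingletonEquiv (s := fun _ : Unit => V D) ())
        (LinearEquiv.refl k _)))

@[simp]
theorem PiTensorProduct.split_tprod (v : ∀ i, V i) :
    PiTensorProduct.split V D g h (PiTensorProduct.tprod k v) =
      v D ⊗ₜ PiTensorProduct.tprod k fun j => v (g j) := by
  have h1 := PiTensorProduct.reindex_tprod (R := k) (s := V) (Equiv.ofBijective _ h).symm v
  have h2 := PiTensorProduct.tmulEquivDep_symm_apply (R := k)
    (N := fun s : Unit ⊕ J => V (Sum.elim (fun _ : Unit => D) g s))
    (fun s => v (Sum.elim (fun _ : Unit => D) g s))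
  have h3 := PiTensorProduct.subsingletonEquiv_apply_tprod (R := k)
    (s := fun _ : Unit => V D) () (fun _ => v D)
  refine (congrArg (fun z => TensorProduct.congr
    (PiTensorProduct.subsingletonEquiv (R := k) (s := fun _ : Unit => V D) ())
        (LinearEquiv.refl k (⨂[k] j, V (g j))) ((PiTensorProduct.tmulEquivDep k
      (fun s : Unit ⊕ J => V (Sum.elim (fun _ : Unit => D) g s))).symm z)) h1).trans ?_
  refine (congrArg (TensorProduct.congr
    (PiTensorProduct.subsingletonEquiv (R := k) (s := fun _ : Unit => V D) ())
        (LinearEquiv.refl k (⨂[k] j, V (g j)))) h2).trans ?_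
  exact congrArg (fun z => z ⊗ₜ[k] PiTensorProduct.tprod k fun j => v (g j)) h3

theorem PiTensorProduct.split_map {W : ι → Type*} [∀ i, AddCommGroup (W i)]
    [∀ i, Module k (W i)] (a : ∀ i, V i →ₗ[k] W i) (x : ⨂[k] i, V i) :
    PiTensorProduct.split W D g h (PiTensorProduct.map a x) =
      TensorProduct.map (a D) (PiTensorProduct.map fun j => a (g j))
        (PiTensorProduct.split V D g h x) := by
  have : (PiTensorProduct.split W D g h).toLinearMap ∘ₗ PiTensorProduct.map a =
      TensorProduct.map (a D) (PiTensorProduct.map fun j => a (g j)) ∘ₗ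
        (PiTensorProduct.split V D g h).toLinearMap := by
    ext v
    simp
  exact LinearMap.congr_fun this x

end Split

end TensorRepresentations

/-! ### Linear maps between tensor products -/

section TensorHom

variable {k : Type*} [Field k] {X R U T : Type*} [AddCommGroup X] [Module k X] [AddCommGroup R]
  [Module k R] [AddCommGroup U] [Module k U] [AddCommGroup T] [Module k T]

/-- Evaluate a functional on the right tensor factor. -/
noncomputable def TensorProduct.sliceRight (ξ : R →ₗ[k] k) : X ⊗[k] R →ₗ[k] X :=
  (TensorProduct.rid k X).toLinearMap ∘ₗ TensorProduct.map LinearMap.id ξ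

/-- Evaluate a functional on the left tensor factor. -/
noncomputable def TensorProduct.sliceLeft (ξ : X →ₗ[k] k) : X ⊗[k] R →ₗ[k] R :=
  (TensorProduct.lid k R).toLinearMap ∘ₗ TensorProduct.map ξ LinearMap.id

@[simp]
theorem TensorProduct.sliceRight_tmul (ξ : R →ₗ[k] k) (x : X) (r : R) :
    TensorProduct.sliceRight ξ (x ⊗ₜ[k] r) = ξ r • x := by
  simp [sliceRight]

@[simp]
theorem TensorProduct.sliceLeft_tmul (ξ : X →ₗ[k] k) (x : X) (r : R) :
    TensorProduct.sliceLeft ξ (x ⊗ₜ[k] r) = ξ x • r := by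
  simp [sliceLeft]

theorem TensorProduct.eq_zero_of_sliceRight {z : X ⊗[k] R}
    (h : ∀ ξ : R →ₗ[k] k, TensorProduct.sliceRight ξ z = 0) : z = 0 := by
  let b := Module.Free.chooseBasis k R
  have key : ∀ (z : X ⊗[k] R) i,
      TensorProduct.equivFinsuppOfBasisRight b z i = TensorProduct.sliceRight (b.coord i) z := by
    intro z i
    induction z using TensorProduct.induction_on with
    | zero => simp
    | tmul x r => simp
    | add z w hz hw => simp [hz, hw]
  apply (TensorProduct.equivFinsuppOfBasisRight (M := X) b).injective
  ext i
  rw [key, h, map_zero]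
  rfl

theorem TensorProduct.eq_zero_of_sliceLeft {z : X ⊗[k] R}
    (h : ∀ ξ : X →ₗ[k] k, TensorProduct.sliceLeft ξ z = 0) : z = 0 := by
  rw [← (TensorProduct.comm k X R).map_eq_zero_iff]
  refine TensorProduct.eq_zero_of_sliceRight fun ξ => ?_
  rw [← h ξ]
  generalize z = w
  induction w using TensorProduct.induction_on with
  | zero => simp
  | tmul x r => simp
  | add z w hz hw => simp only [map_add, hz, hw]

theorem TensorProduct.apply_sliceRight (ξ : X →ₗ[k] k) (η : R →ₗ[k] k) (z : X ⊗[k] R) :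
    ξ (TensorProduct.sliceRight η z) = η (TensorProduct.sliceLeft ξ z) := by
  induction z using TensorProduct.induction_on with
  | zero => simp
  | tmul x r => simp [mul_comm]
  | add z w hz hw => simp only [map_add, hz, hw]

theorem TensorProduct.sliceRight_map (ξ : R →ₗ[k] k) (a : X →ₗ[k] U) (z : X ⊗[k] R) :
    TensorProduct.sliceRight ξ (TensorProduct.map a LinearMap.id z) =
      a (TensorProduct.sliceRight ξ z) := by
  induction z using TensorProduct.induction_on with
  | zero => simp
  | tmul x r => simp
  | add z w hz hw => simp only [map_add, hz, hw]

theorem TensorProduct.sliceLeft_map (ξ : X →ₗ[k] k) (a : R →ₗ[k] T) (z : X ⊗[k] R) :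
    TensorProduct.sliceLeft ξ (TensorProduct.map LinearMap.id a z) =
      a (TensorProduct.sliceLeft ξ z) := by
  induction z using TensorProduct.induction_on with
  | zero => simp
  | tmul x r => simp
  | add z w hz hw => simp only [map_add, hz, hw]

/-- If no nonzero map `X → U` is equivariant, then no nonzero map `X ⊗ R → U ⊗ T` is equivariant in
the first factor. -/
theorem TensorProduct.eq_zero_of_equivariant_left {Γ : Type*} (a : Γ → X →ₗ[k] X)
    (b : Γ → U →ₗ[k] U)
    (h : ∀ φ : X →ₗ[k] U, (∀ g x, φ (a g x) = b g (φ x)) → φ = 0)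
    (d : X ⊗[k] R →ₗ[k] U ⊗[k] T)
    (hd : ∀ g z, d (TensorProduct.map (a g) LinearMap.id z) =
      TensorProduct.map (b g) LinearMap.id (d z)) : d = 0 := by
  ext x r
  refine TensorProduct.eq_zero_of_sliceRight fun ξ => ?_
  have := h (TensorProduct.sliceRight ξ ∘ₗ d ∘ₗ (TensorProduct.mk k X R).flip r) fun g x => by
    have := hd g (x ⊗ₜ r)
    simp only [TensorProduct.map_tmul, LinearMap.id_apply] at this
    simp [this, TensorProduct.sliceRight_map]
  exact LinearMap.congr_fun this x

/-- If only scalars commute with the operators on `R`, then every map `X ⊗ R → U ⊗ R` which is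
equivariant in the second factor is of the form `φ ⊗ 1`. -/
theorem TensorProduct.exists_eq_map_id {Γ : Type*} (a : Γ → R →ₗ[k] R)
    (h : ∀ φ : R →ₗ[k] R, (∀ g x, φ (a g x) = a g (φ x)) → ∃ c : k, ∀ x, φ x = c • x)
    (d : X ⊗[k] R →ₗ[k] U ⊗[k] R)
    (hd : ∀ g z, d (TensorProduct.map LinearMap.id (a g) z) =
      TensorProduct.map LinearMap.id (a g) (d z)) :
    ∃ φ : X →ₗ[k] U, d = TensorProduct.map φ LinearMap.id := by
  rcases subsingleton_or_nontrivial R with hR | hR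
  · refine ⟨0, ?_⟩
    ext x r
    rw [Subsingleton.elim r 0]
    simp
  obtain ⟨r₀, hr₀⟩ := exists_ne (0 : R)
  obtain ⟨ξ, hξ⟩ := Module.Projective.exists_dual_eq_one k hr₀
  -- If $d=\varphi\otimes 1$, then $\varphi$ is recovered by inserting $r_0$ and applying $\xi$,
  -- because $\xi(r_0)=1$.
  let φ : X →ₗ[k] U := TensorProduct.sliceRight ξ ∘ₗ d ∘ₗ (TensorProduct.mk k X R).flip r₀
  refine ⟨φ, ?_⟩
  ext x r
  simp only [TensorProduct.AlgebraTensorModule.curry_apply, LinearMap.restrictScalars_self,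
    TensorProduct.curry_apply, TensorProduct.map_tmul, LinearMap.id_apply]
  rw [← sub_eq_zero]
  refine TensorProduct.eq_zero_of_sliceLeft fun η => ?_
  -- With $x$ and $\eta$ fixed, $d$ becomes an equivariant endomorphism of $R$, hence a scalar $c$.
  -- Evaluating at $r_0$ and applying $\xi$ identifies $c$ with $\eta(\varphi(x))$.
  obtain ⟨c, hc⟩ := h (TensorProduct.sliceLeft η ∘ₗ d ∘ₗ TensorProduct.mk k X R x) fun g r => by
    have := hd g (x ⊗ₜ r)
    simp only [TensorProduct.map_tmul, LinearMap.id_apply] at this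
    simp [this, TensorProduct.sliceLeft_map]
  simp only [LinearMap.comp_apply, TensorProduct.mk_apply] at hc
  have hφ : η (φ x) = c := by
    simp [φ, TensorProduct.apply_sliceRight, hc, hξ]
  rw [map_sub, hc, TensorProduct.sliceLeft_tmul, hφ, sub_self]

theorem TensorProduct.map_id_injective [Nontrivial R] {φ ψ : X →ₗ[k] U}
    (h : TensorProduct.map φ (LinearMap.id : R →ₗ[k] R) = TensorProduct.map ψ LinearMap.id) :
    φ = ψ := by
  obtain ⟨r₀, hr₀⟩ := exists_ne (0 : R)
  obtain ⟨ξ, hξ⟩ := Module.Projective.exists_dual_eq_one k hr₀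
  ext x
  have := congrArg (TensorProduct.sliceRight ξ) (LinearMap.congr_fun h (x ⊗ₜ r₀))
  simpa [hξ] using this

end TensorHom

/-! ### Symmetry of the dimension of intertwining spaces -/

section TracePairing

variable {k : Type*} [Field k] {G : Type*} [Group G] [Finite G]
  {V W : Type*} [AddCommGroup V] [Module k V] [AddCommGroup W] [Module k W]
  [FiniteDimensional k V] [FiniteDimensional k W]

/-- Take a rank one `h₀ : W → V` with $\mathrm{tr}(f h_0)=1$ and sum its conjugates over $G$. Since
$f$ is equivariant, each conjugate contributes trace $1$, so the total is $|G|\neq 0$. -/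
theorem Representation.exists_trace_ne_zero (hG : (Nat.card G : k) ≠ 0) (ρ : Representation k G V)
    (τ : Representation k G W) {f : ρ.IntertwiningMap τ} (hf : f ≠ 0) :
    ∃ h : τ.IntertwiningMap ρ, LinearMap.trace k W (f.toLinearMap ∘ₗ h.toLinearMap) ≠ 0 := by
  have := Fintype.ofFinite G
  obtain ⟨x, hx⟩ : ∃ x, f x ≠ 0 := by
    by_contra! H
    exact hf (DFunLike.ext _ _ H)
  obtain ⟨ξ, hξ⟩ := Module.Projective.exists_dual_eq_one k hx
  let h₀ : W →ₗ[k] V := ξ.smulRight x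
  have h₀tr : LinearMap.trace k W (f.toLinearMap ∘ₗ h₀) = 1 := by
    have : f.toLinearMap ∘ₗ h₀ = ξ.smulRight (f x) := by ext; simp [h₀]
    rw [this, LinearMap.trace_smulRight, hξ]
  let h : τ.IntertwiningMap ρ :=
    ⟨∑ g : G, ρ g ∘ₗ h₀ ∘ₗ τ g⁻¹, fun g => by
      ext w
      simp only [LinearMap.comp_apply, LinearMap.sum_apply, map_sum]
      refine Fintype.sum_equiv (Equiv.mulLeft g⁻¹) _ _ fun g' => ?_
      simp [← Module.End.mul_apply, ← map_mul]⟩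
  refine ⟨h, ?_⟩
  have : LinearMap.trace k W (f.toLinearMap ∘ₗ h.toLinearMap) = (Nat.card G : k) := by
    have h1 : ∀ g : G, LinearMap.trace k W (f.toLinearMap ∘ₗ ρ g ∘ₗ h₀ ∘ₗ τ g⁻¹) = 1 := by
      intro g
      have e : f.toLinearMap ∘ₗ ρ g ∘ₗ h₀ ∘ₗ τ g⁻¹ = (τ g) * ((f.toLinearMap ∘ₗ h₀) * τ g⁻¹) := by
        rw [← LinearMap.comp_assoc, f.isIntertwining']
        rfl
      rw [e, LinearMap.trace_mul_comm, mul_assoc, ← map_mul, inv_mul_cancel, map_one, mul_one,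
        h₀tr]
    have e : f.toLinearMap ∘ₗ h.toLinearMap = ∑ g : G, f.toLinearMap ∘ₗ ρ g ∘ₗ h₀ ∘ₗ τ g⁻¹ := by
      ext w
      simp [h]
    rw [e, map_sum, Finset.sum_congr rfl fun g _ => h1 g]
    simp
  rwa [this]

/-- The pairing $(f,h)\mapsto\mathrm{tr}(fh)$ embeds one space of intertwining maps in the dual of
the other. No decomposition into irreducibles is needed, and exchanging the roles gives equality. -/
theorem Representation.finrank_intertwiningMap_le (hG : (Nat.card G : k) ≠ 0)
    (ρ : Representation k G V) (τ : Representation k G W) :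
    Module.finrank k (ρ.IntertwiningMap τ) ≤ Module.finrank k (τ.IntertwiningMap ρ) := by
  let F : ρ.IntertwiningMap τ →ₗ[k] Module.Dual k (τ.IntertwiningMap ρ) :=
    LinearMap.mk₂ k (fun f h => LinearMap.trace k W (f.toLinearMap ∘ₗ h.toLinearMap))
      (by intro f f' h; rw [← map_add]; rfl)
      (by intro c f h; rw [← map_smul]; rfl)
      (by intro f h h'; rw [← map_add, ← LinearMap.comp_add]; rfl)
      (by intro c f h; rw [← map_smul, ← LinearMap.comp_smul]; rfl)
  have hF : Function.Injective F := by
    rw [injective_iff_map_eq_zero]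
    intro f hf
    by_contra hne
    obtain ⟨h, hh⟩ := ρ.exists_trace_ne_zero hG τ hne
    exact hh (LinearMap.congr_fun hf h)
  exact (LinearMap.finrank_le_finrank_of_injective hF).trans_eq Subspace.dual_finrank_eq

end TracePairing

/-! ### Simple modules up to isomorphism -/

section SimpleClasses

variable {A : Type w} [Ring A]

instance (S : SimpleClass A) : IsSimpleModule A S.rep := (Quotient.out S).2

theorem SimpleClass.eq_of_equiv {S T : SimpleClass A} (e : S.rep ≃ₗ[A] T.rep) : S = T := by
  rw [← Quotient.out_eq S, ← Quotient.out_eq T]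
  exact Quotient.sound ⟨e⟩

/-- The class of a simple module. -/
def SimpleClass.mk (X : Type w) [AddCommGroup X] [Module A X] [IsSimpleModule A X] :
    SimpleClass A :=
  Quotient.mk (simpleModuleSetoid A) ⟨ModuleCat.of A X, ‹_›⟩

theorem SimpleClass.nonempty_rep_mk_equiv (X : Type w) [AddCommGroup X] [Module A X]
    [IsSimpleModule A X] : Nonempty ((SimpleClass.mk (A := A) X).rep ≃ₗ[A] X) :=
  Quotient.mk_out (s := simpleModuleSetoid A) ⟨ModuleCat.of A X, ‹_›⟩

end SimpleClasses

section Irr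

variable {k : Type u} [Field k] {G : Type v} [Group G]

/-- The underlying space of a simple `kG`-module, as a `k`-module which is an additive group. -/
def Irr.Carrier (V : Irr k G) : Type (max u v) := V.rep

noncomputable instance (V : Irr k G) : AddCommGroup V.Carrier :=
  inferInstanceAs (AddCommGroup V.rep)

noncomputable instance (V : Irr k G) : Module k V.Carrier :=
  inferInstanceAs (Module k (RestrictScalars k (MonoidAlgebra k G) V.rep))

/-- The action of `G` on `V.Carrier`. -/
noncomputable def Irr.rho (V : Irr k G) : Representation k G V.Carrier := V.action

instance (V : Irr k G) : Representation.IsIrreducible (Irr.rho V) :=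
  (Representation.isSimpleModule_iff_irreducible_ofModule (k := k) (G := G) V.rep).1 inferInstance

instance [Finite G] (V : Irr k G) : FiniteDimensional k (V.Carrier) := by
  have := IsSimpleModule.nontrivial (MonoidAlgebra k G) V.rep
  obtain ⟨x, hx⟩ := exists_ne (0 : V.rep)
  have hs := IsSimpleModule.toSpanSingleton_surjective (MonoidAlgebra k G) hx
  let f : MonoidAlgebra k G →ₗ[k] V.Carrier :=
    { toFun := fun a => LinearMap.toSpanSingleton (MonoidAlgebra k G) V.rep x a
      map_add' := map_add _
      map_smul' := fun c a => by
        rw [← algebraMap_smul (MonoidAlgebra k G) c a, map_smul]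
        rfl }
  have : FiniteDimensional k (MonoidAlgebra k G) :=
    Module.Finite.equiv (MonoidAlgebra.coeffLinearEquiv k (S := k) (M := G)).symm
  exact Module.Finite.of_surjective f hs

instance (V : Irr k G) : Nontrivial (V.Carrier) :=
  IsSimpleModule.nontrivial (MonoidAlgebra k G) V.rep

theorem Irr.nontrivial_piTensorProduct [Finite G] {ι : Type*} [Finite ι] (V : ι → Irr k G) :
    Nontrivial (⨂[k] i, (V i).Carrier) := by
  have := Fintype.ofFinite ι
  let b := Basis.piTensorProduct fun i => Module.finBasis k (V i).Carrier
  have : Nonempty (∀ i, Fin (Module.finrank k (V i).Carrier)) :=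
    ⟨fun i => ⟨0, Module.finrank_pos⟩⟩
  exact b.repr.toEquiv.nontrivial

/-- A `kG`-linear map, as a `k`-linear map on the underlying space. -/
noncomputable def Irr.restrict {V : Irr k G} {X : Type*} [AddCommGroup X] [Module k X]
    [Module (MonoidAlgebra k G) X] [IsScalarTower k (MonoidAlgebra k G) X]
    (ψ : V.rep →ₗ[MonoidAlgebra k G] X) : V.Carrier →ₗ[k] X where
  toFun := ψ
  map_add' := ψ.map_add
  map_smul' c x := by
    refine (ψ.map_smul (algebraMap k _ c) x).trans ?_
    rw [algebraMap_smul]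
    rfl

theorem Irr.restrict_rho {V : Irr k G} {X : Type*} [AddCommGroup X] [Module k X]
    [Module (MonoidAlgebra k G) X] [IsScalarTower k (MonoidAlgebra k G) X]
    (ψ : V.rep →ₗ[MonoidAlgebra k G] X) (g : G) (x : V.Carrier) :
    Irr.restrict ψ (V.rho g x) = MonoidAlgebra.single g (1 : k) • Irr.restrict ψ x :=
  ψ.map_smul (MonoidAlgebra.single g (1 : k)) x

/-- Simple modules with a nonzero intertwining map between them are isomorphic. -/
theorem Irr.eq_of_intertwining {V W : Irr k G} (φ : V.Carrier →ₗ[k] W.Carrier)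
    (h : ∀ g x, φ (V.rho g x) = W.rho g (φ x)) (h0 : φ ≠ 0) : V = W := by
  let f : (V.rho).IntertwiningMap W.rho := ⟨φ, fun g => LinearMap.ext (h g)⟩
  rcases Representation.IsIrreducible.bijective_or_eq_zero f with hf | hf
  · let φ' : V.rep →+ W.rep := AddMonoidHom.mk' φ φ.map_add
    have h1 : ∀ (g : G) (x : V.rep), φ' (MonoidAlgebra.single g (1 : k) • x) =
        MonoidAlgebra.single g (1 : k) • φ' x := h
    have h2 : ∀ (c : k) (x : V.rep), φ' (algebraMap k (MonoidAlgebra k G) c • x) =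
        algebraMap k (MonoidAlgebra k G) c • φ' x := φ.map_smul
    let e : V.rep →ₗ[MonoidAlgebra k G] W.rep :=
      { φ' with
        map_smul' := fun a x => by
          change φ' (a • x) = a • φ' x
          induction a using MonoidAlgebra.induction_linear with
          | zero => rw [zero_smul, zero_smul, map_zero]
          | add a b ha hb => rw [add_smul, add_smul, map_add, ha, hb]
          | single g c =>
            have e1 : MonoidAlgebra.single g c =
                algebraMap k (MonoidAlgebra k G) c * MonoidAlgebra.single g 1 := by
              simp
            rw [e1, mul_smul, mul_smul, h2, h1] }
    exact SimpleClass.eq_of_equiv (LinearEquiv.ofBijective e hf)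
  · exact absurd (congrArg Representation.IntertwiningMap.toLinearMap hf) h0

end Irr

/-! ### The modules `S_P` -/

theorem Representation.isIrreducible_of_stable {k M V : Type*} [Field k] [Monoid M]
    [AddCommGroup V] [Module k V] [Nontrivial V] (ρ : Representation k M V)
    (h : ∀ N : Submodule k V, (∀ m, ∀ x ∈ N, ρ m x ∈ N) → N ≠ ⊥ → N = ⊤) : ρ.IsIrreducible :=
  { exists_pair_ne := ⟨⊥, ⊤, fun e => bot_ne_top
      (congrArg Subrepresentation.toSubmodule e : (⊥ : Submodule k V) = ⊤)⟩
    eq_bot_or_eq_top := fun N => by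
      by_cases hN : N.toSubmodule = ⊥
      · exact Or.inl (Subrepresentation.toSubmodule_injective hN)
      · exact Or.inr (Subrepresentation.toSubmodule_injective
          (h N.toSubmodule (fun m x hx => N.apply_mem_toSubmodule m hx) hN)) }

namespace LabelledSetPartition

variable {k : Type u} [Field k] {G : Type v} [Group G] {n : ℕ} [NeZero n]
  (P Q : LabelledSetPartition n (Irr k G)) {σ : OrderedGPartition n G}

/-- The underlying space of `S_P`, as a `k`-module which is an additive group. -/
abbrev Carrier : Type (max u v) := ⨂[k] B : P.Block, (P.label B).Carrier

/-- The action on `S_P`. -/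
noncomputable def rho : Representation k (OrderedGPartition n G) P.Carrier := P.action

theorem rho_of_refines (h : P.Refines σ) :
    P.rho σ = PiTensorProduct.map fun B => (P.label B).rho (h.value B) := dif_pos h

theorem rho_of_not_refines (h : ¬ P.Refines σ) : P.rho σ = 0 := dif_neg h

theorem rho_eq (h : P.Refines σ) {γ : P.Block → G}
    (hγ : ∀ x, σ.lab x = γ (P.blockOf x)) :
    P.rho σ = PiTensorProduct.map fun B => (P.label B).rho (γ B) := by
  rw [P.rho_of_refines h]
  congr 1
  funext B
  obtain ⟨x, rfl⟩ := P.blockOf_surjective B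
  rw [h.value_eq_lab (P.mem_blockOf x), hγ]

theorem rho_ordered (γ : P.Block → G) :
    P.rho (P.ordered γ) = PiTensorProduct.map fun B => (P.label B).rho (γ B) :=
  P.rho_eq (P.refines_ordered γ) (P.lab_ordered γ)

theorem rho_of_lab_eq_one (h : P.Refines σ) (h' : ∀ x, σ.lab x = 1) : P.rho σ = 1 := by
  rw [P.rho_eq (γ := 1) h h']
  simp only [Pi.one_apply, map_one]
  exact PiTensorProduct.map_one

theorem rho_unlabel (h : P.Refines σ) : P.rho σ.unlabel = 1 :=
  P.rho_of_lab_eq_one (refines_unlabel.2 h) σ.lab_unlabel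

theorem rho_front_one (x : Fin n) : P.rho (P.front x 1) = 1 :=
  P.rho_of_lab_eq_one (P.refines_front x 1) (P.lab_front_one x)

instance [Finite G] : Nontrivial P.Carrier := Irr.nontrivial_piTensorProduct _

instance [Finite G] [IsAlgClosed k] : P.rho.IsIrreducible :=
  Representation.isIrreducible_of_stable _ fun N hN hbot => by
    obtain ⟨x, hx, hx0⟩ := N.exists_mem_ne_zero_of_ne_bot hbot
    refine PiTensorProduct.eq_top_of_stable (fun B => (P.label B).rho) N
      (fun γ y hy => ?_) hx hx0
    rw [← P.rho_ordered]
    exact hN _ _ hy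

variable {P Q}

/-- The complement of a block, together with the block, as an index set. -/
theorem bijective_sumElim (D : P.Block) : Function.Bijective
    (Sum.elim (fun _ : Unit => D) fun C : {C : P.Block // C ≠ D} => C.1) := by
  constructor
  · rintro (a | a) (b | b) hab
    · rfl
    · exact absurd hab.symm b.2
    · exact absurd hab a.2
    · exact congrArg Sum.inr (Subtype.ext hab)
  · intro C
    by_cases h : C = D
    · exact ⟨Sum.inl (), h.symm⟩
    · exact ⟨Sum.inr ⟨C, h⟩, rfl⟩

/-- Such elements isolate the action of $G$ on the single tensor factor at the block of `x`, so that
Schur's lemma can be applied there. -/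
theorem split_rho_front (x : Fin n) (g : G) (hσ : P.Refines σ)
    (h1 : ∀ y, P.Same x y → σ.lab y = g) (h2 : ∀ y, ¬ P.Same x y → σ.lab y = 1) (z : P.Carrier) :
    PiTensorProduct.split _ _ _ (bijective_sumElim (P.blockOf x)) (P.rho σ z) =
      TensorProduct.map ((P.label (P.blockOf x)).rho g) LinearMap.id
        (PiTensorProduct.split _ _ _ (bijective_sumElim (P.blockOf x)) z) := by
  classical
  rw [P.rho_eq (γ := fun B => if B = P.blockOf x then g else 1) hσ fun y => ?_,
    PiTensorProduct.split_map]
  · congr 2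
    · rw [if_pos rfl]
    · rw [← PiTensorProduct.map_id]
      congr 1
      funext C
      rw [if_neg C.2, map_one]
      rfl
  · split_ifs with h
    · exact h1 y (P.same_iff.2 h.symm)
    · exact h2 y fun h' => h (P.same_iff.1 h').symm

/-- If the same block of `P` and `Q` has different labels, then there is no nonzero map between
`S_P` and `S_Q` which is equivariant for the elements which are above both. -/
theorem eq_zero_of_label_ne [Finite G] {x : Fin n} (hx : ∀ y, P.Same x y ↔ Q.Same x y)
    (hne : P.label (P.blockOf x) ≠ Q.label (Q.blockOf x)) (d : P.Carrier →ₗ[k] Q.Carrier)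
    (hd : ∀ σ : OrderedGPartition n G, P.Refines σ → Q.Refines σ →
      ∀ z, d (P.rho σ z) = Q.rho σ (d z)) : d = 0 := by
  let eP := PiTensorProduct.split (k := k) (fun B => (P.label B).Carrier) _ _
    (bijective_sumElim (P.blockOf x))
  let eQ := PiTensorProduct.split (k := k) (fun B => (Q.label B).Carrier) _ _
    (bijective_sumElim (Q.blockOf x))
  have key := TensorProduct.eq_zero_of_equivariant_left (P.label (P.blockOf x)).rho
    (Q.label (Q.blockOf x)).rho (fun φ hφ => by
      by_contra h0
      exact hne (Irr.eq_of_intertwining φ hφ h0))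
    (eQ.toLinearMap ∘ₗ d ∘ₗ eP.symm.toLinearMap) (fun g z => by
      have hQ : Q.Refines (P.front x g) := refines_iff.2 fun y z h => by
        rw [same_front, hx, hx]
        exact ⟨fun h' => h'.trans h, fun h' => h'.trans h.symm⟩
      have h1 := split_rho_front x g (P.refines_front x g)
        (fun y => P.lab_front_of_same g) (fun y => P.lab_front_of_not_same g) (eP.symm z)
      have h2 := split_rho_front x g hQ
        (fun y h => P.lab_front_of_same g ((hx y).2 h))
        (fun y h => P.lab_front_of_not_same g fun h' => h ((hx y).1 h')) (d (eP.symm z))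
      rw [← hd _ (P.refines_front x g) hQ] at h2
      have h3 : P.rho (P.front x g) (eP.symm z) = eP.symm
          (TensorProduct.map ((P.label (P.blockOf x)).rho g) LinearMap.id z) := by
        rw [← eP.symm_apply_apply (P.rho (P.front x g) (eP.symm z))]
        exact congrArg eP.symm (h1.trans (by rw [eP.apply_symm_apply]))
      rw [h3] at h2
      exact h2)
  ext1
  refine MultilinearMap.ext fun m => ?_
  have := LinearMap.congr_fun key (eP (PiTensorProduct.tprod k m))
  simp only [LinearMap.comp_apply, LinearEquiv.coe_coe, LinearEquiv.symm_apply_apply,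
    LinearMap.zero_apply] at this
  exact eQ.map_eq_zero_iff.1 this

/-- `S_P` determines `P`. -/
theorem eq_of_equiv [Finite G] (e : P.Carrier ≃ₗ[k] Q.Carrier)
    (he : ∀ (σ : OrderedGPartition n G) z, e (P.rho σ z) = Q.rho σ (e z)) : P = Q := by
  -- An unlabelled element acts on $S_P$ as the identity or as zero according to whether `P` refines
  -- it, so the set partition can be read off from the action.
  have key : ∀ {P Q : LabelledSetPartition n (Irr k G)} (e : P.Carrier ≃ₗ[k] Q.Carrier)
      (_ : ∀ (σ : OrderedGPartition n G) z, e (P.rho σ z) = Q.rho σ (e z)),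
      ∀ σ : OrderedGPartition n G, P.Refines σ → Q.Refines σ := by
    intro P Q e he σ h
    by_contra hQ
    obtain ⟨z, hz⟩ := exists_ne (0 : P.Carrier)
    have := he σ.unlabel z
    rw [P.rho_unlabel h, Q.rho_of_not_refines (refines_unlabel.not.2 hQ)] at this
    exact hz (e.map_eq_zero_iff.1 this)
  have h1 := key e he
  have h2 := key e.symm fun σ z => by
    rw [LinearEquiv.symm_apply_eq, he, e.apply_symm_apply]
  have hsame : ∀ x y, P.Same x y ↔ Q.Same x y := by
    intro x y
    constructor
    · intro h
      have := refines_iff.1 (h2 _ (Q.refines_ordered 1)) x y h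
      rwa [same_ordered] at this
    · intro h
      have := refines_iff.1 (h1 _ (P.refines_ordered 1)) x y h
      rwa [same_ordered] at this
  refine eq_of_same hsame fun x => ?_
  by_contra hne
  have := eq_zero_of_label_ne (hsame x) hne e.toLinearMap fun σ _ _ z => he σ z
  obtain ⟨z, hz⟩ := exists_ne (0 : P.Carrier)
  exact hz (e.map_eq_zero_iff.1 (LinearMap.congr_fun this z))

end LabelledSetPartition

/-! ### Irreducible representations of powers of a group -/

section PowerOfGroup

variable {k : Type u} [Field k] {G : Type v} [Group G] [Finite G] {ι : Type*} [Finite ι]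
  {N : Type*} [AddCommGroup N] [Module k N]

open scoped Classical in
/-- The multilinear map on `k[G]` which sends a family of elements of `G` to its action on `n`. -/
noncomputable def Representation.orbitMap [Fintype (ι → G)] [Fintype ι]
    (τ : Representation k (ι → G) N) (n : N) :
    MultilinearMap k (fun _ : ι => MonoidAlgebra k G) N :=
  ∑ γ : ι → G, ((MultilinearMap.mkPiAlgebra k ι k).compLinearMap
    fun i => Finsupp.lapply (γ i) ∘ₗ (MonoidAlgebra.coeffLinearEquiv k).toLinearMap).smulRight
      (τ γ n)

theorem Representation.orbitMap_apply [Fintype (ι → G)] [Fintype ι]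
    (τ : Representation k (ι → G) N) (n : N) (a : ι → MonoidAlgebra k G) :
    τ.orbitMap n a = ∑ γ : ι → G, (∏ i, (a i).coeff (γ i)) • τ γ n := by
  simp only [orbitMap, sum_apply, MultilinearMap.smulRight_apply,
    MultilinearMap.compLinearMap_apply, MultilinearMap.mkPiAlgebra_apply]
  rfl

theorem Representation.orbitMap_one [Fintype (ι → G)] [Fintype ι]
    (τ : Representation k (ι → G) N) (n : N) : τ.orbitMap n 1 = n := by
  classical
  rw [orbitMap_apply, Finset.sum_eq_single 1]
  · simp
  · intro γ _ hγ
    obtain ⟨i, hi⟩ := Function.ne_iff.1 hγ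
    rw [Finset.prod_eq_zero (Finset.mem_univ i), zero_smul]
    rw [Pi.one_apply, MonoidAlgebra.one_def, MonoidAlgebra.coeff_single]
    exact Finsupp.single_eq_of_ne hi
  · simp

/-- Equivariance of `orbitMap`, by the substitution $\delta\mapsto\gamma^{-1}\delta$ in the sum. It
lets tensor products of left ideals of $k[G]$ map to `N`. -/
theorem Representation.orbitMap_single_mul [Fintype (ι → G)] [Fintype ι]
    (τ : Representation k (ι → G) N) (n : N) (γ : ι → G) (a : ι → MonoidAlgebra k G) :
    τ.orbitMap n (fun i => MonoidAlgebra.single (γ i) 1 * a i) = τ γ (τ.orbitMap n a) := by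
  rw [orbitMap_apply, orbitMap_apply, map_sum]
  refine Fintype.sum_equiv (Equiv.mulLeft γ⁻¹) _ _ fun δ => ?_
  rw [map_smul, ← Module.End.mul_apply, ← map_mul, Equiv.coe_mulLeft, mul_inv_cancel_left]
  congr 1
  refine Finset.prod_congr rfl fun i _ => ?_
  rw [MonoidAlgebra.coeff_single_mul_apply, one_mul]
  rfl

/-- The unit of a semisimple ring is a sum of elements of simple ideals. -/
theorem exists_sum_simple_eq_one (R : Type*) [Ring R] [IsSemisimpleModule R R] :
    ∃ (s : Finset {L : Submodule R R // IsSimpleModule R L}) (ε : ∀ L ∈ s, L.1),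
      ∑ L ∈ s.attach, (ε L.1 L.2 : R) = 1 := by
  have h1 : (1 : R) ∈ ⨆ L : {L : Submodule R R // IsSimpleModule R L}, L.1 := by
    have := IsSemisimpleModule.sSup_simples_eq_top R R
    rw [sSup_eq_iSup'] at this
    exact this ▸ Submodule.mem_top
  obtain ⟨f, hf, hsum⟩ := (Submodule.mem_iSup_iff_exists_finsupp _ _).1 h1
  refine ⟨f.support, fun L _ => ⟨f L, hf L⟩, ?_⟩
  rw [← hsum]
  exact Finset.sum_attach _ f

/-- An irreducible representation of `ι → G` is an outer tensor product of irreducible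
representations of `G`. -/
theorem exists_equiv_piTensorProduct [IsAlgClosed k] (hG : (Nat.card G : k) ≠ 0)
    (τ : Representation k (ι → G) N) [Nontrivial N]
    (hτ : ∀ N' : Submodule k N, (∀ γ, ∀ x ∈ N', τ γ x ∈ N') → N' ≠ ⊥ → N' = ⊤) :
    ∃ (V : ι → Irr k G) (e : (⨂[k] i, (V i).Carrier) ≃ₗ[k] N), ∀ (γ : ι → G) x,
      e (PiTensorProduct.map (fun i => (V i).rho (γ i)) x) = τ γ (e x) := by
  have := Fintype.ofFinite (ι → G)
  have := Fintype.ofFinite ι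
  have : NeZero (Nat.card G : k) := ⟨hG⟩
  classical
  obtain ⟨n, hn⟩ := exists_ne (0 : N)
  obtain ⟨s, ε, hε⟩ := exists_sum_simple_eq_one (MonoidAlgebra k G)
  -- Writing $1$ in every slot as a sum over simple left ideals and expanding multilinearly, some
  -- choice `p` of one ideal per slot has a nonzero value.
  have hm : τ.orbitMap n (fun _ => ∑ L : s, (ε L.1 L.2 : MonoidAlgebra k G)) ≠ 0 := by
    have h1 : (fun _ : ι => ∑ L : s, (ε L.1 L.2 : MonoidAlgebra k G)) = 1 := by
      funext i
      exact hε
    rwa [h1, Representation.orbitMap_one]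
  rw [MultilinearMap.map_sum] at hm
  obtain ⟨p, -, hp⟩ := Finset.exists_ne_zero_of_sum_ne_zero hm
  have hsimple : ∀ i, IsSimpleModule (MonoidAlgebra k G) (p i).1.1 := fun i => (p i).1.2
  let V : ι → Irr k G := fun i => SimpleClass.mk (p i).1.1
  have hV : ∀ i, Nonempty ((V i).rep ≃ₗ[MonoidAlgebra k G] (p i).1.1) := fun i =>
    SimpleClass.nonempty_rep_mk_equiv _
  let f := fun i => (hV i).some
  let ψ : ∀ i, (V i).Carrier →ₗ[k] MonoidAlgebra k G := fun i =>
    Irr.restrict ((p i).1.1.subtype ∘ₗ (f i).toLinearMap)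
  have hψ : ∀ i g x, ψ i ((V i).rho g x) = MonoidAlgebra.single g (1 : k) * ψ i x :=
    fun i g x => Irr.restrict_rho _ g x
  let F : (⨂[k] i, (V i).Carrier) →ₗ[k] N :=
    PiTensorProduct.lift ((τ.orbitMap n).compLinearMap ψ)
  have hF : ∀ (γ : ι → G) x, F (PiTensorProduct.map (fun i => (V i).rho (γ i)) x) = τ γ (F x) := by
    intro γ x
    have : F ∘ₗ PiTensorProduct.map (fun i => (V i).rho (γ i)) = τ γ ∘ₗ F := by
      ext v
      simp only [LinearMap.compMultilinearMap_apply, LinearMap.comp_apply,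
        PiTensorProduct.map_tprod, F, PiTensorProduct.lift.tprod,
        MultilinearMap.compLinearMap_apply, hψ]
      exact Representation.orbitMap_single_mul _ _ _ _
    exact LinearMap.congr_fun this x
  let v : ∀ i, (V i).Carrier := fun i => (f i).symm (ε (p i).1 (p i).2)
  have hv : F (PiTensorProduct.tprod k v) ≠ 0 := by
    rw [PiTensorProduct.lift.tprod, MultilinearMap.compLinearMap_apply]
    convert hp with i
    exact congrArg Subtype.val ((f i).apply_symm_apply _)
  -- Schur's argument for the nonzero equivariant map `F`: its kernel is stable in an irreducible
  -- outer tensor product, and its range is stable in the irreducible `N`.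
  refine ⟨V, LinearEquiv.ofBijective F ⟨?_, ?_⟩, hF⟩
  · rw [← LinearMap.ker_eq_bot]
    by_contra hker
    obtain ⟨x, hx, hx0⟩ := (LinearMap.ker F).exists_mem_ne_zero_of_ne_bot hker
    have := PiTensorProduct.eq_top_of_stable (fun i => (V i).rho) (LinearMap.ker F)
      (fun γ y hy => by rw [LinearMap.mem_ker] at hy ⊢; rw [hF, hy, map_zero]) hx hx0
    exact hv (LinearMap.mem_ker.1 (this ▸ Submodule.mem_top))
  · rw [← LinearMap.range_eq_top]
    refine hτ _ ?_ fun h => hv (by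
      have : F (PiTensorProduct.tprod k v) ∈ LinearMap.range F := ⟨_, rfl⟩
      rwa [h, Submodule.mem_bot] at this)
    rintro γ _ ⟨x, rfl⟩
    exact ⟨_, hF γ x⟩

end PowerOfGroup

/-! ### Every simple module is some `S_P` -/

namespace LabelledSetPartition

variable {n : ℕ} {X : Type*} {Y : Type w}

/-- The labelled set partition with the blocks of `P` and new labels. -/
def relabel (P : LabelledSetPartition n X) (V : P.Block → Y) : LabelledSetPartition n Y where
  carrier := {p | ∃ B : P.Block, p = (B.1, V B)}
  nonempty := by
    rintro _ ⟨B, rfl⟩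
    exact P.block_nonempty B
  disjoint := by
    rintro _ ⟨B, rfl⟩ _ ⟨C, rfl⟩ hne
    refine Finset.disjoint_left.2 fun x hB hC => hne ?_
    rw [P.block_eq hB hC]
  cover x := ⟨_, ⟨P.blockOf x, rfl⟩, P.mem_blockOf x⟩

variable (P : LabelledSetPartition n X) (V : P.Block → Y)

/-- The blocks do not change under relabelling. -/
def relabelBlock : (P.relabel V).Block ≃ P.Block where
  toFun B := ⟨B.1, by
    obtain ⟨x, C, h⟩ := B.2
    have h' : B.1 = C.1 := congrArg Prod.fst h
    exact h' ▸ C.2⟩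
  invFun B := ⟨B.1, V B, B, rfl⟩
  left_inv _ := rfl
  right_inv _ := rfl

theorem label_relabel (B : (P.relabel V).Block) :
    (P.relabel V).label B = V (P.relabelBlock V B) :=
  label_eq _ B ⟨P.relabelBlock V B, rfl⟩

theorem same_relabel {x y : Fin n} : (P.relabel V).Same x y ↔ P.Same x y :=
  ⟨fun ⟨B, h⟩ => ⟨P.relabelBlock V B, h⟩, fun ⟨B, h⟩ => ⟨(P.relabelBlock V).symm B, h⟩⟩

theorem refines_relabel {G : Type v} {σ : OrderedGPartition n G} :
    (P.relabel V).Refines σ ↔ P.Refines σ := by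
  simp only [refines_iff, same_relabel]

theorem value_relabel {G : Type v} {σ : OrderedGPartition n G} (h : (P.relabel V).Refines σ)
    (h' : P.Refines σ) (B : (P.relabel V).Block) :
    h.value B = h'.value (P.relabelBlock V B) := by
  obtain ⟨x, hx⟩ := (P.relabel V).block_nonempty B
  rw [h.value_eq_lab hx, h'.value_eq_lab (B := P.relabelBlock V B) hx]

end LabelledSetPartition

namespace OrderedGPartition

variable {n : ℕ} {G : Type v}

/-- The unlabelled set partition which underlies `σ`. -/
def blocks (σ : OrderedGPartition n G) : LabelledSetPartition n Unit where
  carrier := {p | ∃ q ∈ σ.parts, q.1 = p.1}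
  nonempty := by
    rintro p ⟨q, hq, h⟩
    exact h ▸ σ.nonempty q hq
  disjoint := by
    rintro ⟨p, u⟩ ⟨q, hq, h⟩ ⟨p', u'⟩ ⟨q', hq', h'⟩ hne
    refine Finset.disjoint_left.2 fun x hx hx' => hne ?_
    dsimp only at h h' hx hx'
    subst h h'
    rw [σ.eq_of_mem hq hq' hx hx']
  cover x := by
    obtain ⟨q, hq, hx⟩ := σ.cover x
    exact ⟨(q.1, ()), ⟨q, hq, rfl⟩, hx⟩

theorem same_blocks (σ : OrderedGPartition n G) {x y : Fin n} :
    σ.blocks.Same x y ↔ σ.Same x y := by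
  constructor
  · rintro ⟨⟨B, u, q, hq, h⟩, hx, hy⟩
    have h' : q.1 = B := h
    exact ⟨q, hq, h' ▸ hx, h' ▸ hy⟩
  · rintro ⟨q, hq, hx, hy⟩
    exact ⟨⟨q.1, (), q, hq, rfl⟩, hx, hy⟩

theorem mul_ordered_blocks [Monoid G] (σ : OrderedGPartition n G) :
    σ * σ.blocks.ordered 1 = σ := by
  refine ext_precedes (fun x y => ?_) fun x => ?_
  · rw [precedes_mul]
    have : σ.Same x y → ¬ (σ.blocks.ordered (1 : σ.blocks.Block → G)).Precedes x y := fun h h' =>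
      h'.not_same ((LabelledSetPartition.same_ordered _ _).2 (σ.same_blocks.2 h))
    tauto
  · rw [lab_mul, LabelledSetPartition.lab_ordered, Pi.one_apply, mul_one]

end OrderedGPartition

namespace LabelledSetPartition

variable {k : Type u} [Field k] {G : Type v} [Group G] [Finite G] {n : ℕ} [NeZero n]
  {N : Type w} [AddCommGroup N] [Module k N]

/-- An irreducible representation of the monoid of ordered `G`-partitions is an irreducible
representation of the group of functions on the blocks of some set partition, inflated. -/
theorem exists_blocks_of_stable (τ : Representation k (OrderedGPartition n G) N) [Nontrivial N]
    (hτ : ∀ N' : Submodule k N, (∀ σ, ∀ x ∈ N', τ σ x ∈ N') → N' ≠ ⊥ → N' = ⊤) :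
    ∃ P : LabelledSetPartition n Unit, τ (P.ordered 1) = 1 ∧
      ∀ σ, ¬ P.Refines σ → τ σ = 0 := by
  classical
  have := Fintype.ofFinite (OrderedGPartition n G)
  let pairs : OrderedGPartition n G → Finset (Fin n × Fin n) := fun σ =>
    Finset.univ.filter fun p => σ.Same p.1 p.2
  -- A finest element acting nontrivially, fineness being measured by the number of pairs of points
  -- in a common block.
  obtain ⟨σ, hσ, hmin⟩ := Finset.exists_min_image
    (Finset.univ.filter fun σ : OrderedGPartition n G => τ σ ≠ 0) (fun σ => (pairs σ).card)
    ⟨1, by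
      rw [Finset.mem_filter, map_one]
      exact ⟨Finset.mem_univ _, one_ne_zero⟩⟩
  rw [Finset.mem_filter] at hσ
  let P := σ.blocks
  let e : OrderedGPartition n G := P.ordered 1
  have he : ∀ x, e.lab x = 1 := fun x => P.lab_ordered 1 x
  have he0 : τ e ≠ 0 := fun h => hσ.2 (by
    rw [← σ.mul_ordered_blocks, map_mul]
    exact (congrArg (τ σ * ·) h).trans (mul_zero _))
  -- The kernel of `e` is stable, because $e\sigma' = e\sigma' e$ kills whatever `e` kills.
  have hker : LinearMap.ker (τ e) = ⊥ := by
    by_contra hne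
    have := hτ _ (fun σ' x hx => by
      rw [LinearMap.mem_ker] at hx ⊢
      rw [← Module.End.mul_apply, ← map_mul, ← OrderedGPartition.mul_mul_of_lab_eq_one σ' he,
        map_mul, Module.End.mul_apply, hx, map_zero]) hne
    exact he0 (LinearMap.ker_eq_top.1 this)
  have hee : e * e = e := by
    have := OrderedGPartition.mul_mul_of_lab_eq_one 1 he
    rwa [mul_one] at this
  have he1 : τ e = 1 := by
    ext x
    refine LinearMap.ker_eq_bot.1 hker ?_
    rw [← Module.End.mul_apply, ← map_mul, hee]
    rfl
  refine ⟨P, he1, fun σ' h => ?_⟩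
  by_contra h0
  rw [refines_iff] at h
  push Not at h
  obtain ⟨x, y, hxy, hxy'⟩ := h
  -- If `σ'` acted nontrivially then so would `e * σ'`, but it separates the pair `(x, y)` which `σ`
  -- keeps together, against minimality.
  have h1 : τ (e * σ') ≠ 0 := by rwa [map_mul, he1, one_mul]
  have h2 := hmin (e * σ') (Finset.mem_filter.2 ⟨Finset.mem_univ _, h1⟩)
  refine absurd (Finset.card_lt_card (Finset.ssubset_iff_subset_ne.2 ⟨?_, ?_⟩)) h2.not_gt
  · intro p hp
    simp only [pairs, Finset.mem_filter, Finset.mem_univ, true_and,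
      OrderedGPartition.same_mul] at hp ⊢
    rw [← σ.same_blocks]
    exact (P.same_ordered 1).1 hp.1
  · intro heq
    have : (x, y) ∈ pairs σ :=
      Finset.mem_filter.2 ⟨Finset.mem_univ _, σ.same_blocks.1 hxy⟩
    rw [← heq] at this
    exact hxy' ((OrderedGPartition.same_mul _ _).1 (Finset.mem_filter.1 this).2).2

/-- Once `P.ordered 1` acts as the identity, submodules for the monoid and for $G^{\text{blocks}}$
coincide, so irreducibility passes to the group. -/
theorem exists_equiv_of_stable [IsAlgClosed k] (hG : (Nat.card G : k) ≠ 0)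
    (τ : Representation k (OrderedGPartition n G) N) [Nontrivial N]
    (hτ : ∀ N' : Submodule k N, (∀ σ, ∀ x ∈ N', τ σ x ∈ N') → N' ≠ ⊥ → N' = ⊤) :
    ∃ (P : LabelledSetPartition n (Irr k G)) (e : P.Carrier ≃ₗ[k] N),
      ∀ σ x, e (P.rho σ x) = τ σ (e x) := by
  obtain ⟨P, hP1, hP0⟩ := exists_blocks_of_stable τ hτ
  have hPσ : ∀ {σ} (h : P.Refines σ), τ σ = τ (P.ordered h.value) := fun {σ} h => by
    rw [← h.ordered_one_mul, map_mul, hP1, one_mul]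
  let τ' : Representation k (P.Block → G) N :=
    { toFun := fun γ => τ (P.ordered γ)
      map_one' := hP1
      map_mul' := fun γ δ => by rw [← P.ordered_mul_ordered, map_mul] }
  obtain ⟨V, e, he⟩ := exists_equiv_piTensorProduct hG τ' fun N' hN' => hτ N' fun σ x hx => by
    by_cases h : P.Refines σ
    · rw [hPσ h]
      exact hN' _ _ hx
    · rw [hP0 σ h]
      exact N'.zero_mem
  let E := P.relabelBlock V
  -- The labels of `P.relabel V` equal the `V (E B)` only propositionally. Abstracting them to `ℓ`
  -- allows substitution before the tensor factors are reindexed.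
  have key : ∀ ℓ : (P.relabel V).Block → Irr k G, (∀ B, ℓ B = V (E B)) →
      ∃ e' : (⨂[k] B, (ℓ B).Carrier) ≃ₗ[k] N, ∀ (γ : P.Block → G) x,
        e' (PiTensorProduct.map (fun B => (ℓ B).rho (γ (E B))) x) = τ' γ (e' x) := by
    intro ℓ hℓ
    obtain rfl : ℓ = fun B => V (E B) := funext hℓ
    let R : (⨂[k] B, (V B).Carrier) ≃ₗ[k] ⨂[k] B, (V (E B)).Carrier :=
      PiTensorProduct.reindex k (fun B => (V B).Carrier) E.symm
    have hR : ∀ (γ : P.Block → G) x, R (PiTensorProduct.map (fun B => (V B).rho (γ B)) x) =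
        PiTensorProduct.map (fun B => (V (E B)).rho (γ (E B))) (R x) := by
      intro γ x
      have : R.toLinearMap ∘ₗ PiTensorProduct.map (fun B => (V B).rho (γ B)) =
          PiTensorProduct.map (fun B => (V (E B)).rho (γ (E B))) ∘ₗ R.toLinearMap := by
        ext v
        simp only [LinearMap.compMultilinearMap_apply, LinearMap.comp_apply,
          PiTensorProduct.map_tprod, LinearEquiv.coe_coe]
        have h1 : ∀ w : ∀ B, (V B).Carrier, R (PiTensorProduct.tprod k w) =
            PiTensorProduct.tprod k fun B => w (E B) := fun w =>
          PiTensorProduct.reindex_tprod (R := k) (s := fun B => (V B).Carrier) E.symm w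
        rw [h1, h1, PiTensorProduct.map_tprod]
      exact LinearMap.congr_fun this x
    refine ⟨R.symm.trans e, fun γ x => ?_⟩
    obtain ⟨y, rfl⟩ := R.surjective x
    simp only [LinearEquiv.trans_apply]
    rw [← hR, R.symm_apply_apply, R.symm_apply_apply, he]
  obtain ⟨e', he'⟩ := key (P.relabel V).label (P.label_relabel V)
  refine ⟨P.relabel V, e', fun σ x => ?_⟩
  by_cases h : P.Refines σ
  · have h' : (P.relabel V).Refines σ := (P.refines_relabel V).2 h
    rw [rho_of_refines _ h', hPσ h]
    simp only [P.value_relabel V h' h]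
    exact he' _ _
  · rw [rho_of_not_refines _ ((P.refines_relabel V).not.2 h), hP0 σ h]
    simp

end LabelledSetPartition

/-! ### Modules over monoid algebras and cocycles -/

section Cocycles

variable {k : Type u} [Field k] {M : Type v} [Monoid M]

theorem MonoidAlgebra.map_smul_of_single {X Y : Type*} [AddCommGroup X] [Module k X]
    [Module (MonoidAlgebra k M) X] [IsScalarTower k (MonoidAlgebra k M) X] [AddCommGroup Y]
    [Module k Y] [Module (MonoidAlgebra k M) Y] [IsScalarTower k (MonoidAlgebra k M) Y]
    (f : X →ₗ[k] Y) (h : ∀ (m : M) x, f (single m (1 : k) • x) = single m (1 : k) • f x)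
    (a : MonoidAlgebra k M) (x : X) : f (a • x) = a • f x := by
  induction a using MonoidAlgebra.induction_linear with
  | zero => simp
  | add a b ha hb => rw [add_smul, add_smul, map_add, ha, hb]
  | single m c =>
    have e : single m c = c • single m (1 : k) := by simp
    rw [e, smul_assoc, smul_assoc, map_smul, h]

/-- A `k`-linear isomorphism which commutes with the monoid is linear over the monoid algebra. -/
def MonoidAlgebra.equivOfSingle {X Y : Type*} [AddCommGroup X] [Module k X]
    [Module (MonoidAlgebra k M) X] [IsScalarTower k (MonoidAlgebra k M) X] [AddCommGroup Y]
    [Module k Y] [Module (MonoidAlgebra k M) Y] [IsScalarTower k (MonoidAlgebra k M) Y]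
    (f : X ≃ₗ[k] Y) (h : ∀ (m : M) x, f (single m (1 : k) • x) = single m (1 : k) • f x) :
    X ≃ₗ[MonoidAlgebra k M] Y :=
  { f.toAddEquiv with map_smul' := MonoidAlgebra.map_smul_of_single f.toLinearMap h }

variable {V W : Type max u v} [AddCommGroup V] [Module k V] [AddCommGroup W] [Module k W]
  (ρ : Representation k M V) (τ : Representation k M W)

/-- Derivations of a monoid with values in `Hom_k(V, W)`. -/
def cocycles : Submodule k (M → V →ₗ[k] W) where
  carrier := {f | ∀ m m' x, f (m * m') x = τ m (f m' x) + f m (ρ m' x)}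
  add_mem' := by
    intro f g hf hg m m' x
    simp only [Pi.add_apply, LinearMap.add_apply, hf m m' x, hg m m' x, map_add]
    abel
  zero_mem' := by simp
  smul_mem' := by
    intro c f hf m m' x
    simp [hf m m' x]

variable {ρ τ}

theorem cocycles_mul (f : cocycles ρ τ) (m m' : M) (x : V) :
    f.1 (m * m') x = τ m (f.1 m' x) + f.1 m (ρ m' x) := f.2 m m' x

variable (ρ τ)

/-- The restriction of a derivation of the monoid algebra to the monoid. -/
noncomputable def derivationToCocycle :
    homDerivations k (MonoidAlgebra k M) ρ.asModule τ.asModule →ₗ[k] cocycles ρ τ where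
  toFun D := ⟨fun m => D.1 (MonoidAlgebra.single m 1), fun m m' x => by
    let x' : ρ.asModule := x
    have := D.2 (MonoidAlgebra.single m 1) (MonoidAlgebra.single m' 1) x'
    rw [MonoidAlgebra.single_mul_single, one_mul, Representation.single_smul,
      Representation.single_smul, one_smul, one_smul] at this
    exact this⟩
  map_add' _ _ := rfl
  map_smul' _ _ := rfl

/-- The monoid is a basis of its algebra, and the Leibniz rule, bilinear in the two algebra
elements, need only hold on this basis. -/
theorem derivationToCocycle_surjective : Function.Surjective (derivationToCocycle ρ τ) := by
  intro f
  let D : MonoidAlgebra k M →ₗ[k] ρ.asModule →ₗ[k] τ.asModule :=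
    Finsupp.linearCombination k f.1 ∘ₗ (MonoidAlgebra.coeffLinearEquiv k).toLinearMap
  have hD : ∀ m c, D (MonoidAlgebra.single m c) = c • f.1 m := fun m c =>
    Finsupp.linearCombination_single k c m
  refine ⟨⟨D, fun a b x => ?_⟩, ?_⟩
  · induction a using MonoidAlgebra.induction_linear with
    | zero => simp
    | add a a' ha ha' =>
      rw [add_mul, map_add, LinearMap.add_apply, ha, ha', add_smul, map_add, LinearMap.add_apply]
      abel
    | single m c =>
      induction b using MonoidAlgebra.induction_linear with
      | zero => simp
      | add b b' hb hb' =>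
        rw [mul_add, map_add, LinearMap.add_apply, hb, hb', add_smul, map_add, map_add,
          LinearMap.add_apply, smul_add]
        abel
      | single m' c' =>
        rw [MonoidAlgebra.single_mul_single, hD, hD, hD, Representation.single_smul,
          Representation.single_smul]
        have h := f.2 m m' x
        refine (congrArg ((c * c') • ·) h).trans ?_
        change (c * c') • (τ m (f.1 m' x) + f.1 m (ρ m' x)) =
          c • τ m (c' • f.1 m' x) + c • f.1 m (c' • ρ m' x)
        rw [map_smul, map_smul, smul_add, mul_smul, mul_smul]
  · ext m : 2
    exact (hD m 1).trans (one_smul _ _)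

theorem derivationToCocycle_injective : Function.Injective (derivationToCocycle ρ τ) := by
  intro D D' h
  refine Subtype.ext (LinearMap.ext fun a => ?_)
  induction a using MonoidAlgebra.induction_linear with
  | zero => simp
  | add a b ha hb => rw [map_add, map_add, ha, hb]
  | single m c =>
    have h1 : D.1 (MonoidAlgebra.single m 1) = D'.1 (MonoidAlgebra.single m 1) :=
      congrFun (congrArg Subtype.val h) m
    have e : MonoidAlgebra.single m c = c • MonoidAlgebra.single m (1 : k) := by simp
    rw [e, map_smul, map_smul, h1]

theorem mem_range_innerDerivation_iff_cocycle
    (D : homDerivations k (MonoidAlgebra k M) ρ.asModule τ.asModule) :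
    D ∈ LinearMap.range (innerDerivation k (MonoidAlgebra k M) ρ.asModule τ.asModule) ↔
      ∃ h : V →ₗ[k] W, ∀ m x, (derivationToCocycle ρ τ D).1 m x = τ m (h x) - h (ρ m x) := by
  have hinner : ∀ (h : V →ₗ[k] W) m x, (derivationToCocycle ρ τ
      (innerDerivation k (MonoidAlgebra k M) ρ.asModule τ.asModule h)).1 m x =
        τ m (h x) - h (ρ m x) := by
    intro h m x
    let h' : ρ.asModule →ₗ[k] τ.asModule := h
    let x' : ρ.asModule := x
    refine (innerDerivation_apply (A := MonoidAlgebra k M) h' (MonoidAlgebra.single m 1)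
      x').trans ?_
    rw [Representation.single_smul, Representation.single_smul, one_smul, one_smul]
    rfl
  constructor
  · rintro ⟨h, rfl⟩
    exact ⟨h, hinner h⟩
  · rintro ⟨h, hh⟩
    refine ⟨h, derivationToCocycle_injective ρ τ (Subtype.ext (funext fun m => ?_))⟩
    ext x
    rw [hinner, hh]

end Cocycles

section CocyclesArrows

variable {k : Type u} [Field k] {M : Type v} [Monoid M]
  {V W : Type max u v} [AddCommGroup V] [Module k V] [AddCommGroup W] [Module k W]
  {ρ : Representation k M V} {τ : Representation k M W}
  {S T : SimpleClass (MonoidAlgebra k M)}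

/-- The number of arrows is the dimension of the space of derivations of the monoid modulo the
inner ones. -/
theorem gabrielArrows_eq_rank_of_cocycles (e : S.rep ≃ₗ[MonoidAlgebra k M] ρ.asModule)
    (f : T.rep ≃ₗ[MonoidAlgebra k M] τ.asModule) {E : Type max u v} [AddCommGroup E] [Module k E]
    (Θ : cocycles ρ τ →ₗ[k] E) (hΘ : Function.Surjective Θ)
    (hker : ∀ c, Θ c = 0 ↔ ∃ h : V →ₗ[k] W, ∀ m x, c.1 m x = τ m (h x) - h (ρ m x)) :
    gabrielArrows k (MonoidAlgebra k M) S T = Module.rank k E := by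
  refine gabrielArrows_eq_rank e f (Θ ∘ₗ derivationToCocycle ρ τ)
    (hΘ.comp (derivationToCocycle_surjective ρ τ)) ?_
  ext D
  rw [LinearMap.mem_ker, LinearMap.comp_apply, hker, mem_range_innerDerivation_iff_cocycle]

theorem gabrielArrows_eq_zero_of_cocycles (e : S.rep ≃ₗ[MonoidAlgebra k M] ρ.asModule)
    (f : T.rep ≃ₗ[MonoidAlgebra k M] τ.asModule)
    (h : ∀ c : cocycles ρ τ, ∃ h : V →ₗ[k] W, ∀ m x, c.1 m x = τ m (h x) - h (ρ m x)) :
    gabrielArrows k (MonoidAlgebra k M) S T = 0 :=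
  gabrielArrows_eq_zero e f fun D => (mem_range_innerDerivation_iff_cocycle ρ τ D).2 (h _)

end CocyclesArrows

/-! ### The bijection from labelled set partitions to simple modules -/

namespace LabelledSetPartition

variable {k : Type u} [Field k] [IsAlgClosed k] {G : Type v} [Group G] [Finite G] {n : ℕ}
  [NeZero n]

/-- The class of the simple module `S_P`. -/
noncomputable def simple (P : LabelledSetPartition n (Irr k G)) :
    SimpleClass (MonoidAlgebra k (OrderedGPartition n G)) :=
  SimpleClass.mk P.rho.asModule

theorem nonempty_simple_equiv (P : LabelledSetPartition n (Irr k G)) :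
    Nonempty (P.simple.rep ≃ₗ[MonoidAlgebra k (OrderedGPartition n G)] P.rho.asModule) :=
  SimpleClass.nonempty_rep_mk_equiv _

theorem simple_injective :
    Function.Injective (simple : LabelledSetPartition n (Irr k G) → _) := by
  intro P Q h
  obtain ⟨e⟩ := P.nonempty_simple_equiv
  obtain ⟨f⟩ := Q.nonempty_simple_equiv
  rw [← h] at f
  let g : P.rho.asModule ≃ₗ[MonoidAlgebra k (OrderedGPartition n G)] Q.rho.asModule :=
    e.symm.trans f
  refine eq_of_equiv (g.restrictScalars k) fun σ z => ?_
  let z' : P.rho.asModule := z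
  have := g.map_smul (MonoidAlgebra.single σ (1 : k)) z'
  rw [Representation.single_smul, Representation.single_smul, one_smul, one_smul] at this
  exact this

theorem simple_surjective (hG : (Nat.card G : k) ≠ 0) :
    Function.Surjective (simple : LabelledSetPartition n (Irr k G) → _) := by
  intro S
  let A := MonoidAlgebra k (OrderedGPartition n G)
  let : Module k S.rep := Module.compHom S.rep (algebraMap k A)
  have : IsScalarTower k A S.rep := ⟨fun c a x => by
    rw [Algebra.smul_def, mul_smul]
    rfl⟩
  have := IsSimpleModule.nontrivial A S.rep
  let τ : Representation k (OrderedGPartition n G) S.rep :=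
    (Algebra.lsmul k k S.rep : A →ₐ[k] Module.End k S.rep).toMonoidHom.comp
      (MonoidAlgebra.of k (OrderedGPartition n G))
  have hτ : ∀ σ x, τ σ x = MonoidAlgebra.single σ (1 : k) • x := fun σ x => rfl
  obtain ⟨P, e, he⟩ := exists_equiv_of_stable hG τ fun N' hN' hne => by
    have hmem : ∀ (a : A), ∀ x ∈ N', a • x ∈ N' := by
      intro a x hx
      induction a using MonoidAlgebra.induction_linear with
      | zero => rw [zero_smul]; exact N'.zero_mem
      | add a b ha hb => rw [add_smul]; exact N'.add_mem ha hb
      | single m c =>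
        have e : MonoidAlgebra.single m c = c • MonoidAlgebra.single m (1 : k) := by simp
        rw [e, smul_assoc]
        exact N'.smul_mem c (hN' m x hx)
    let L : Submodule A S.rep := { N' with smul_mem' := fun a x hx => hmem a x hx }
    rcases eq_bot_or_eq_top L with h | h
    · refine absurd ?_ hne
      ext x
      exact SetLike.ext_iff.1 h x
    · ext x
      exact SetLike.ext_iff.1 h x
  refine ⟨P, ?_⟩
  obtain ⟨f⟩ := P.nonempty_simple_equiv
  let e' : P.rho.asModule ≃ₗ[k] S.rep := e
  let g : P.rho.asModule ≃ₗ[A] S.rep := MonoidAlgebra.equivOfSingle e' fun σ x => by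
    rw [Representation.single_smul, one_smul]
    exact he σ x
  exact SimpleClass.eq_of_equiv (f.trans g)

/-- The bijection `P ↦ S_P`. -/
noncomputable def simpleEquiv (hG : (Nat.card G : k) ≠ 0) :
    LabelledSetPartition n (Irr k G) ≃ SimpleClass (MonoidAlgebra k (OrderedGPartition n G)) :=
  Equiv.ofBijective simple ⟨simple_injective, simple_surjective hG⟩

end LabelledSetPartition

/-! ### Derivations of the monoid of ordered `G`-partitions -/

namespace OrderedGPartition

variable {n : ℕ} {G : Type v}

theorem ListPrecedes.cases {l : List (Finset (Fin n) × G)} {x y z : Fin n}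
    (h : ListPrecedes l x y) (hz : ∃ p ∈ l, z ∈ p.1) :
    ListPrecedes l x z ∨ ListPrecedes l z y := by
  induction l with
  | nil => exact h.elim
  | cons p l ih =>
    obtain ⟨q, hq, hzq⟩ := hz
    rcases List.mem_cons.1 hq with rfl | hq
    · rcases h with ⟨_, h⟩ | h
      · exact Or.inr (Or.inl ⟨hzq, h⟩)
      · exact Or.inr (Or.inl ⟨hzq, h.mem_right⟩)
    · rcases h with ⟨hx, _⟩ | h
      · exact Or.inl (Or.inl ⟨hx, q, hq, hzq⟩)
      · exact (ih h ⟨q, hq, hzq⟩).imp Or.inr Or.inr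

theorem Precedes.cases {σ : OrderedGPartition n G} {x y : Fin n} (h : σ.Precedes x y)
    (z : Fin n) : σ.Precedes x z ∨ σ.Precedes z y :=
  ListPrecedes.cases h (σ.cover z)

theorem Precedes.congr_right {σ : OrderedGPartition n G} {x y z : Fin n} (h : σ.Precedes x y)
    (h' : σ.Same y z) : σ.Precedes x z :=
  (h.cases z).resolve_right fun h1 => h1.not_same h'.symm

end OrderedGPartition

namespace LabelledSetPartition

variable {k : Type u} [Field k] {G : Type v} [Group G] {n : ℕ} [NeZero n]
  {P Q : LabelledSetPartition n (Irr k G)} (c : cocycles P.rho Q.rho)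
  {σ τ : OrderedGPartition n G}

/-- When `σ` acts as zero on $S_Q$, the term $\sigma c(\tau)$ of the Leibniz rule drops out. -/
theorem cocycle_mul_of_not_refines (hσ : ¬ Q.Refines σ) (x : P.Carrier) :
    c.1 (σ * τ) x = c.1 σ (P.rho τ x) := by
  rw [cocycles_mul, Q.rho_of_not_refines hσ, LinearMap.zero_apply, zero_add]

theorem cocycle_mul_of_lab_eq_one (hσ : ¬ Q.Refines σ) (hτ : P.Refines τ)
    (h : ∀ x, τ.lab x = 1) : c.1 (σ * τ) = c.1 σ := by
  ext1
  refine MultilinearMap.ext fun x => ?_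
  rw [LinearMap.compMultilinearMap_apply, cocycle_mul_of_not_refines c hσ,
    P.rho_of_lab_eq_one hτ h]
  rfl

theorem cocycle_eq_zero (hP : ¬ P.Refines σ) (hQ : ¬ Q.Refines σ) (x : P.Carrier) :
    c.1 σ x = 0 := by
  rw [← σ.mul_unlabel, cocycle_mul_of_not_refines c hQ,
    P.rho_of_not_refines (refines_unlabel.not.2 hP), LinearMap.zero_apply, map_zero]

/-- A derivation is inner if the set partition of `P` does not refine the one of `Q`. -/
theorem cocycle_inner_of_not_le {x y : Fin n} (hP : P.Same x y) (hQ : ¬ Q.Same x y) :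
    ∃ h : P.Carrier →ₗ[k] Q.Carrier, ∀ σ z, c.1 σ z = Q.rho σ (h z) - h (P.rho σ z) := by
  let e : OrderedGPartition n G := Q.ordered 1
  have he : ∀ x, e.lab x = 1 := fun x => Q.lab_ordered 1 x
  have heQ : Q.rho e = 1 := Q.rho_of_lab_eq_one (Q.refines_ordered 1) he
  have heP : P.rho e = 0 := P.rho_of_not_refines fun h =>
    hQ ((Q.same_ordered 1).1 (refines_iff.1 h x y hP))
  refine ⟨c.1 e, fun σ z => ?_⟩
  -- Apply `c` to $e\sigma e=e\sigma$. As `e` is $0$ on $S_P$ and $1$ on $S_Q$, this gives $\sigma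
  -- c(e)=c(e\sigma)=c(\sigma)+c(e)\sigma$, so $c(e)$ witnesses that `c` is inner.
  have h1 := cocycles_mul c (e * σ) e z
  rw [OrderedGPartition.mul_mul_of_lab_eq_one σ he, heP, map_mul, heQ, one_mul,
    LinearMap.zero_apply, map_zero, add_zero, cocycles_mul, heQ, Module.End.one_apply] at h1
  rw [← h1, add_sub_cancel_right]

/-- A derivation is inner if `P` and `Q` have the same underlying set partition. -/
theorem cocycle_inner_of_same [Finite G] (hG : (Nat.card G : k) ≠ 0)
    (hPQ : ∀ x y, P.Same x y ↔ Q.Same x y) :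
    ∃ h : P.Carrier →ₗ[k] Q.Carrier, ∀ σ z, c.1 σ z = Q.rho σ (h z) - h (P.rho σ z) := by
  classical
  have := Fintype.ofFinite P.Block
  have := Fintype.ofFinite G
  have := Fintype.ofFinite (P.Block → G)
  let o : (P.Block → G) → OrderedGPartition n G := P.ordered
  have ho : ∀ γ δ, o γ * o δ = o (γ * δ) := P.ordered_mul_ordered
  have hrefines : ∀ σ : OrderedGPartition n G, P.Refines σ ↔ Q.Refines σ := fun σ => by
    simp only [refines_iff, hPQ]
  have hP1 : P.rho (o 1) = 1 := P.rho_of_lab_eq_one (P.refines_ordered 1) (P.lab_ordered 1)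
  have hQ1 : Q.rho (o 1) = 1 :=
    Q.rho_of_lab_eq_one ((hrefines _).1 (P.refines_ordered 1)) (P.lab_ordered 1)
  -- The averaging behind $H^1=0$ for the group $G^{\text{blocks}}$: minus this sum, divided by the
  -- order of the group, exhibits `c` as inner on the group.
  let s : P.Carrier →ₗ[k] Q.Carrier := ∑ δ, c.1 (o δ) ∘ₗ P.rho (o δ⁻¹)
  have hs : ∀ γ z, s (P.rho (o γ) z) =
      Q.rho (o γ) (s z) + (Fintype.card (P.Block → G) : k) • c.1 (o γ) z := by
    intro γ z
    have h1 : s (P.rho (o γ) z) =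
        ∑ δ, c.1 (o (γ * δ)) (P.rho (o (γ * δ)⁻¹) (P.rho (o γ) z)) := by
      simp only [s, LinearMap.sum_apply, LinearMap.comp_apply]
      exact (Equiv.sum_comp (Equiv.mulLeft γ) fun δ =>
        c.1 (o δ) (P.rho (o δ⁻¹) (P.rho (o γ) z))).symm
    rw [h1]
    simp only [s, LinearMap.sum_apply, LinearMap.comp_apply, map_sum]
    rw [Nat.cast_smul_eq_nsmul, ← Finset.card_univ, ← Finset.sum_const, ← Finset.sum_add_distrib]
    refine Finset.sum_congr rfl fun δ _ => ?_
    have h2 : P.rho (o (γ * δ)⁻¹) (P.rho (o γ) z) = P.rho (o δ⁻¹) z := by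
      rw [← Module.End.mul_apply, ← map_mul, ho]
      congr 3
      group
    have h3 : P.rho (o δ) (P.rho (o δ⁻¹) z) = z := by
      rw [← Module.End.mul_apply, ← map_mul, ho, mul_inv_cancel, hP1, Module.End.one_apply]
    rw [h2, ← ho, cocycles_mul, h3]
  have hcard : (Fintype.card (P.Block → G) : k) ≠ 0 := by
    rw [← Nat.card_eq_fintype_card, Nat.card_fun, Nat.cast_pow]
    exact pow_ne_zero _ hG
  refine ⟨-((Fintype.card (P.Block → G) : k)⁻¹ • s), fun σ z => ?_⟩
  by_cases h : P.Refines σ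
  · have key : ∀ γ z, c.1 (o γ) z =
        Q.rho (o γ) ((-((Fintype.card (P.Block → G) : k)⁻¹ • s)) z) -
          (-((Fintype.card (P.Block → G) : k)⁻¹ • s)) (P.rho (o γ) z) := by
      intro γ z
      simp only [LinearMap.neg_apply, LinearMap.smul_apply, hs, map_neg, map_smul, smul_add,
        smul_smul, inv_mul_cancel₀ hcard, one_smul]
      abel
    have hσ : o 1 * σ = o h.value := h.ordered_one_mul
    -- The idempotent `o 1` acts as the identity on both modules, so $c(o1)=2c(o1)$. Hence
    -- $c(\sigma)=c(o1\cdot\sigma)$, which is a value on the group.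
    have h0 : ∀ z, c.1 (o 1) z = 0 := fun z => by
      have := cocycles_mul c (o 1) (o 1) z
      rw [ho, one_mul, hQ1, hP1, Module.End.one_apply, Module.End.one_apply] at this
      exact left_eq_add.1 this
    have hc : c.1 (o h.value) z = c.1 σ z := by
      rw [← hσ, cocycles_mul, h0, add_zero, hQ1, Module.End.one_apply]
    have hP : P.rho (o h.value) = P.rho σ := by rw [← hσ, map_mul, hP1, one_mul]
    have hQ : Q.rho (o h.value) = Q.rho σ := by rw [← hσ, map_mul, hQ1, one_mul]
    rw [← hc, key, hP, hQ]
  · rw [cocycle_eq_zero c h ((hrefines σ).not.1 h), P.rho_of_not_refines h,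
      Q.rho_of_not_refines ((hrefines σ).not.1 h)]
    simp

/-! ### Critical pairs and the values that determine a derivation -/

variable (P Q) in
/-- `x` and `y` lie in the same block of `Q`, but in different blocks of `P`. -/
def Critical (x y : Fin n) : Prop := Q.Same x y ∧ ¬ P.Same x y

theorem Critical.symm {x y : Fin n} (h : Critical P Q x y) : Critical P Q y x :=
  ⟨h.1.symm, fun h' => h.2 h'.symm⟩

theorem Critical.not_refines_front {x y : Fin n} (h : Critical P Q x y) (g : G) :
    ¬ Q.Refines (P.front x g) := fun h' =>
  (P.precedes_front.2 ⟨Same.refl P x, h.2⟩).not_same (refines_iff.1 h' x y h.1)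

theorem front_congr {x y : Fin n} (h : P.Same x y) (g : G) : P.front x g = P.front y g := by
  have key : ∀ z, P.Same x z ↔ P.Same y z := fun z =>
    ⟨fun h' => h.symm.trans h', fun h' => h.trans h'⟩
  refine OrderedGPartition.ext_precedes (fun z w => ?_) fun z => ?_
  · rw [precedes_front, precedes_front, key, key]
  · by_cases hz : P.Same x z
    · rw [lab_front_of_same _ _ hz, lab_front_of_same _ _ ((key z).1 hz)]
    · rw [lab_front_of_not_same _ _ hz, lab_front_of_not_same _ _ fun h' => hz ((key z).2 h')]

/-- On unlabelled ordered partitions in which `x` precedes `y`, where `(x, y)` is a critical pair,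
a derivation has the same value as on the ordered partition into the block of `x` and the rest. -/
theorem cocycle_eq_front {x y : Fin n} (h : Critical P Q x y) (hσ : P.Refines σ)
    (hσ' : ∀ x, σ.lab x = 1) (hxy : σ.Precedes x y) : c.1 σ = c.1 (P.front x 1) := by
  classical
  -- The two-step coarsening of `σ` cut just after the block of `x`. It still separates `x` from
  -- `y`, so `Q` does not refine it; it is absorbed by `σ` and commutes with `P.front x 1`.
  let s : OrderedGPartition n G := .ofFun (fun z => if σ.Precedes x z then 1 else 0) 1
  have hs : ∀ {z w}, s.Precedes z w ↔ ¬ σ.Precedes x z ∧ σ.Precedes x w := by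
    intro z w
    simp only [s, OrderedGPartition.precedes_ofFun]
    split_ifs <;> simp [*]
  have hs' : ∀ z, s.lab z = 1 := fun z => by simp [s]
  have hsP : P.Refines s := refines_iff.2 fun z w hzw => by
    have h1 := refines_iff.1 hσ z w hzw
    rw [OrderedGPartition.same_iff, hs, hs]
    exact ⟨fun h => h.1 (h.2.congr_right h1.symm), fun h => h.1 (h.2.congr_right h1)⟩
  have hxx : ¬ σ.Precedes x x := fun h => h.not_same (OrderedGPartition.Same.refl _ _)
  have hsQ : ¬ Q.Refines s := fun h' =>
    (hs.2 ⟨hxx, hxy⟩).not_same (refines_iff.1 h' x y h.1)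
  have h1 : s * σ = σ := by
    refine OrderedGPartition.ext_precedes (fun z w => ?_) fun z => ?_
    · rw [OrderedGPartition.precedes_mul, OrderedGPartition.same_iff, hs, hs]
      constructor
      · rintro (⟨hz, hw⟩ | ⟨-, h⟩)
        · exact (hw.cases z).resolve_left hz
        · exact h
      · intro h
        have : ¬ (¬ σ.Precedes x w ∧ σ.Precedes x z) := fun h' =>
          (h'.2.cases w).elim h'.1 h.asymm
        tauto
    · rw [OrderedGPartition.lab_mul, hs', one_mul]
  have h2 : s * P.front x 1 = P.front x 1 * s := by
    have hP : ∀ {z}, P.Same x z → ¬ σ.Precedes x z := fun hz h' =>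
      h'.not_same (refines_iff.1 hσ _ _ hz)
    refine OrderedGPartition.ext_precedes (fun z w => ?_) fun z => ?_
    · rw [OrderedGPartition.precedes_mul, OrderedGPartition.precedes_mul,
        OrderedGPartition.same_iff, hs, hs, precedes_front, same_front]
      have := @hP z
      have := @hP w
      tauto
    · rw [OrderedGPartition.lab_mul, OrderedGPartition.lab_mul, hs', lab_front_one]
  -- With $f$ the front element, $c(\sigma)=c(s\sigma)=c(s)=c(sf)=c(fs)=c(f)$: a right factor that
  -- is unlabelled and refined by `P` can be dropped whenever the left factor acts as zero on $S_Q$.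
  rw [← h1, cocycle_mul_of_lab_eq_one c hsQ hσ hσ',
    ← cocycle_mul_of_lab_eq_one c hsQ (P.refines_front x 1) (P.lab_front_one x), h2,
    cocycle_mul_of_lab_eq_one c (h.not_refines_front 1) hsP hs']

/-- Labels are put back through $\sigma=\bar\sigma\sigma$, where $\bar\sigma$ acts as zero on $S_Q$.
-/
theorem cocycle_of_precedes {x y : Fin n} (h : Critical P Q x y) (hσ : P.Refines σ)
    (hxy : σ.Precedes x y) (z : P.Carrier) : c.1 σ z = c.1 (P.front x 1) (P.rho σ z) := by
  have hQ : ¬ Q.Refines σ.unlabel := fun h' =>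
    hxy.not_same (refines_iff.1 (refines_unlabel.1 h') x y h.1)
  rw [← cocycle_eq_front c h (refines_unlabel.2 hσ) σ.lab_unlabel (σ.precedes_unlabel.2 hxy),
    ← cocycle_mul_of_not_refines c hQ, σ.unlabel_mul]

/-- In $\sigma f$, with $f$ the front element at `x`, the tie between `x` and `y` is broken in
favour of `x`. So $c(\sigma f)$ is known from `cocycle_of_precedes`, and it equals $\sigma
c(f)+c(\sigma)$ because $f$ acts as the identity on $S_P$. -/
theorem cocycle_of_refines (hle : ∀ x y, P.Same x y → Q.Same x y) {x y : Fin n}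
    (h : Critical P Q x y) (hσ : Q.Refines σ) (z : P.Carrier) :
    c.1 σ z = c.1 (P.front x 1) (P.rho σ z) - Q.rho σ (c.1 (P.front x 1) z) := by
  have hσP : P.Refines σ := refines_iff.2 fun x y h => refines_iff.1 hσ x y (hle x y h)
  have hf : P.Refines (P.front x (1 : G)) := P.refines_front x 1
  have h1 := cocycle_of_precedes c h (σ := σ * P.front x 1) (refines_mul.2 ⟨hσP, hf⟩)
    ((OrderedGPartition.precedes_mul _ _).2 (Or.inr ⟨refines_iff.1 hσ x y h.1,
      P.precedes_front.2 ⟨Same.refl P x, h.2⟩⟩)) z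
  rw [cocycles_mul, map_mul, rho_front_one, mul_one, Module.End.one_apply] at h1
  rw [← h1, add_sub_cancel_left]

/-- If the values of a derivation on all the ordered partitions into a block and the rest agree,
then the derivation is inner. -/
theorem cocycle_inner_of_front (hle : ∀ x y, P.Same x y → Q.Same x y)
    {x₀ y₀ : Fin n} (h₀ : Critical P Q x₀ y₀)
    (hc : ∀ x y, Critical P Q x y → c.1 (P.front x 1) = c.1 (P.front x₀ 1)) :
    ∃ h : P.Carrier →ₗ[k] Q.Carrier, ∀ σ z, c.1 σ z = Q.rho σ (h z) - h (P.rho σ z) := by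
  refine ⟨-c.1 (P.front x₀ 1), fun σ z => ?_⟩
  rw [LinearMap.neg_apply, LinearMap.neg_apply, map_neg, sub_neg_eq_add, neg_add_eq_sub]
  by_cases hQ : Q.Refines σ
  · exact cocycle_of_refines c hle h₀ hQ z
  rw [Q.rho_of_not_refines hQ, LinearMap.zero_apply, sub_zero]
  by_cases hP : P.Refines σ
  -- If `P` refines `σ` but `Q` does not, then `σ` separates some critical pair, and swapping its
  -- entries if necessary makes `σ` order it.
  · obtain ⟨x, y, h, hxy⟩ : ∃ x y, Critical P Q x y ∧ σ.Precedes x y := by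
      rw [refines_iff] at hQ
      push Not at hQ
      obtain ⟨x, y, h, hxy⟩ := hQ
      have hcrit : Critical P Q x y := ⟨h, fun h' => hxy (refines_iff.1 hP x y h')⟩
      rcases σ.precedes_cases x y with h1 | h1 | h1
      · exact ⟨x, y, hcrit, h1⟩
      · exact absurd h1 hxy
      · exact ⟨y, x, hcrit.symm, h1⟩
    rw [cocycle_of_precedes c h hP hxy, hc x y h]
  · rw [cocycle_eq_zero c hP hQ, P.rho_of_not_refines hP, LinearMap.zero_apply, map_zero]

/-- Block of `x`, then block of `x'`, then the rest: this one ordered partition puts `x` before `y`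
and `x'` before `y'`, so both front values equal its value. -/
theorem cocycle_front_eq_of_not_same {x y x' y' : Fin n} (h : Critical P Q x y)
    (h' : Critical P Q x' y') (hne : ¬ P.Same x y') :
    c.1 (P.front x 1) = c.1 (P.front x' 1) := by
  classical
  let s : OrderedGPartition n G :=
    .ofFun (fun z => if P.Same x z then 0 else if P.Same x' z then 1 else 2) 1
  have hs : P.Refines s := refines_iff.2 fun z w hzw => by
    have h1 : P.Same x z ↔ P.Same x w := ⟨fun h => h.trans hzw, fun h => h.trans hzw.symm⟩
    have h2 : P.Same x' z ↔ P.Same x' w := ⟨fun h => h.trans hzw, fun h => h.trans hzw.symm⟩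
    simp [s, h1, h2]
  have hs' : ∀ z, s.lab z = 1 := fun z => by simp [s]
  rw [← cocycle_eq_front c h hs hs', ← cocycle_eq_front c h' hs hs']
  · simp only [s, OrderedGPartition.precedes_ofFun, if_neg hne, if_neg h'.2,
      if_pos (Same.refl P x')]
    split_ifs <;> omega
  · simp only [s, OrderedGPartition.precedes_ofFun, if_neg h.2, if_pos (Same.refl P x)]
    split_ifs <;> omega

/-- A derivation is inner if there are critical pairs which belong to different pairs of blocks. -/
theorem cocycle_inner_of_critical (hle : ∀ x y, P.Same x y → Q.Same x y)
    {x₀ y₀ x₁ y₁ : Fin n} (h₀ : Critical P Q x₀ y₀) (h₁ : Critical P Q x₁ y₁)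
    (hne : ¬ (P.Same x₀ x₁ ∧ P.Same y₀ y₁)) (hne' : ¬ (P.Same x₀ y₁ ∧ P.Same y₀ x₁)) :
    ∃ h : P.Carrier →ₗ[k] Q.Carrier, ∀ σ z, c.1 σ z = Q.rho σ (h z) - h (P.rho σ z) := by
  -- Two critical pairs can be ordered compatibly, starting from one first entry or the other,
  -- unless each is the reverse of the other up to blocks.
  have key : ∀ {x y x' y'}, Critical P Q x y → Critical P Q x' y' →
      ¬ (P.Same x y' ∧ P.Same y x') → c.1 (P.front x 1) = c.1 (P.front x' 1) := by
    intro x y x' y' h h' hne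
    by_cases h1 : P.Same x y'
    · exact (cocycle_front_eq_of_not_same c h' h fun h2 => hne ⟨h1, h2.symm⟩).symm
    · exact cocycle_front_eq_of_not_same c h h' h1
  refine cocycle_inner_of_front c hle h₀ fun x y h => ?_
  -- A pair that reverses $(x_0,y_0)$ is compared by way of $(x_1,y_1)$, which matches $(x_0,y_0)$
  -- in neither direction.
  by_cases h2 : P.Same x y₀ ∧ P.Same y x₀
  · rw [key h₀ h₁ hne', key h h₁ fun h3 => hne ⟨h2.2.symm.trans h3.2, h2.1.symm.trans h3.1⟩]
  · exact key h h₀ h2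

end LabelledSetPartition

/-! ### Arrows for a single critical pair of blocks -/

/-- The value of a derivation at an element of the monoid. -/
def evalCocycle {k : Type u} [Field k] {M : Type v} [Monoid M] {V W : Type max u v}
    [AddCommGroup V] [Module k V] [AddCommGroup W] [Module k W] (ρ : Representation k M V)
    (τ : Representation k M W) (m : M) : cocycles ρ τ →ₗ[k] V →ₗ[k] W where
  toFun c := c.1 m
  map_add' _ _ := rfl
  map_smul' _ _ := rfl

namespace LabelledSetPartition

variable {k : Type u} [Field k] {G : Type v} [Group G] {n : ℕ} [NeZero n]
  (P Q : LabelledSetPartition n (Irr k G))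

/-- The linear maps from `S_P` to `S_Q` which commute with all elements above `Q`. -/
def equivariantMaps : Submodule k (P.Carrier →ₗ[k] Q.Carrier) where
  carrier := {d | ∀ σ : OrderedGPartition n G, Q.Refines σ →
    ∀ z, d (P.rho σ z) = Q.rho σ (d z)}
  add_mem' := by
    intro d d' hd hd' σ hσ z
    rw [LinearMap.add_apply, LinearMap.add_apply, hd σ hσ, hd' σ hσ, map_add]
  zero_mem' := by simp
  smul_mem' := by
    intro c d hd σ hσ z
    rw [LinearMap.smul_apply, LinearMap.smul_apply, hd σ hσ, map_smul]

variable {P Q}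

open scoped Classical in
/-- The derivation of the monoid which a map between `S_P` and `S_Q` defines, when the blocks of
`x₀` and `y₀` are the only blocks of `P` which are joined in `Q`. -/
noncomputable def cocycleOfMap {x₀ y₀ : Fin n} (h₀ : Critical P Q x₀ y₀)
    (huniq : ∀ x y, Critical P Q x y →
      (P.Same x₀ x ∧ P.Same y₀ y) ∨ (P.Same x₀ y ∧ P.Same y₀ x))
    (hle : ∀ x y, P.Same x y → Q.Same x y) (d : equivariantMaps P Q) :
    cocycles P.rho Q.rho :=
  ⟨fun σ => if P.Refines σ ∧ σ.Precedes x₀ y₀ then d.1 ∘ₗ P.rho σ else 0, fun σ τ z => by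
    dsimp only
    have hQP : ∀ {σ : OrderedGPartition n G}, Q.Refines σ → P.Refines σ := fun hσ =>
      refines_iff.2 fun x y h => refines_iff.1 hσ x y (hle x y h)
    by_cases hσ : P.Refines σ
    swap
    · simp [refines_mul, hσ, Q.rho_of_not_refines fun h => hσ (hQP h)]
    by_cases hτ : P.Refines τ
    swap
    · simp [refines_mul, hτ, P.rho_of_not_refines hτ]
    have hsep : ∀ {σ : OrderedGPartition n G}, ¬ σ.Same x₀ y₀ → Q.rho σ = 0 := fun h =>
      Q.rho_of_not_refines fun h' => h (refines_iff.1 h' _ _ h₀.1)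
    have hmul : P.Refines (σ * τ) := refines_mul.2 ⟨hσ, hτ⟩
    simp only [hσ, hτ, hmul, true_and, OrderedGPartition.precedes_mul]
    -- If `σ` separates $x_0$ from $y_0$, it acts as zero on $S_Q$ and alone decides their order in
    -- the product. If not, uniqueness of the joined blocks makes `Q` refine `σ`, so `d` commutes
    -- with `σ`, and `τ` decides.
    rcases σ.precedes_cases x₀ y₀ with h | h | h
    · rw [if_pos (Or.inl h), if_pos h, hsep h.not_same, map_mul]
      simp
    · have h' : ¬ σ.Precedes x₀ y₀ := fun h' => h'.not_same h
      have hQ : Q.Refines σ := refines_iff.2 fun x y hxy => by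
        by_cases hP : P.Same x y
        · exact refines_iff.1 hσ _ _ hP
        · rcases huniq x y ⟨hxy, hP⟩ with h1 | h1
          · exact ((refines_iff.1 hσ _ _ h1.1).symm.trans h).trans (refines_iff.1 hσ _ _ h1.2)
          · exact ((refines_iff.1 hσ _ _ h1.2).symm.trans h.symm).trans
              (refines_iff.1 hσ _ _ h1.1)
      simp only [h, h', true_and, false_or, if_false, LinearMap.zero_apply, add_zero]
      split_ifs
      · rw [LinearMap.comp_apply, LinearMap.comp_apply, map_mul, Module.End.mul_apply,
          d.2 σ hQ]
      · simp
    · have h' : ¬ σ.Same x₀ y₀ := fun h' => h.not_same h'.symm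
      rw [if_neg (fun h1 => h1.elim (fun h2 => h2.asymm h) fun h2 => h' h2.1),
        if_neg h.asymm, hsep h']
      simp⟩

/-- Up to blocks only $(x_0,y_0)$ and its reverse are critical, so the difference of the two front
values is the whole obstruction to being inner. -/
theorem gabrielArrows_eq_rank_equivariantMaps {x₀ y₀ : Fin n} (h₀ : Critical P Q x₀ y₀)
    (huniq : ∀ x y, Critical P Q x y →
      (P.Same x₀ x ∧ P.Same y₀ y) ∨ (P.Same x₀ y ∧ P.Same y₀ x))
    (hle : ∀ x y, P.Same x y → Q.Same x y)
    {S T : SimpleClass (MonoidAlgebra k (OrderedGPartition n G))}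
    (e : S.rep ≃ₗ[MonoidAlgebra k (OrderedGPartition n G)] P.rho.asModule)
    (f : T.rep ≃ₗ[MonoidAlgebra k (OrderedGPartition n G)] Q.rho.asModule) :
    gabrielArrows k (MonoidAlgebra k (OrderedGPartition n G)) S T =
      Module.rank k (equivariantMaps P Q) := by
  -- For `σ` refined by `Q`, the value $c(\sigma)$ is computed from the front at $x_0$ and also from
  -- the front at $y_0$; subtracting the two formulas gives equivariance of the difference.
  have hmem : ∀ c : cocycles P.rho Q.rho,
      c.1 (P.front x₀ 1) - c.1 (P.front y₀ 1) ∈ equivariantMaps P Q := by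
    intro c σ hσ z
    have h1 := cocycle_of_refines c hle h₀ hσ z
    rw [cocycle_of_refines c hle h₀.symm hσ z] at h1
    rw [LinearMap.sub_apply, LinearMap.sub_apply, map_sub]
    rw [sub_eq_sub_iff_add_eq_add] at h1 ⊢
    exact h1.symm.trans (add_comm _ _)
  let Θ : cocycles P.rho Q.rho →ₗ[k] equivariantMaps P Q :=
    (evalCocycle P.rho Q.rho (P.front x₀ 1) - evalCocycle P.rho Q.rho (P.front y₀ 1)).codRestrict _
      fun c => by
        rw [LinearMap.sub_apply]
        exact hmem c
  have hΘ : ∀ c, (Θ c).1 = c.1 (P.front x₀ 1) - c.1 (P.front y₀ 1) := fun c =>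
    LinearMap.sub_apply (evalCocycle P.rho Q.rho (P.front x₀ 1)) _ c
  refine gabrielArrows_eq_rank_of_cocycles e f (E := equivariantMaps P Q) Θ (fun d => ?_)
    fun c => ⟨fun h => ?_, ?_⟩
  · refine ⟨cocycleOfMap h₀ huniq hle d, Subtype.ext ?_⟩
    rw [hΘ]
    have h1 : P.Refines (P.front x₀ (1 : G)) ∧ (P.front x₀ (1 : G)).Precedes x₀ y₀ :=
      ⟨P.refines_front _ _, P.precedes_front.2 ⟨Same.refl P _, h₀.2⟩⟩
    have h2 : ¬ (P.Refines (P.front y₀ (1 : G)) ∧ (P.front y₀ (1 : G)).Precedes x₀ y₀) :=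
      fun h => (P.precedes_front.1 h.2).2 (Same.refl P _)
    simp only [cocycleOfMap, if_pos h1, if_neg h2, sub_zero, rho_front_one]
    rfl
  · refine cocycle_inner_of_front c hle h₀ fun x y hxy => ?_
    have h' : c.1 (P.front x₀ 1) = c.1 (P.front y₀ 1) := by
      rw [← sub_eq_zero, ← hΘ, h]
      rfl
    rcases huniq x y hxy with h1 | h1
    · rw [front_congr h1.1]
    · rw [h', front_congr h1.2]
  · rintro ⟨h, hh⟩
    refine Subtype.ext (LinearMap.ext fun z => ?_)
    have h1 : ∀ x y, Critical P Q x y → c.1 (P.front x 1) z = -h z := fun x y hxy => by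
      rw [hh, Q.rho_of_not_refines (hxy.not_refines_front 1), rho_front_one]
      simp
    rw [hΘ, LinearMap.sub_apply, h1 _ _ h₀, h1 _ _ h₀.symm, sub_self]
    rfl

/-! ### Merging two blocks -/

section Merge

variable {X : Type w} (P : LabelledSetPartition n X) (B C : P.Block) (hBC : B ≠ C) (U : X)

/-- The new block which arises by merging two blocks. -/
def mergeBlock : (P.merge B C hBC U).Block := ⟨B.1 ∪ C.1, U, Or.inl rfl⟩

/-- The old blocks which do not take part in the merging of two blocks. -/
def mergeOther (D : {D : P.Block // D ≠ B ∧ D ≠ C}) : (P.merge B C hBC U).Block :=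
  ⟨D.1.1, P.label D.1, Or.inr ⟨P.label_mem D.1, by
    rintro (h | h)
    · exact D.2.1 (Subtype.ext (congrArg Prod.fst h))
    · exact D.2.2 (Subtype.ext (congrArg Prod.fst h))⟩⟩

theorem label_mergeBlock : (P.merge B C hBC U).label (P.mergeBlock B C hBC U) = U :=
  label_eq _ _ (Or.inl rfl)

theorem label_mergeOther (D : {D : P.Block // D ≠ B ∧ D ≠ C}) :
    (P.merge B C hBC U).label (P.mergeOther B C hBC U D) = P.label D.1 :=
  label_eq _ _ (Or.inr ⟨P.label_mem D.1, by
    rintro (h | h)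
    · exact D.2.1 (Subtype.ext (congrArg Prod.fst h))
    · exact D.2.2 (Subtype.ext (congrArg Prod.fst h))⟩)

theorem bijective_mergeBlock : Function.Bijective
    (Sum.elim (fun _ : Unit => P.mergeBlock B C hBC U) (P.mergeOther B C hBC U)) := by
  have hne : ∀ D, P.mergeBlock B C hBC U ≠ P.mergeOther B C hBC U D := by
    intro D h
    obtain ⟨x, hx⟩ := P.block_nonempty B
    have h' : B.1 ∪ C.1 = D.1.1 := congrArg Subtype.val h
    exact D.2.1 (P.block_eq (h' ▸ Finset.mem_union_left _ hx) hx)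
  constructor
  · rintro (a | a) (b | b) hab
    · rfl
    · exact absurd hab (hne b)
    · exact absurd hab.symm (hne a)
    · have h' : a.1.1 = b.1.1 := congrArg (fun E : (P.merge B C hBC U).Block => E.1) hab
      exact congrArg Sum.inr (Subtype.ext (Subtype.ext h'))
  · rintro ⟨D, x, h | ⟨h, h'⟩⟩
    · exact ⟨Sum.inl (), Subtype.ext (congrArg Prod.fst h).symm⟩
    · refine ⟨Sum.inr ⟨⟨D, x, h⟩, ?_, ?_⟩, rfl⟩
      · rintro rfl
        exact h' (Or.inl (Prod.ext rfl (P.label_eq ⟨D, x, h⟩ h).symm))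
      · rintro rfl
        exact h' (Or.inr (Prod.ext rfl (P.label_eq ⟨D, x, h⟩ h).symm))

theorem same_merge {x y : Fin n} : (P.merge B C hBC U).Same x y ↔
    P.Same x y ∨ (x ∈ B.1 ∪ C.1 ∧ y ∈ B.1 ∪ C.1) := by
  constructor
  · rintro ⟨D, hx, hy⟩
    obtain ⟨s | s, rfl⟩ := (P.bijective_mergeBlock B C hBC U).2 D
    · exact Or.inr ⟨hx, hy⟩
    · exact Or.inl ⟨s.1, hx, hy⟩
  · rintro (⟨D, hx, hy⟩ | ⟨hx, hy⟩)
    · by_cases h : D = B ∨ D = C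
      · refine ⟨P.mergeBlock B C hBC U, ?_⟩
        rcases h with rfl | rfl
        · exact ⟨Finset.mem_union_left _ hx, Finset.mem_union_left _ hy⟩
        · exact ⟨Finset.mem_union_right _ hx, Finset.mem_union_right _ hy⟩
      · rw [not_or] at h
        exact ⟨P.mergeOther B C hBC U ⟨D, h⟩, hx, hy⟩
    · exact ⟨P.mergeBlock B C hBC U, hx, hy⟩

variable {P} {Q : LabelledSetPartition n X}

/-- Recognises merges pointwise, which reduces the absence of other arrows to a case analysis of
critical pairs and labels. -/
theorem eq_merge {x₀ y₀ : Fin n} (hxy : P.blockOf x₀ ≠ P.blockOf y₀) (h₀ : Q.Same x₀ y₀)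
    (huniq : ∀ x y, Q.Same x y → ¬ P.Same x y →
      (P.Same x₀ x ∧ P.Same y₀ y) ∨ (P.Same x₀ y ∧ P.Same y₀ x))
    (hle : ∀ x y, P.Same x y → Q.Same x y)
    (hlabel : ∀ x, ¬ P.Same x₀ x → ¬ P.Same y₀ x →
      P.label (P.blockOf x) = Q.label (Q.blockOf x)) :
    Q = P.merge (P.blockOf x₀) (P.blockOf y₀) hxy (Q.label (Q.blockOf x₀)) := by
  have hmem : ∀ x, x ∈ (P.blockOf x₀).1 ∪ (P.blockOf y₀).1 ↔ P.Same x₀ x ∨ P.Same y₀ x := by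
    intro x
    rw [Finset.mem_union, mem_block_iff, mem_block_iff, same_iff, same_iff, eq_comm,
      eq_comm (a := P.blockOf x)]
  refine eq_of_same (fun x y => ?_) fun x => ?_
  · rw [same_merge, hmem, hmem]
    constructor
    · intro h
      by_cases h' : P.Same x y
      · exact Or.inl h'
      · have := huniq x y h h'
        tauto
    · have hQ : ∀ x, P.Same x₀ x ∨ P.Same y₀ x → Q.Same x₀ x := by
        rintro x (h | h)
        · exact hle _ _ h
        · exact h₀.trans (hle _ _ h)
      rintro (h | ⟨hx, hy⟩)
      · exact hle x y h
      · exact (hQ x hx).symm.trans (hQ y hy)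
  · by_cases h : P.Same x₀ x ∨ P.Same y₀ x
    · have h1 : (P.merge _ _ hxy (Q.label (Q.blockOf x₀))).blockOf x = P.mergeBlock _ _ hxy _ :=
        blockOf_eq ((hmem x).2 h)
      have h2 : Q.Same x₀ x := h.elim (hle _ _) fun h => h₀.trans (hle _ _ h)
      rw [h1, label_mergeBlock, (Q.same_iff).1 h2]
    · rw [not_or] at h
      have h1 : (P.merge _ _ hxy (Q.label (Q.blockOf x₀))).blockOf x = P.mergeOther _ _ hxy _
          ⟨P.blockOf x, fun h' => h.1 (P.same_iff.2 h'.symm),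
            fun h' => h.2 (P.same_iff.2 h'.symm)⟩ :=
        blockOf_eq (P.mem_blockOf x)
      rw [h1, label_mergeOther, hlabel x h.1 h.2]

end Merge

end LabelledSetPartition

/-! ### The number of arrows for a merging of two blocks -/

namespace LabelledSetPartition

variable {k : Type u} [Field k] {G : Type v} [Group G] {n : ℕ} [NeZero n]
  (P : LabelledSetPartition n (Irr k G)) (B C : P.Block) (hBC : B ≠ C) (U : Irr k G)

/-- The tensor product of the spaces which belong to the blocks other than `B` and `C`. -/
abbrev OtherCarrier : Type (max u v) :=
  ⨂[k] j : {D : P.Block // D ≠ B ∧ D ≠ C}, (P.label j.1).Carrier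

/-- The action of a family of elements of `G` on the blocks other than `B` and `C`. -/
noncomputable def otherMap (δ : {D : P.Block // D ≠ B ∧ D ≠ C} → G) :
    P.OtherCarrier B C →ₗ[k] P.OtherCarrier B C :=
  PiTensorProduct.map fun j => (P.label j.1).rho (δ j)

theorem otherMap_one : P.otherMap B C 1 = LinearMap.id := by
  simp only [otherMap, Pi.one_apply, map_one]
  exact PiTensorProduct.map_id

/-- On the union of `B` and `C` the label of `σ` is `g`, on another block `D` it is `δ D`. -/
def HasLabels (σ : OrderedGPartition n G) (g : G)
    (δ : {D : P.Block // D ≠ B ∧ D ≠ C} → G) : Prop :=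
  (∀ x ∈ B.1 ∪ C.1, σ.lab x = g) ∧ ∀ j, ∀ x ∈ j.1.1, σ.lab x = δ j

theorem exists_hasLabels_of_refines {σ : OrderedGPartition n G}
    (h : (P.merge B C hBC U).Refines σ) : ∃ g δ, P.HasLabels B C σ g δ :=
  ⟨h.value (P.mergeBlock B C hBC U), fun j => h.value (P.mergeOther B C hBC U j),
    fun _ hx => (h.value_eq_lab (B := P.mergeBlock B C hBC U) hx).symm,
    fun j _ hx => (h.value_eq_lab (B := P.mergeOther B C hBC U j) hx).symm⟩

/-- The label on the merged block and those on the other blocks vary independently; this is what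
lets equivariance be tested in each tensor factor separately. -/
theorem exists_refines_hasLabels (g : G) (δ : {D : P.Block // D ≠ B ∧ D ≠ C} → G) :
    ∃ σ, (P.merge B C hBC U).Refines σ ∧ P.HasLabels B C σ g δ := by
  let E := Equiv.ofBijective _ (P.bijective_mergeBlock B C hBC U)
  let γ : (P.merge B C hBC U).Block → G := fun D => Sum.elim (fun _ => g) δ (E.symm D)
  refine ⟨(P.merge B C hBC U).ordered γ, refines_ordered _ _, fun x hx => ?_, fun j x hx => ?_⟩
  · have h1 : (P.merge B C hBC U).blockOf x = E (Sum.inl ()) :=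
      blockOf_eq (B := P.mergeBlock B C hBC U) hx
    rw [lab_ordered, h1]
    simp [γ]
  · have h1 : (P.merge B C hBC U).blockOf x = E (Sum.inr j) :=
      blockOf_eq (B := P.mergeOther B C hBC U j) hx
    rw [lab_ordered, h1]
    simp [γ]

theorem refines_of_merge {σ : OrderedGPartition n G} (h : (P.merge B C hBC U).Refines σ) :
    P.Refines σ :=
  refines_iff.2 fun x y hxy =>
    refines_iff.1 h x y ((P.same_merge B C hBC U).2 (Or.inl hxy))

theorem exists_split_merge :
    ∃ e : (P.merge B C hBC U).Carrier ≃ₗ[k] U.Carrier ⊗[k] P.OtherCarrier B C,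
      ∀ (σ : OrderedGPartition n G) g δ, (P.merge B C hBC U).Refines σ → P.HasLabels B C σ g δ →
        ∀ z, e ((P.merge B C hBC U).rho σ z) =
          TensorProduct.map (U.rho g) (P.otherMap B C δ) (e z) := by
  let Q := P.merge B C hBC U
  let e₁ := PiTensorProduct.split (k := k) (fun D : Q.Block => (Q.label D).Carrier) _ _
    (P.bijective_mergeBlock B C hBC U)
  have h₁ : ∀ (σ : OrderedGPartition n G) g δ, Q.Refines σ → P.HasLabels B C σ g δ →
      ∀ z, e₁ (Q.rho σ z) = TensorProduct.map ((Q.label (P.mergeBlock B C hBC U)).rho g)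
        (PiTensorProduct.map fun j => (Q.label (P.mergeOther B C hBC U j)).rho (δ j)) (e₁ z) := by
    intro σ g δ hσ hl z
    rw [Q.rho_of_refines hσ]
    refine (PiTensorProduct.split_map _ _ _ _ _ _).trans ?_
    have hg : hσ.value (P.mergeBlock B C hBC U) = g := by
      obtain ⟨x, hx⟩ := Q.block_nonempty (P.mergeBlock B C hBC U)
      rw [hσ.value_eq_lab hx, hl.1 x hx]
    have hδ : ∀ j, hσ.value (P.mergeOther B C hBC U j) = δ j := by
      intro j
      obtain ⟨x, hx⟩ := Q.block_nonempty (P.mergeOther B C hBC U j)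
      rw [hσ.value_eq_lab hx, hl.2 j x hx]
    simp only [hg, hδ]
    rfl
  -- The labels of the merged partition agree with `U` and the old labels only propositionally, so
  -- the spaces are identified by substituting for variables `W` and `ℓ`.
  have h₂ : ∀ (W : Irr k G) (ℓ : {D : P.Block // D ≠ B ∧ D ≠ C} → Irr k G), W = U →
      (∀ j, ℓ j = P.label j.1) →
      ∃ e : W.Carrier ⊗[k] (⨂[k] j, (ℓ j).Carrier) ≃ₗ[k] U.Carrier ⊗[k] P.OtherCarrier B C,
        ∀ g (δ : {D : P.Block // D ≠ B ∧ D ≠ C} → G) z,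
          e (TensorProduct.map (W.rho g) (PiTensorProduct.map fun j => (ℓ j).rho (δ j)) z) =
            TensorProduct.map (U.rho g) (P.otherMap B C δ) (e z) := by
    rintro W ℓ rfl hℓ
    obtain rfl : ℓ = fun j => P.label j.1 := funext hℓ
    exact ⟨LinearEquiv.refl k _, fun g δ z => rfl⟩
  obtain ⟨e₂, he₂⟩ := h₂ _ _ (P.label_mergeBlock B C hBC U) (P.label_mergeOther B C hBC U)
  refine ⟨e₁.trans e₂, fun σ g δ hσ hl z => ?_⟩
  rw [LinearEquiv.trans_apply, LinearEquiv.trans_apply, ← he₂]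
  exact congrArg e₂ (h₁ σ g δ hσ hl z)

theorem bijective_other : Function.Bijective
    (Sum.elim (fun _ : Unit => (⟨C, hBC.symm⟩ : {D : P.Block // D ≠ B}))
      fun j : {D : P.Block // D ≠ B ∧ D ≠ C} => ⟨j.1, j.2.1⟩) := by
  constructor
  · rintro (a | a) (b | b) hab
    · rfl
    · exact absurd (congrArg Subtype.val hab).symm b.2.2
    · exact absurd (congrArg Subtype.val hab) a.2.2
    · have h : a.1 = b.1 := congrArg (fun D : {D : P.Block // D ≠ B} => D.1) hab
      exact congrArg Sum.inr (Subtype.ext h)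
  · intro D
    by_cases h : D.1 = C
    · exact ⟨Sum.inl (), Subtype.ext h.symm⟩
    · exact ⟨Sum.inr ⟨D.1, D.2, h⟩, rfl⟩

/-- Elements that are constant on `B ∪ C` give both factors the same group element: this is the
source of the diagonal action on $V_B\otimes V_C$. -/
theorem exists_split_pair (hBC : B ≠ C) :
    ∃ e : P.Carrier ≃ₗ[k]
        ((P.label B).Carrier ⊗[k] (P.label C).Carrier) ⊗[k] P.OtherCarrier B C,
      ∀ (σ : OrderedGPartition n G) g δ, P.Refines σ → P.HasLabels B C σ g δ →
        ∀ z, e (P.rho σ z) =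
          TensorProduct.map (TensorProduct.map ((P.label B).rho g) ((P.label C).rho g))
            (P.otherMap B C δ) (e z) := by
  let e₁ := PiTensorProduct.split (k := k) (fun D : P.Block => (P.label D).Carrier) _ _
    (bijective_sumElim B)
  let e₂ := PiTensorProduct.split (k := k)
    (fun D : {D : P.Block // D ≠ B} => (P.label D.1).Carrier) _ _ (P.bijective_other B C hBC)
  let e₃ := TensorProduct.congr (LinearEquiv.refl k (P.label B).Carrier) e₂
  let e₄ := (TensorProduct.assoc k (P.label B).Carrier (P.label C).Carrier
    (P.OtherCarrier B C)).symm
  refine ⟨e₁.trans (e₃.trans e₄), fun σ g δ hσ hl z => ?_⟩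
  have hB : hσ.value B = g := by
    obtain ⟨x, hx⟩ := P.block_nonempty B
    rw [hσ.value_eq_lab hx, hl.1 x (Finset.mem_union_left _ hx)]
  have hC : hσ.value C = g := by
    obtain ⟨x, hx⟩ := P.block_nonempty C
    rw [hσ.value_eq_lab hx, hl.1 x (Finset.mem_union_right _ hx)]
  have hδ : (fun j : {D : P.Block // D ≠ B ∧ D ≠ C} => (P.label j.1).rho (hσ.value j.1)) =
      fun j => (P.label j.1).rho (δ j) := by
    funext j
    obtain ⟨x, hx⟩ := P.block_nonempty j.1
    rw [hσ.value_eq_lab hx, hl.2 j x hx]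
  have h₁ : e₁ (P.rho σ z) = TensorProduct.map ((P.label B).rho g)
      (PiTensorProduct.map fun D : {D : P.Block // D ≠ B} => (P.label D.1).rho (hσ.value D.1))
        (e₁ z) := by
    rw [P.rho_of_refines hσ]
    refine (PiTensorProduct.split_map _ _ _ _ _ _).trans ?_
    rw [hB]
  have h₂ : ∀ y, e₂ (PiTensorProduct.map (fun D : {D : P.Block // D ≠ B} =>
      (P.label D.1).rho (hσ.value D.1)) y) =
        TensorProduct.map ((P.label C).rho g) (P.otherMap B C δ) (e₂ y) := by
    intro y
    refine (PiTensorProduct.split_map _ _ _ _ _ _).trans ?_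
    rw [otherMap, ← hδ, ← hC]
  simp only [LinearEquiv.trans_apply]
  rw [h₁]
  generalize e₁ z = y
  induction y using TensorProduct.induction_on with
  | zero => simp
  | add y y' hy hy' => simp only [map_add, hy, hy']
  | tmul b r =>
    have h3 : ∀ b r, e₃ (b ⊗ₜ r) = b ⊗ₜ e₂ r := fun b r => rfl
    rw [TensorProduct.map_tmul, h3, h3, h₂]
    generalize e₂ r = s
    induction s using TensorProduct.induction_on with
    | zero => simp
    | add y y' hy hy' => simp only [map_add, TensorProduct.tmul_add, hy, hy']
    | tmul c r => rfl

variable [IsAlgClosed k] [Finite G]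

/-- Equivariance on the untouched blocks forces the form $\varphi\otimes 1$ by Schur's lemma, and
equivariance on the merged block then says that $\varphi : V_B\otimes V_C\to U$ is a $G$-map. -/
theorem rank_equivariantMaps_merge (hG : (Nat.card G : k) ≠ 0) :
    Module.rank k (equivariantMaps P (P.merge B C hBC U)) =
      dimHomTensor U (P.label B) (P.label C) := by
  obtain ⟨eP, heP⟩ := P.exists_split_pair B C hBC
  obtain ⟨eQ, heQ⟩ := P.exists_split_merge B C hBC U
  let ρ := (P.label B).rho.tprod (P.label C).rho
  have hρ : ∀ g, ρ g = TensorProduct.map ((P.label B).rho g) ((P.label C).rho g) := fun _ => rfl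
  have hR : Nontrivial (P.OtherCarrier B C) := Irr.nontrivial_piTensorProduct _
  let Ψ : ρ.IntertwiningMap U.rho →ₗ[k] equivariantMaps P (P.merge B C hBC U) :=
    { toFun := fun φ => ⟨eQ.symm.toLinearMap ∘ₗ TensorProduct.map φ.toLinearMap LinearMap.id ∘ₗ
          eP.toLinearMap, fun σ hσ z => by
        obtain ⟨g, δ, hl⟩ := P.exists_hasLabels_of_refines B C hBC U hσ
        simp only [LinearMap.comp_apply, LinearEquiv.coe_coe]
        rw [LinearEquiv.symm_apply_eq, heQ σ g δ hσ hl,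
          heP σ g δ (P.refines_of_merge B C hBC U hσ) hl, eQ.apply_symm_apply]
        rw [← LinearMap.comp_apply, ← LinearMap.comp_apply, ← TensorProduct.map_comp,
          ← TensorProduct.map_comp, ← hρ, φ.isIntertwining', LinearMap.id_comp,
          LinearMap.comp_id]⟩
      map_add' := fun φ ψ => by
        refine Subtype.ext (LinearMap.ext fun z => ?_)
        change eQ.symm (TensorProduct.map (φ.toLinearMap + ψ.toLinearMap) LinearMap.id (eP z)) =
          eQ.symm _ + eQ.symm _
        rw [TensorProduct.map_add_left, LinearMap.add_apply, map_add]
        rfl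
      map_smul' := fun r φ => by
        refine Subtype.ext (LinearMap.ext fun z => ?_)
        change eQ.symm (TensorProduct.map (r • φ.toLinearMap) LinearMap.id (eP z)) =
          r • eQ.symm _
        rw [TensorProduct.map_smul_left, LinearMap.smul_apply, map_smul]
        rfl }
  have hΨ : Function.Bijective Ψ := by
    constructor
    · intro φ ψ h
      have h1 : TensorProduct.map φ.toLinearMap
          (LinearMap.id : P.OtherCarrier B C →ₗ[k] P.OtherCarrier B C) =
            TensorProduct.map ψ.toLinearMap LinearMap.id := by
        refine LinearMap.ext fun y => ?_
        obtain ⟨z, rfl⟩ := eP.surjective y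
        exact eQ.symm.injective (LinearMap.congr_fun (congrArg Subtype.val h) z)
      have h2 := TensorProduct.map_id_injective h1
      exact DFunLike.ext _ _ fun x => LinearMap.congr_fun h2 x
    · rintro ⟨d, hd⟩
      let d' := eQ.toLinearMap ∘ₗ d ∘ₗ eP.symm.toLinearMap
      have hd' : ∀ g δ y, d' (TensorProduct.map (ρ g) (P.otherMap B C δ) y) =
          TensorProduct.map (U.rho g) (P.otherMap B C δ) (d' y) := by
        intro g δ y
        obtain ⟨σ, hσ, hl⟩ := P.exists_refines_hasLabels B C hBC U g δ
        obtain ⟨z, rfl⟩ := eP.surjective y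
        rw [hρ, ← heP σ g δ (P.refines_of_merge B C hBC U hσ) hl]
        simp only [d', LinearMap.comp_apply, LinearEquiv.coe_coe, eP.symm_apply_apply]
        rw [hd σ hσ, heQ σ g δ hσ hl]
      obtain ⟨φ, hφ⟩ := TensorProduct.exists_eq_map_id (P.otherMap B C)
        (fun φ hφ => PiTensorProduct.eq_smul_of_commute
          (fun j : {D : P.Block // D ≠ B ∧ D ≠ C} => (P.label j.1).rho) φ hφ) d' (fun δ y => by
            have := hd' 1 δ y
            rwa [map_one, map_one] at this)
      have hφ' : ∀ g, φ ∘ₗ ρ g = U.rho g ∘ₗ φ := by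
        intro g
        apply TensorProduct.map_id_injective (R := P.OtherCarrier B C)
        refine LinearMap.ext fun y => ?_
        have := hd' g 1 y
        rw [otherMap_one, hφ, ← LinearMap.comp_apply, ← LinearMap.comp_apply,
          ← TensorProduct.map_comp, ← TensorProduct.map_comp, LinearMap.id_comp] at this
        exact this
      refine ⟨⟨φ, hφ'⟩, Subtype.ext (LinearMap.ext fun z => ?_)⟩
      change eQ.symm (TensorProduct.map φ LinearMap.id (eP z)) = d z
      rw [← hφ]
      simp [d']
  rw [← (LinearEquiv.ofBijective Ψ hΨ).rank_eq]
  -- The maps found go from $V_B\otimes V_C$ to `U`, while the arrow count uses maps from `U`; the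
  -- trace pairing in both directions equates the dimensions.
  change _ = Module.rank k (U.rho.IntertwiningMap ρ)
  rw [← Module.finrank_eq_rank, ← Module.finrank_eq_rank]
  exact congrArg _ (le_antisymm (Representation.finrank_intertwiningMap_le hG _ _)
    (Representation.finrank_intertwiningMap_le hG _ _))

end LabelledSetPartition

/-! ### The quiver -/

namespace LabelledSetPartition

variable {k : Type u} [Field k] {G : Type v} [Group G] {n : ℕ} [NeZero n]

theorem critical_merge {P : LabelledSetPartition n (Irr k G)} {B C : P.Block} {hBC : B ≠ C}
    {U : Irr k G} {x₀ y₀ : Fin n} (hx : x₀ ∈ B.1) (hy : y₀ ∈ C.1) :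
    Critical P (P.merge B C hBC U) x₀ y₀ :=
  ⟨(P.same_merge B C hBC U).2
    (Or.inr ⟨Finset.mem_union_left _ hx, Finset.mem_union_right _ hy⟩),
    fun h => hBC (by rw [← blockOf_eq hx, ← blockOf_eq hy, P.same_iff.1 h])⟩

theorem critical_merge_unique {P : LabelledSetPartition n (Irr k G)} {B C : P.Block} {hBC : B ≠ C}
    {U : Irr k G} {x₀ y₀ : Fin n} (hx : x₀ ∈ B.1) (hy : y₀ ∈ C.1) (x y : Fin n)
    (h : Critical P (P.merge B C hBC U) x y) :
    (P.Same x₀ x ∧ P.Same y₀ y) ∨ (P.Same x₀ y ∧ P.Same y₀ x) := by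
  obtain ⟨h1, h2⟩ := (P.same_merge B C hBC U).1 h.1 |>.resolve_left h.2
  rcases Finset.mem_union.1 h1 with hxB | hxC <;> rcases Finset.mem_union.1 h2 with hyB | hyC
  · exact absurd ⟨B, hxB, hyB⟩ h.2
  · exact Or.inl ⟨⟨B, hx, hxB⟩, ⟨C, hy, hyC⟩⟩
  · exact Or.inr ⟨⟨B, hx, hyB⟩, ⟨C, hy, hxC⟩⟩
  · exact absurd ⟨C, hxC, hyC⟩ h.2

variable {P Q : LabelledSetPartition n (Irr k G)}
  {S T : SimpleClass (MonoidAlgebra k (OrderedGPartition n G))}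

theorem gabrielArrows_merge [IsAlgClosed k] [Finite G] (hG : (Nat.card G : k) ≠ 0)
    (B C : P.Block) (hBC : B ≠ C) (U : Irr k G)
    (e : S.rep ≃ₗ[MonoidAlgebra k (OrderedGPartition n G)] P.rho.asModule)
    (f : T.rep ≃ₗ[MonoidAlgebra k (OrderedGPartition n G)] (P.merge B C hBC U).rho.asModule) :
    gabrielArrows k (MonoidAlgebra k (OrderedGPartition n G)) S T =
      dimHomTensor U (P.label B) (P.label C) := by
  obtain ⟨x₀, hx⟩ := P.block_nonempty B
  obtain ⟨y₀, hy⟩ := P.block_nonempty C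
  rw [← P.rank_equivariantMaps_merge B C hBC U hG]
  exact gabrielArrows_eq_rank_equivariantMaps (critical_merge hx hy)
    (critical_merge_unique hx hy) (fun x y h => (P.same_merge B C hBC U).2 (Or.inl h)) e f

theorem gabrielArrows_eq_zero_of_ne_merge [Finite G] (hG : (Nat.card G : k) ≠ 0)
    (hne : ¬ ∃ (B C : P.Block) (hBC : B ≠ C) (U : Irr k G), Q = P.merge B C hBC U)
    (e : S.rep ≃ₗ[MonoidAlgebra k (OrderedGPartition n G)] P.rho.asModule)
    (f : T.rep ≃ₗ[MonoidAlgebra k (OrderedGPartition n G)] Q.rho.asModule) :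
    gabrielArrows k (MonoidAlgebra k (OrderedGPartition n G)) S T = 0 := by
  by_cases hle : ∀ x y, P.Same x y → Q.Same x y
  swap
  · push Not at hle
    obtain ⟨x, y, hP, hQ⟩ := hle
    exact gabrielArrows_eq_zero_of_cocycles e f fun c => cocycle_inner_of_not_le c hP hQ
  by_cases hcrit : ∃ x y, Critical P Q x y
  swap
  · refine gabrielArrows_eq_zero_of_cocycles e f fun c => cocycle_inner_of_same c hG fun x y =>
      ⟨hle x y, fun h => ?_⟩
    by_contra h'
    exact hcrit ⟨x, y, h, h'⟩
  obtain ⟨x₀, y₀, h₀⟩ := hcrit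
  by_cases huniq : ∀ x y, Critical P Q x y →
      (P.Same x₀ x ∧ P.Same y₀ y) ∨ (P.Same x₀ y ∧ P.Same y₀ x)
  swap
  · push Not at huniq
    obtain ⟨x, y, h, h1, h2⟩ := huniq
    exact gabrielArrows_eq_zero_of_cocycles e f fun c => cocycle_inner_of_critical c hle h₀ h
      (fun h' => h1 h'.1 h'.2) fun h' => h2 h'.1 h'.2
  rw [gabrielArrows_eq_rank_equivariantMaps h₀ huniq hle e f]
  by_cases hlabel : ∀ x, ¬ P.Same x₀ x → ¬ P.Same y₀ x →
      P.label (P.blockOf x) = Q.label (Q.blockOf x)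
  · exact absurd ⟨_, _, fun h => h₀.2 (P.same_iff.2 h), _, eq_merge
      (fun h => h₀.2 (P.same_iff.2 h)) h₀.1 (fun x y h h' => huniq x y ⟨h, h'⟩) hle hlabel⟩ hne
  · push Not at hlabel
    obtain ⟨x, hx, hy, hxne⟩ := hlabel
    -- `x` lies outside the two joined blocks, so its block is common to `P` and `Q`. Its two labels
    -- differ, and Schur's lemma leaves no nonzero equivariant map.
    have hsame : ∀ y, P.Same x y ↔ Q.Same x y := fun y => ⟨hle x y, fun h => by
      by_contra h'
      rcases huniq x y ⟨h, h'⟩ with h1 | h1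
      · exact hx h1.1
      · exact hy h1.2⟩
    have : equivariantMaps P Q = ⊥ := (Submodule.eq_bot_iff _).2 fun d hd =>
      eq_zero_of_label_ne hsame hxne d fun σ _ hσ z => hd σ hσ z
    rw [this]
    exact rank_subsingleton' k (⊥ : Submodule k (P.Carrier →ₗ[k] Q.Carrier))

end LabelledSetPartition

theorem theorem6p3 (k : Type u) [Field k] [IsAlgClosed k] (G : Type v) [Group G] [Finite G]
    (hchar : ¬ ringChar k ∣ Nat.card G) (n : ℕ) [NeZero n] :
    ∃ Φ : LabelledSetPartition n (Irr k G) ≃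
        SimpleClass (MonoidAlgebra k (OrderedGPartition n G)),
      (∀ P : LabelledSetPartition n (Irr k G),
        Nonempty ((Φ P).rep ≃ₗ[MonoidAlgebra k (OrderedGPartition n G)] P.action.asModule)) ∧
      (∀ (P : LabelledSetPartition n (Irr k G)) (B C : P.Block) (hBC : B ≠ C) (U : Irr k G),
        gabrielArrows k (MonoidAlgebra k (OrderedGPartition n G)) (Φ P) (Φ (P.merge B C hBC U)) =
          dimHomTensor U (P.label B) (P.label C)) ∧
      (∀ P Q : LabelledSetPartition n (Irr k G),
        (¬ ∃ (B C : P.Block) (hBC : B ≠ C) (U : Irr k G), Q = P.merge B C hBC U) →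
        gabrielArrows k (MonoidAlgebra k (OrderedGPartition n G)) (Φ P) (Φ Q) = 0) := by
  have hG : (Nat.card G : k) ≠ 0 := fun h => hchar ((ringChar.spec k _).1 h)
  refine ⟨LabelledSetPartition.simpleEquiv hG, fun P => P.nonempty_simple_equiv,
    fun P B C hBC U => ?_, fun P Q hne => ?_⟩
  · obtain ⟨e⟩ := P.nonempty_simple_equiv
    obtain ⟨f⟩ := (P.merge B C hBC U).nonempty_simple_equiv
    exact LabelledSetPartition.gabrielArrows_merge hG B C hBC U e f
  · obtain ⟨e⟩ := P.nonempty_simple_equiv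
    obtain ⟨f⟩ := Q.nonempty_simple_equiv
    exact LabelledSetPartition.gabrielArrows_eq_zero_of_ne_merge hG hne e f
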